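/- **Theorem 1.2.** Let $1\le k\le n$ be integers and put $K=k(n-k+1)$, so $K/k=n-k+1$. Let $\Lambda$ be the ring of symmetric functions in $x_1,x_2,\dots$ with coefficients in $\mathbb{Q}(q,t)$. The Hall inner product is the unique bilinear form on $\Lambda$ for which the Schur functions $s_\mu=\det(h_{\mu_i-i+j})$ are orthonormal, and $s_\lambda^\perp:\Lambda\to\Lambda$ is the (unique) linear operator with $\langle s_\lambda^\perp f,g\rangle=\langle f,s_\lambda g\rangle$ for all $f,g\in\Lambda$; both exist. Then the two series below are symmetric functions, and $$ s_{(k-1)^{n-k}}^{\perp}\sum_{\pi\in \mathrm{WPF}_{K,k}}t^{\mathrm{area}(\pi)}q^{\mathrm{dinv}(\pi)}x^{\pi}=\sum_{P\in \mathrm{WLD}_{n,k}^{\mathrm{stack}}} t^{\mathrm{area}(P)} q^{\mathrm{hdinv}(P)} x^P . $$ Here $(k-1)^{n-k}$ is the partition with $n-k$ parts equal to $k-1$, $x^\pi$ (resp. $x^P$) is the product of $x_i$ over all labels $i$, and boxes are named by their lower left corners. The sets and statistics are as follows. *Rational word parking functions.* $\mathrm{WPF}_{K,k}$ is the set of lattice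 paths $D$ with unit north and east steps from $(0,0)$ to $(k,K)$ that stay weakly above the line from $(0,0)$ to $(k,K)$, together with a labeling of the north steps by positive integers that strictly increases up each vertical run; the label of a north step is placed in the box to its right. * $\mathrm{area}(\pi)$ is the number of boxes below $D$ whose interior does not meet the region below that line. * $\mathrm{dinv}(\pi)=\mathrm{pathdinv}(D)+\mathrm{tdinv}(\pi)-\mathrm{maxtdinv}(D)$. * $\mathrm{pathdinv}(D)$ is the number of boxes $b$ of the grid above $D$ with $\frac{\mathrm{arm}(b)}{\mathrm{leg}(b)+1}\le \frac kK<\frac{\mathrm{arm}(b)+1}{\mathrm{leg}(b)}$, where $\mathrm{arm}(b)$ (resp. $\mathrm{leg}(b)$) is the number of boxes above $D$ to the right of $b$ in its row (resp. below $b$ in its column), and the right inequality holds if $\mathrm{leg}(b)=0$. * Two boxes are on the same diagonal if they differ by an integer multiple of $(1,K/k)$; the box $(x,y)$ is on the diagonal with number $y-\frac Kk x$. An ordered pair of boxes $(a,b)$ is attacking if either $a$ and $b$ are on the same diagonal with $a$ to the left of $b$, or $a$ is one diagonal below $b$ (its number is smaller by one) and to the right of $b$. * $\mathrm{tdinv}(\pi)$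 is the number of attacking pairs $(a,b)$ of labeled boxes such that the label of $a$ is strictly smaller than the label of $b$, and $\mathrm{maxtdinv}(D)$ is the largest $\mathrm{tdinv}$ of any word parking function with path $D$. *Stacked word parking functions.* $\mathrm{WLD}^{\mathrm{stack}}_{n,k}$ is the set of triples of: a stack $S$, that is, a set of boxes of the grid of height $n$ and width $k$ with exactly one box in each row, at least one in each column, and each box weakly to the right of the one below it; a lattice path from $(0,0)$ to $(k,n)$ with unit north and east steps such that every box of $S$ is below the path; and a labeling of its north steps by positive integers that strictly increases up each column. * $\mathrm{area}(P)$ is the number of boxes between the path and the stack, that is, boxes below the path and strictly to the left of the box of $S$ in the same row. * Let $w_i$ be the number of boxes of $S$ in column $i$. Insert $w_i-1$ empty columns directly to the right of column $i$ for each $i$, filling the gaps in the path with horizontal steps. This gives an $(n,n)$ word parking function $P'$, defined as above with $K=k=n$. Then $\mathrm{hdinv}(P)=\mathrm{tdinv}(P')$, the number of attacking pairs $(a,b)$ of labeled boxes of $P'$ (for diagonals of slope $1$) such that the label of $a$ is strictly smaller than the label of $b$. -/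

import Mathlib

noncomputable section

/-! ### Symmetric functions in the variables `x₁, x₂, x₃, …` -/

/-- The ring `Λ` of symmetric functions over `R`: formal power series of bounded degree in the
variables `x_i` (`i` a positive integer) that are invariant under all permutations of the
variables. -/
def SymmFunc (R : Type) [CommRing R] : Subalgebra R (MvPowerSeries ℕ+ R) where
  carrier := {f | (∀ σ : Equiv.Perm ℕ+, MvPowerSeries.renameEquiv R σ f = f) ∧
    ∃ d : ℕ, ∀ α : ℕ+ →₀ ℕ, MvPowerSeries.coeff α f ≠ 0 → α.degree ≤ d}
  mul_mem' := by
    rintro f g ⟨hf, d, hd⟩ ⟨hg, e, he⟩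
    refine ⟨fun σ => by rw [map_mul, hf, hg], d + e, fun α hα => ?_⟩
    rw [MvPowerSeries.coeff_mul] at hα
    obtain ⟨p, hp, hne⟩ := Finset.exists_ne_zero_of_sum_ne_zero hα
    rw [← Finset.HasAntidiagonal.mem_antidiagonal.mp hp, map_add]
    exact add_le_add (hd _ (left_ne_zero_of_mul hne)) (he _ (right_ne_zero_of_mul hne))
  add_mem' := by
    rintro f g ⟨hf, d, hd⟩ ⟨hg, e, he⟩
    refine ⟨fun σ => by rw [map_add, hf, hg], max d e, fun α hα => ?_⟩
    by_cases h : MvPowerSeries.coeff α f = 0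
    · refine le_max_of_le_right (he _ fun h' => hα ?_)
      rw [map_add, h, h', add_zero]
    · exact le_max_of_le_left (hd _ h)
  algebraMap_mem' r := by
    classical
    refine ⟨fun σ => AlgEquiv.commutes _ r, 0, fun α hα => ?_⟩
    rw [MvPowerSeries.algebraMap_apply, Algebra.algebraMap_self_apply,
      MvPowerSeries.coeff_C] at hα
    have : α = 0 := by
      by_contra h
      exact hα (if_neg h)
    simp [this]

/-- The complete homogeneous symmetric function `h_m`, the sum of all monomials of degree `m`;
it is `0` for negative `m`. -/
def hSymm (R : Type) [CommRing R] (m : ℤ) : SymmFunc R :=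
  ⟨fun α => if (α.degree : ℤ) = m then 1 else 0, by
    have hc (α : ℕ+ →₀ ℕ) : MvPowerSeries.coeff α
        (fun α => if (α.degree : ℤ) = m then 1 else 0 : MvPowerSeries ℕ+ R) =
        if (α.degree : ℤ) = m then 1 else 0 := rfl
    refine ⟨fun σ => ?_, m.toNat, fun α hα => ?_⟩
    · ext α
      obtain ⟨β, rfl⟩ : ∃ β : ℕ+ →₀ ℕ, β.embDomain σ.toEmbedding = α :=
        ⟨α.equivMapDomain σ.symm, by
          ext i
          obtain ⟨j, rfl⟩ := σ.surjective i
          exact (Finsupp.embDomain_apply_self σ.toEmbedding _ j).trans (by simp)⟩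
      refine (MvPowerSeries.coeff_embDomain_rename σ.toEmbedding _ β).trans ?_
      rw [hc, hc, Finsupp.embDomain_eq_mapDomain, Finsupp.degree_mapDomain]
    · rw [hc] at hα
      have : (α.degree : ℤ) = m := by
        by_contra h
        exact hα (if_neg h)
      omega⟩

/-- The Schur function `s_μ = det (h_{μ_i - i + j})`, where `i, j` run over the rows of `μ`. -/
def schur (R : Type) [CommRing R] (μ : YoungDiagram) : SymmFunc R :=
  Matrix.det (Matrix.of fun i j : Fin (μ.colLen 0) =>
    hSymm R ((μ.rowLen i : ℤ) - (i : ℤ) + (j : ℤ)))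

open Classical in
/-- `B` is a bilinear form on `Λ` for which the Schur functions are orthonormal. -/
def IsHallForm (R : Type) [CommRing R] (B : LinearMap.BilinForm R (SymmFunc R)) : Prop :=
  ∀ μ ν : YoungDiagram, B (schur R μ) (schur R ν) = if μ = ν then 1 else 0

/-- The Hall inner product: the bilinear form for which the Schur functions are orthonormal. -/
def hallForm (R : Type) [CommRing R] : LinearMap.BilinForm R (SymmFunc R) :=
  Classical.epsilon (IsHallForm R)

/-- `T` is adjoint, for the Hall inner product, to multiplication by `s`. -/
def IsSkewing (R : Type) [CommRing R] (s : SymmFunc R) (T : SymmFunc R →ₗ[R] SymmFunc R) : Prop :=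
  ∀ f g : SymmFunc R, hallForm R (T f) g = hallForm R f (s * g)

/-- The skewing operator `s^⊥`: the operator adjoint, for the Hall inner product, to
multiplication by `s`. -/
def skew (R : Type) [CommRing R] (s : SymmFunc R) : SymmFunc R →ₗ[R] SymmFunc R :=
  Classical.epsilon (IsSkewing R s)

/-- The partition `(b^a) = (b, b, …, b)` with `a` parts equal to `b`. -/
def rectPartition (a b : ℕ) : YoungDiagram :=
  YoungDiagram.ofRowLens (List.replicate a b) (List.pairwise_replicate_of_refl).sortedGE

/-- The field `ℚ(q,t)`. -/
abbrev QT : Type := FractionRing (MvPolynomial (Fin 2) ℚ)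

/-- The indeterminate `q` of `ℚ(q,t)`. -/
def qVar : QT := algebraMap (MvPolynomial (Fin 2) ℚ) QT (MvPolynomial.X 0)

/-- The indeterminate `t` of `ℚ(q,t)`. -/
def tVar : QT := algebraMap (MvPolynomial (Fin 2) ℚ) QT (MvPolynomial.X 1)

/-! ### Rational word parking functions

A box of the grid is named by the coordinates `(x, y)` of its lower left corner. A lattice path
with `N` north steps is given by the `x`-coordinates `col 0 ≤ col 1 ≤ ⋯` of its north steps, from
bottom to top: the `r`-th one goes from `(col r, r)` to `(col r, r + 1)`, and the box to its right,
which carries its label, is `(col r, r)`. The box `(x, y)` is above (left of) the path iff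
`x < col y`, and below (right of) it iff `col y ≤ x`. -/

/-- A rational Dyck path of height `K` and width `k`: a lattice path from `(0,0)` to `(k,K)` that
stays weakly above the line from `(0,0)` to `(k,K)`, that is, all its north steps start weakly
above this line. -/
structure RationalDyckPath (K k : ℕ) where
  col : Fin K → ℕ
  mono : Monotone col
  above : ∀ r : Fin K, K * col r ≤ k * r

/-- A `(K,k)` word parking function: a rational Dyck path with north steps labeled by positive
integers that strictly increase up each vertical run. -/
structure WordParkingFunction (K k : ℕ) where
  path : RationalDyckPath K k
  label : Fin K → ℕ+
  strict : ∀ r s : Fin K, r < s → path.col r = path.col s → label r < label s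

/-- The number of the diagonal of slope `m` that contains the box `(x, y)`: two boxes have the
same number iff they differ by an integer multiple of `(1, m)`, and the number increases by one
from a diagonal to the next one above it. -/
def diagonal (m x y : ℕ) : ℤ := (y : ℤ) - (m : ℤ) * (x : ℤ)

/-- The box `a` attacks the box `b` (in this order): either `a` and `b` are on the same diagonal
with `a` to the left of `b`, or `a` is one diagonal below `b` and to the right of `b`. -/
def Attacks (m : ℕ) (a b : ℕ × ℕ) : Prop :=
  (diagonal m a.1 a.2 = diagonal m b.1 b.2 ∧ a.1 < b.1) ∨
  (diagonal m a.1 a.2 = diagonal m b.1 b.2 - 1 ∧ b.1 < a.1)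

namespace RationalDyckPath

variable {K k : ℕ}

/-- The number of whole boxes `(x, y)` between the path and the main diagonal: the box is below
the path, and its lower right corner is weakly above the diagonal. -/
def area (D : RationalDyckPath K k) : ℕ :=
  Nat.card {b : Fin k × Fin K //
    D.col b.2 ≤ (b.1 : ℕ) ∧ K * ((b.1 : ℕ) + 1) ≤ k * (b.2 : ℕ)}

/-- The arm of the box `(x, y)`: the number of boxes to its right that are above the path. -/
def arm (D : RationalDyckPath K k) (x : Fin k) (y : Fin K) : ℕ :=
  Nat.card {x' : Fin k // x < x' ∧ (x' : ℕ) < D.col y}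

/-- The leg of the box `(x, y)`: the number of boxes below it that are above the path. -/
def leg (D : RationalDyckPath K k) (x : Fin k) (y : Fin K) : ℕ :=
  Nat.card {y' : Fin K // y' < y ∧ (x : ℕ) < D.col y'}

/-- The number of boxes above the path with `arm / (leg + 1) ≤ k / K < (arm + 1) / leg`. The
inequalities are multiplied out; the right one holds when `leg = 0`. -/
def pathdinv (D : RationalDyckPath K k) : ℕ :=
  Nat.card {b : Fin k × Fin K // (b.1 : ℕ) < D.col b.2 ∧
    D.arm b.1 b.2 * K ≤ k * (D.leg b.1 b.2 + 1) ∧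
    k * D.leg b.1 b.2 < (D.arm b.1 b.2 + 1) * K}

end RationalDyckPath

namespace WordParkingFunction

variable {K k : ℕ}

/-- The number of attacking pairs of labeled boxes `a, b` such that the label of `a` is smaller
than that of `b`. The diagonals have slope `K / k`, where `k` divides `K`. -/
def tdinv (P : WordParkingFunction K k) : ℕ :=
  Nat.card {p : Fin K × Fin K //
    Attacks (K / k) (P.path.col p.1, (p.1 : ℕ)) (P.path.col p.2, (p.2 : ℕ)) ∧
    P.label p.1 < P.label p.2}

end WordParkingFunction

/-- The largest `tdinv` of all word parking functions with path `D`. -/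
def RationalDyckPath.maxtdinv {K k : ℕ} (D : RationalDyckPath K k) : ℕ :=
  sSup {d : ℕ | ∃ P : WordParkingFunction K k, P.path = D ∧ P.tdinv = d}

namespace WordParkingFunction

variable {K k : ℕ}

def area (P : WordParkingFunction K k) : ℕ := P.path.area

/-- The statistic `dinv = pathdinv + tdinv - maxtdinv`, as an integer. -/
def dinv (P : WordParkingFunction K k) : ℤ :=
  (P.path.pathdinv : ℤ) + (P.tdinv : ℤ) - (P.path.maxtdinv : ℤ)

/-- The exponent vector of the monomial `x^P`, the product of the `x_i` over all labels `i`. -/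
def content (P : WordParkingFunction K k) : ℕ+ →₀ ℕ :=
  ∑ r : Fin K, Finsupp.single (P.label r) 1

end WordParkingFunction

/-! ### Stacked word parking functions -/

/-- A stack in the grid of height `n` and width `k`: one box `(box y, y)` in each row `y`, at least
one box in each column, and each box weakly to the right of the one below it. -/
structure GridStack (n k : ℕ) where
  box : Fin n → Fin k
  mono : Monotone box
  surj : Function.Surjective box

/-- An element of `WLD^stack_{n,k}`: a stack together with a lattice path from `(0,0)` to `(k,n)`
that has all boxes of the stack below it, and a labeling of its north steps by positive integers
that strictly increases up each column. -/
structure StackedParkingFunction (n k : ℕ) where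
  stack : GridStack n k
  col : Fin n → ℕ
  mono : Monotone col
  below : ∀ r : Fin n, col r ≤ (stack.box r : ℕ)
  label : Fin n → ℕ+
  strict : ∀ r s : Fin n, r < s → col r = col s → label r < label s

namespace GridStack

variable {n k : ℕ}

/-- The number of boxes of the stack in column `j`. -/
def height (S : GridStack n k) (j : Fin k) : ℕ := Nat.card {r : Fin n // S.box r = j}

/-- The position of column `x` after `height j - 1` empty columns have been inserted to the right
of each column `j`. -/
def shift (S : GridStack n k) (x : ℕ) : ℕ :=
  x + ∑ j ∈ Finset.univ.filter (fun j : Fin k => (j : ℕ) < x), (S.height j - 1)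

theorem height_pos (S : GridStack n k) (j : Fin k) : 0 < S.height j := by
  obtain ⟨r, hr⟩ := S.surj j
  have : Nonempty {r : Fin n // S.box r = j} := ⟨⟨r, hr⟩⟩
  exact Nat.card_pos

theorem shift_strictMono (S : GridStack n k) : StrictMono S.shift := by
  intro x y h
  refine add_lt_add_of_lt_of_le h (Finset.sum_le_sum_of_subset fun j hj => ?_)
  simp only [Finset.mem_filter, Finset.mem_univ, true_and] at hj ⊢
  omega

theorem shift_le (S : GridStack n k) (r : Fin n) (x : ℕ) (hx : x ≤ (S.box r : ℕ)) :
    S.shift x ≤ r := by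
  classical
  refine (S.shift_strictMono.monotone hx).trans ?_
  set c := S.box r with hc
  have hcard : (Finset.univ.filter fun j : Fin k => (j : ℕ) < (c : ℕ)) = Finset.Iio c := by
    ext j
    simp
  have h1 : S.shift c = ∑ j ∈ Finset.Iio c, S.height j := by
    rw [shift, hcard]
    have : ∑ j ∈ Finset.Iio c, S.height j = ∑ j ∈ Finset.Iio c, (1 + (S.height j - 1)) :=
      Finset.sum_congr rfl fun j _ => by have := S.height_pos j; omega
    rw [this, Finset.sum_add_distrib]
    simp
  have h2 : ∑ j ∈ Finset.Iio c, S.height j =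
      (Finset.univ.filter fun s : Fin n => S.box s ∈ Finset.Iio c).card := by
    rw [Finset.card_eq_sum_card_fiberwise (f := S.box) (t := Finset.Iio c)
      (fun s hs => by simpa using hs)]
    refine Finset.sum_congr rfl fun j hj => ?_
    rw [height, Nat.card_eq_fintype_card, Fintype.card_subtype]
    congr 1
    ext s
    simp only [Finset.mem_filter, Finset.mem_univ, true_and]
    exact ⟨fun h => ⟨h ▸ hj, h⟩, fun h => h.2⟩
  rw [h1, h2]
  calc _ ≤ (Finset.Iio r).card := Finset.card_le_card fun s hs => by
        simp only [Finset.mem_filter, Finset.mem_univ, true_and, Finset.mem_Iio] at hs ⊢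
        by_contra hle
        exact absurd (S.mono (not_lt.mp hle)) (not_le.mpr (hc ▸ hs))
    _ = r := by simp

end GridStack

namespace StackedParkingFunction

variable {n k : ℕ}

/-- The number of boxes between the path and the stack. -/
def area (P : StackedParkingFunction n k) : ℕ :=
  Nat.card {b : Fin k × Fin n // P.col b.2 ≤ (b.1 : ℕ) ∧ b.1 < P.stack.box b.2}

/-- The ordinary `(n,n)` parking function obtained by inserting, for each column `j`, as many empty
columns to the right of it as the height of the stack in column `j` minus one. -/
def expand (P : StackedParkingFunction n k) : WordParkingFunction n n where
  path :=
    { col := fun r => P.stack.shift (P.col r)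
      mono := fun _ _ h => P.stack.shift_strictMono.monotone (P.mono h)
      above := fun r => Nat.mul_le_mul_left n (P.stack.shift_le r _ (P.below r)) }
  label := P.label
  strict := fun r s h e => P.strict r s h (P.stack.shift_strictMono.injective e)

/-- The number of diagonal inversions of the associated ordinary `(n,n)` parking function. -/
def hdinv (P : StackedParkingFunction n k) : ℕ := P.expand.tdinv

/-- The exponent vector of the monomial `x^P`, the product of the `x_i` over all labels `i`. -/
def content (P : StackedParkingFunction n k) : ℕ+ →₀ ℕ :=
  ∑ r : Fin n, Finsupp.single (P.label r) 1

end StackedParkingFunction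

/-! ### Generating functions

The coefficient of each monomial is a sum over finitely many parking functions. -/

theorem label_mem_support_of_content {N : ℕ} {l : Fin N → ℕ+} {α : ℕ+ →₀ ℕ}
    (h : ∑ r : Fin N, Finsupp.single (l r) 1 = α) (r : Fin N) : l r ∈ α.support := by
  classical
  rw [Finsupp.mem_support_iff, ← h, Finsupp.finsetSum_apply]
  refine (Finset.sum_pos' (fun _ _ => Nat.zero_le _) ⟨r, Finset.mem_univ r, ?_⟩).ne'
  simp

theorem WordParkingFunction.finite_content (K k : ℕ) (α : ℕ+ →₀ ℕ) :
    {P : WordParkingFunction K k | P.content = α}.Finite := by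
  refine Set.Finite.of_injOn (f := fun P : WordParkingFunction K k => (P.path.col, P.label))
    (t := Set.pi Set.univ (fun _ => Set.Iic k) ×ˢ Set.pi Set.univ (fun _ => (α.support : Set ℕ+)))
    (fun P hP => ⟨fun r _ => ?_, fun r _ => label_mem_support_of_content hP r⟩) ?_
    ((Set.Finite.pi' fun _ => Set.finite_Iic k).prod
      (Set.Finite.pi' fun _ => α.support.finite_toSet) |>.subset (by simp [Set.pi]))
  · have h := P.path.above r
    have hr := r.isLt
    by_contra hlt
    have h1 : k * (r : ℕ) ≤ k * K := Nat.mul_le_mul_left k hr.le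
    have h2 : K * k < K * P.path.col r :=
      Nat.mul_lt_mul_of_pos_left (not_le.mp hlt) (by omega)
    have h3 := mul_comm K k
    omega
  · rintro ⟨⟨_, _, _⟩, _, _⟩ _ ⟨⟨_, _, _⟩, _, _⟩ _ h
    obtain ⟨rfl, rfl⟩ := Prod.mk.inj h
    rfl

theorem StackedParkingFunction.finite_content (n k : ℕ) (α : ℕ+ →₀ ℕ) :
    {P : StackedParkingFunction n k | P.content = α}.Finite := by
  refine Set.Finite.of_injOn
    (f := fun P : StackedParkingFunction n k => (P.stack.box, P.col, P.label))
    (t := Set.univ ×ˢ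
      Set.pi Set.univ (fun _ => Set.Iic k) ×ˢ Set.pi Set.univ (fun _ => (α.support : Set ℕ+)))
    (fun P hP => ⟨trivial, fun r _ => (P.below r).trans (P.stack.box r).isLt.le,
      fun r _ => label_mem_support_of_content hP r⟩) ?_
    (Set.finite_univ.prod ((Set.Finite.pi' fun _ => Set.finite_Iic k).prod
      (Set.Finite.pi' fun _ => α.support.finite_toSet)) |>.subset (by simp [Set.pi]))
  rintro ⟨⟨_, _, _⟩, _, _, _, _, _⟩ _ ⟨⟨_, _, _⟩, _, _, _, _, _⟩ _ h
  obtain ⟨rfl, h⟩ := Prod.mk.inj h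
  obtain ⟨rfl, rfl⟩ := Prod.mk.inj h
  rfl

/-- `∑ t^area(P) q^dinv(P) x^P` over all `(K,k)` word parking functions `P`. -/
def wpfSeries (K k : ℕ) : MvPowerSeries ℕ+ QT := fun α =>
  ∑ P ∈ (WordParkingFunction.finite_content K k α).toFinset, tVar ^ P.area * qVar ^ P.dinv

/-- `∑ t^area(P) q^hdinv(P) x^P` over all stacked word parking functions `P`. -/
def stackedSeries (n k : ℕ) : MvPowerSeries ℕ+ QT := fun α =>
  ∑ P ∈ (StackedParkingFunction.finite_content n k α).toFinset, tVar ^ P.area * qVar ^ P.hdinv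

end

/-! Write `l = n - k` and `m = l + 1`. Under the Hall form, pairing with `h_α` extracts the
coefficient of `x^α` (`hallForm_hProd`), so the coefficient of `x^M` in `s^⊥ f` is `⟨f, s h_M⟩`
(`coeffL_skew`). For the rectangle, the first row of the Jacobi–Trudi matrix is `h_{k-1}, h_k,
h_{k+1}, …`. In the rational series each label occurs at most once per column, so all exponents are
at most `k` and every multiple of `h_a` with `a > k` is orthogonal to it. The determinant then
behaves as a Hessenberg one, and its expansion is a signed sum of coefficients of `f` at `x^M`
extended by exponents `k - a` (`coeffL_skew_rect`).

Such coefficients come from inserting labels in increasing order. Adding one label puts a box on a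
set of columns, each box weighted by its rank in the current profile of column heights. The number
of inversions is the total rank minus a quantity depending only on the column heights
(`inv_add_base`), so each series is a sum over height sequences of an explicit weight times
`transfer`. Exchanging two consecutive labels does not change `transfer` (`transfer_swap`); this
rests on a symmetry of unit interval graphs (`sum_pow_edgeAsc_symm`) and yields the symmetry of both
series.

A label used `k - a` times is described by the `a` columns that it misses. In these terms boxes are
removed, and `q` is replaced by `q⁻¹` up to a global power (`transfer_compl`). The signed sum over
the `l` additional labels collapses to a single power of `q⁻¹`, present exactly when the columns
have `l` missing boxes in total, with no negative number in any column (`signedSum_cotransfer_eq`).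
The cancellation is the vanishing of a product with a factor `1 - 1`.

If `r` are the column heights made by the original labels and `h` the full heights, the surviving
condition says that `w = r + m - h` has positive entries with sum `n`: these are the column heights
of a stack. Under this substitution the levels, and hence the areas, of the rational and the stacked
objects coincide (`wpfLevel_wpfHeights`). It remains to compare powers of `q`, which is
`exponent_identity`: every statistic is a sum over pairs of columns of truncated linear functions,
and the difference of the two sides telescopes (`pairSum_exponents`). -/

noncomputable section

namespace RiseDelta

/-! ### Complete homogeneous power series in finitely many variables -/

section Bialternant

variable {ι : Type} [DecidableEq ι] {R : Type} [CommRing R]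

/-- The complete homogeneous symmetric polynomial of degree `m` in the variables from `S`. -/
def homogSum (R : Type) [CommRing R] (S : Finset ι) (m : ℕ) : MvPowerSeries ι R :=
  fun α => if α.degree = m ∧ α.support ⊆ S then 1 else 0

theorem coeff_homogSum (S : Finset ι) (m : ℕ) (α : ι →₀ ℕ) :
    MvPowerSeries.coeff α (homogSum R S m) = if α.degree = m ∧ α.support ⊆ S then 1 else 0 := rfl

/-- A monomial either avoids `x_i` or is divisible by it. -/
theorem homogSum_insert_succ (S : Finset ι) (i : ι) (hi : i ∉ S) (m : ℕ) :
    homogSum R (insert i S) (m + 1) =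
      homogSum R S (m + 1) + MvPowerSeries.X i * homogSum R (insert i S) m := by
  ext α
  rw [map_add, MvPowerSeries.X, MvPowerSeries.coeff_monomial_mul]
  simp only [coeff_homogSum, Finsupp.single_le_iff]
  by_cases h : α i = 0
  · have h1 : ¬ 1 ≤ α i := by omega
    have h2 : α.support ⊆ insert i S ↔ α.support ⊆ S := by
      rw [Finset.subset_insert_iff_of_notMem]
      simpa using h
    simp [h1, h2]
  · have h1 : 1 ≤ α i := by omega
    have h2 : ¬ α.support ⊆ S := fun hs => hi (hs (by simpa using h))
    have hle : Finsupp.single i 1 ≤ α := by simpa using h1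
    obtain ⟨β, rfl⟩ := exists_add_of_le hle
    have h3 : (Finsupp.single i 1 + β).degree = m + 1 ↔ β.degree = m := by
      rw [map_add, Finsupp.degree_single]; omega
    have h4 : (Finsupp.single i 1 + β).support ⊆ insert i S ↔ β.support ⊆ insert i S := by
      constructor
      · intro hs j hj
        apply hs
        simp only [Finsupp.mem_support_iff, Finsupp.add_apply] at hj ⊢
        omega
      · intro hs j hj
        by_cases hji : j = i
        · simp [hji]
        · apply hs
          simpa [Finsupp.single_apply, Ne.symm hji] using hj
    rw [if_pos h1, add_tsub_cancel_left]
    simp only [h2, h3, h4, and_false, if_false, one_mul, zero_add]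

/-- The generating function of the complete homogeneous symmetric polynomials. -/
def homogSeries (R : Type) [CommRing R] (S : Finset ι) : PowerSeries (MvPowerSeries ι R) :=
  PowerSeries.mk (homogSum R S)

theorem homogSum_zero (S : Finset ι) : homogSum R S 0 = 1 := by
  ext α
  rw [coeff_homogSum, MvPowerSeries.coeff_one]
  by_cases h : α = 0
  · simp [h]
  · rw [if_neg h, if_neg]
    rintro ⟨h1, -⟩
    exact h ((Finsupp.degree_eq_zero_iff _).mp h1)

theorem homogSeries_insert (S : Finset ι) (i : ι) (hi : i ∉ S) :
    homogSeries R (insert i S) *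
      (1 - PowerSeries.C (MvPowerSeries.X i : MvPowerSeries ι R) * PowerSeries.X) =
      homogSeries R S := by
  ext1 m
  rw [mul_sub, mul_one, map_sub, mul_comm, mul_assoc, PowerSeries.coeff_C_mul]
  rcases m with _ | m
  · simp [homogSeries, homogSum_zero]
  · rw [mul_comm PowerSeries.X, PowerSeries.coeff_succ_mul_X]
    simp only [homogSeries, PowerSeries.coeff_mk]
    rw [homogSum_insert_succ S i hi]
    ring

theorem homogSeries_mul_prod (S : Finset ι) :
    homogSeries R S *
      ∏ i ∈ S, (1 - PowerSeries.C (MvPowerSeries.X i : MvPowerSeries ι R) * PowerSeries.X) = 1 := by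
  induction S using Finset.induction_on with
  | empty =>
    rw [Finset.prod_empty, mul_one]
    ext1 m
    rcases m with _ | m
    · simp [homogSeries, homogSum_zero]
    · rw [homogSeries, PowerSeries.coeff_mk, PowerSeries.coeff_one, if_neg (by omega)]
      ext α
      rw [coeff_homogSum, if_neg]
      · simp
      · rintro ⟨h1, h2⟩
        have : α = 0 := by simpa using h2
        simp [this] at h1
  | insert i S hi ih =>
    rw [Finset.prod_insert hi, ← mul_assoc, homogSeries_insert S i hi, ih]

variable [Fintype ι]

/-- The polynomial `∏_{i ≠ k} (1 - x_i t)` in `t`. -/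
def elemPoly (R : Type) [CommRing R] (k : ι) : Polynomial (MvPowerSeries ι R) :=
  ∏ i ∈ Finset.univ.erase k, (1 - Polynomial.C (MvPowerSeries.X i) * Polynomial.X)

/-- Multiplying `∏ 1/(1 - x_i t)` by all factors except the one of `k` leaves the geometric series
of `x_k`. -/
theorem homogSeries_mul_elemPoly (k : ι) :
    homogSeries R (Finset.univ : Finset ι) * (elemPoly R k : PowerSeries (MvPowerSeries ι R)) =
      PowerSeries.mk fun m => (MvPowerSeries.X k : MvPowerSeries ι R) ^ m := by
  have hgeom : (PowerSeries.mk fun m => (MvPowerSeries.X k : MvPowerSeries ι R) ^ m) *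
      (1 - PowerSeries.C (MvPowerSeries.X k : MvPowerSeries ι R) * PowerSeries.X) = 1 := by
    ext1 m
    rw [mul_sub, mul_one, map_sub, mul_comm, mul_assoc, PowerSeries.coeff_C_mul]
    rcases m with _ | m
    · simp
    · rw [mul_comm PowerSeries.X, PowerSeries.coeff_succ_mul_X]
      simp [PowerSeries.coeff_one, pow_succ']
  have hcoe : (elemPoly R k : PowerSeries (MvPowerSeries ι R)) =
      ∏ i ∈ Finset.univ.erase k,
        (1 - PowerSeries.C (MvPowerSeries.X i : MvPowerSeries ι R) * PowerSeries.X) := by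
    rw [elemPoly, ← Polynomial.coeToPowerSeries.ringHom_apply, map_prod]
    refine Finset.prod_congr rfl fun i _ => ?_
    simp
  have hall := homogSeries_mul_prod (R := R) (Finset.univ : Finset ι)
  rw [← Finset.mul_prod_erase _ _ (Finset.mem_univ k), ← hcoe] at hall
  calc _ = homogSeries R (Finset.univ : Finset ι) * (elemPoly R k : PowerSeries _) *
        ((PowerSeries.mk fun m => (MvPowerSeries.X k : MvPowerSeries ι R) ^ m) *
          (1 - PowerSeries.C (MvPowerSeries.X k : MvPowerSeries ι R) * PowerSeries.X)) := by
        rw [hgeom, mul_one]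
    _ = _ := by linear_combination (PowerSeries.mk fun m => (MvPowerSeries.X k : MvPowerSeries ι R) ^ m) * hall

theorem elemPoly_natDegree_lt (k : ι) : (elemPoly R k).natDegree < Fintype.card ι := by
  have h1 : (elemPoly R k).natDegree ≤ ∑ i ∈ Finset.univ.erase k, 1 := by
    refine (Polynomial.natDegree_prod_le _ _).trans (Finset.sum_le_sum fun i _ => ?_)
    refine (Polynomial.natDegree_sub_le _ _).trans ?_
    simp only [Polynomial.natDegree_one, zero_le, sup_of_le_right]
    exact (Polynomial.natDegree_C_mul_le _ _).trans Polynomial.natDegree_X_le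
  rw [Finset.sum_const, smul_eq_mul, mul_one, Finset.card_erase_of_mem (Finset.mem_univ k),
    Finset.card_univ] at h1
  have : 0 < Fintype.card ι := Fintype.card_pos_iff.mpr ⟨k⟩
  omega

/-- `homogSum` in all variables, with integer index. -/
def homogInt (ι R : Type) [Fintype ι] [DecidableEq ι] [CommRing R] (m : ℤ) : MvPowerSeries ι R :=
  if 0 ≤ m then homogSum R Finset.univ m.toNat else 0

/-- The coefficient of `t^m` in the previous identity. It turns a row of complete homogeneous
polynomials into a row of powers, as needed for the bialternant formula. -/
theorem sum_homogInt_mul_elemPoly (k : ι) (m : ℕ) :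
    ∑ j ∈ Finset.range (Fintype.card ι), homogInt ι R ((m : ℤ) - j) * (elemPoly R k).coeff j =
      (MvPowerSeries.X k : MvPowerSeries ι R) ^ m := by
  have h := congrArg (PowerSeries.coeff m) (homogSeries_mul_elemPoly (R := R) k)
  rw [PowerSeries.coeff_mk, mul_comm, PowerSeries.coeff_mul,
    Finset.Nat.sum_antidiagonal_eq_sum_range_succ_mk] at h
  rw [← h]
  simp only [homogSeries, PowerSeries.coeff_mk, Polynomial.coeff_coe]
  -- The two sums have different natural ranges and are padded to a common one: on one side the
  -- degree bound on `elemPoly` kills the added terms, on the other the vanishing of `h` at negative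
  -- indices.
  have e1 : ∑ j ∈ Finset.range (Fintype.card ι),
      homogInt ι R ((m : ℤ) - j) * (elemPoly R k).coeff j =
      ∑ j ∈ Finset.range (max (Fintype.card ι) (m + 1)),
        homogInt ι R ((m : ℤ) - j) * (elemPoly R k).coeff j := by
    refine Finset.sum_subset (by simp) fun j _ hj => ?_
    rw [Polynomial.coeff_eq_zero_of_natDegree_lt, mul_zero]
    have := elemPoly_natDegree_lt (R := R) k
    simp only [Finset.mem_range] at hj
    omega
  have e2 : ∑ j ∈ Finset.range (m + 1), (elemPoly R k).coeff j * homogSum R Finset.univ (m - j) =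
      ∑ j ∈ Finset.range (max (Fintype.card ι) (m + 1)),
        homogInt ι R ((m : ℤ) - j) * (elemPoly R k).coeff j := by
    refine Eq.trans (Finset.sum_congr rfl fun j hj => ?_)
      (Finset.sum_subset (s₁ := Finset.range (m + 1)) (by simp) fun j _ hj => ?_)
    · simp only [Finset.mem_range] at hj
      rw [homogInt, if_pos (by omega), mul_comm]
      congr 2
      omega
    · simp only [Finset.mem_range] at hj
      rw [homogInt, if_neg (by omega), zero_mul]
  rw [e1, e2]

end Bialternant

/-! ### Jacobi–Trudi determinants and alternants (the bialternant formula) -/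

section Alternants

variable {R : Type} [CommRing R] {d : ℕ}

/-- The Jacobi–Trudi determinant with `d` rows for a family `H` indexed by the integers. -/
def jacobiTrudi {A : Type} [CommRing A] (H : ℤ → A) (d : ℕ) (ν : ℕ → ℕ) : A :=
  Matrix.det (Matrix.of fun i j : Fin d => H ((ν i : ℤ) - (i : ℕ) + (j : ℕ)))

/-- The alternant `det (x_k ^ (ν_i + d - 1 - i))`. -/
def alternant (R : Type) [CommRing R] (d : ℕ) (ν : ℕ → ℕ) : MvPowerSeries (Fin d) R :=
  Matrix.det (Matrix.of fun i k : Fin d =>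
    (MvPowerSeries.X k : MvPowerSeries (Fin d) R) ^ (ν i + (d - 1 - i)))

theorem jacobiTrudi_zero {A : Type} [CommRing A] (H : ℤ → A) (h0 : H 0 = 1)
    (hneg : ∀ m < 0, H m = 0) (d : ℕ) : jacobiTrudi H d (fun _ => 0) = 1 := by
  rw [jacobiTrudi, Matrix.det_of_isUpperTriangular]
  · exact Finset.prod_eq_one fun i _ => by simp [h0]
  · intro i j hij
    simp only [id] at hij
    rw [Matrix.of_apply, hneg]
    have : (j : ℕ) < i := hij
    push_cast
    omega

/-- The Jacobi–Trudi matrix times a matrix `N` independent of `ν` is the matrix of powers. For `ν =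
0` the first determinant is `1`, which identifies `det N` with the Vandermonde determinant without
any division. -/
theorem jacobiTrudi_mul_alternant_zero (ν : ℕ → ℕ) :
    jacobiTrudi (homogInt (Fin d) R) d ν * alternant R d (fun _ => 0) = alternant R d ν := by
  set N : Matrix (Fin d) (Fin d) (MvPowerSeries (Fin d) R) :=
    Matrix.of fun j k => (elemPoly R k).coeff (d - 1 - j) with hN
  have key (ν : ℕ → ℕ) : jacobiTrudi (homogInt (Fin d) R) d ν * N.det = alternant R d ν := by
    rw [jacobiTrudi, ← Matrix.det_mul, alternant]
    congr 1
    ext1 i k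
    rw [Matrix.mul_apply, Matrix.of_apply, ← sum_homogInt_mul_elemPoly, Fintype.card_fin,
      ← Finset.sum_range_reflect, Finset.sum_range]
    refine Finset.sum_congr rfl fun j _ => ?_
    rw [Matrix.of_apply, hN, Matrix.of_apply]
    congr 2
    have := j.isLt
    have := i.isLt
    push_cast
    omega
  rw [← key ν, ← key (fun _ => 0), jacobiTrudi_zero, one_mul]
  · rw [homogInt, if_pos le_rfl]
    exact homogSum_zero _
  · intro m hm
    rw [homogInt, if_neg (by omega)]

theorem alternant_eq_sum (ν : ℕ → ℕ) : alternant R d ν = ∑ σ : Equiv.Perm (Fin d),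
    MvPowerSeries.monomial (Finsupp.equivFunOnFinite.symm fun i : Fin d => ν (σ i) + (d - 1 - σ i))
      ((Equiv.Perm.sign σ : ℤ) : R) := by
  rw [alternant, Matrix.det_apply']
  refine Finset.sum_congr rfl fun σ _ => ?_
  have h1 : ∏ i, Matrix.of (fun i k : Fin d =>
      (MvPowerSeries.X k : MvPowerSeries (Fin d) R) ^ (ν i + (d - 1 - i))) (σ i) i =
      MvPowerSeries.monomial
        (Finsupp.equivFunOnFinite.symm fun i : Fin d => ν (σ i) + (d - 1 - σ i)) (1 : R) := by
    simp only [Matrix.of_apply, MvPowerSeries.X_pow_eq]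
    rw [MvPowerSeries.prod_monomial]
    congr 1
    · congr 1
      ext j
      simp [-Finsupp.single_add, -Finsupp.single_tsub, Finsupp.finsetSum_apply, Finsupp.single_apply]
    · simp
  rw [h1, ← map_intCast (MvPowerSeries.C (σ := Fin d) (R := R)), ← MvPowerSeries.monomial_zero_eq_C_apply,
    MvPowerSeries.monomial_mul_monomial]
  simp

end Alternants

end RiseDelta
end

noncomputable section

namespace RiseDelta

/-! ### Symmetric functions: coefficients and Jacobi–Trudi determinants -/

section SymmetricFunctions

variable {R : Type} [CommRing R]

/-- The coefficient of `x^α`, as a linear functional on `Λ`. -/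
def coeffL (R : Type) [CommRing R] (α : ℕ+ →₀ ℕ) : SymmFunc R →ₗ[R] R :=
  MvPowerSeries.coeff α ∘ₗ (SymmFunc R).val.toLinearMap

theorem coeffL_apply (α : ℕ+ →₀ ℕ) (f : SymmFunc R) :
    coeffL R α f = MvPowerSeries.coeff α (f : MvPowerSeries ℕ+ R) := rfl

theorem coeffL_embDomain (σ : Equiv.Perm ℕ+) (α : ℕ+ →₀ ℕ) (f : SymmFunc R) :
    coeffL R (α.embDomain σ.toEmbedding) f = coeffL R α f := by
  refine Eq.trans ?_ (MvPowerSeries.coeff_embDomain_rename σ.toEmbedding _ α)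
  exact congrArg (MvPowerSeries.coeff (α.embDomain σ.toEmbedding)) (f.2.1 σ).symm

theorem symmFunc_ext {f g : SymmFunc R} (h : ∀ α, coeffL R α f = coeffL R α g) : f = g :=
  Subtype.ext (MvPowerSeries.ext h)

theorem coeffL_hSymm (m : ℤ) (α : ℕ+ →₀ ℕ) :
    coeffL R α (hSymm R m) = if (α.degree : ℤ) = m then 1 else 0 := rfl

theorem hSymm_zero : hSymm R 0 = 1 := by
  refine symmFunc_ext fun α => ?_
  rw [coeffL_hSymm, coeffL_apply, OneMemClass.coe_one, MvPowerSeries.coeff_one]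
  simp [Finsupp.degree_eq_zero_iff]

theorem hSymm_neg (m : ℤ) (hm : m < 0) : hSymm R m = 0 := by
  refine symmFunc_ext fun α => ?_
  rw [coeffL_hSymm, if_neg (by omega), map_zero]

/-- The product of the `h_{α_i}`. -/
def hProd (R : Type) [CommRing R] (α : ℕ+ →₀ ℕ) : SymmFunc R :=
  α.prod fun _ a => hSymm R a

theorem hProd_embDomain (e : ℕ+ ↪ ℕ+) (α : ℕ+ →₀ ℕ) : hProd R (α.embDomain e) = hProd R α := by
  rw [hProd, Finsupp.prod_embDomain, hProd]

/-- The first `d` indices of variables. -/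
def firstVars (d : ℕ) : Fin d ↪ ℕ+ := ⟨fun i => Nat.succPNat i, fun i j h => by
  simpa [Fin.ext_iff] using h⟩

/-- The exponent vector `(v_0, …, v_{d-1}, 0, 0, …)`. -/
def vecExp {d : ℕ} (v : Fin d → ℕ) : ℕ+ →₀ ℕ :=
  (Finsupp.equivFunOnFinite.symm v).embDomain (firstVars d)

theorem degree_embDomain {ι κ : Type} (e : ι ↪ κ) (v : ι →₀ ℕ) :
    (v.embDomain e).degree = v.degree := by
  rw [Finsupp.embDomain_eq_mapDomain, Finsupp.degree_mapDomain]

theorem vecExp_degree {d : ℕ} (v : Fin d → ℕ) : (vecExp v).degree = ∑ i, v i := by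
  rw [vecExp, degree_embDomain, Finsupp.degree_eq_sum]
  rfl

theorem hProd_vecExp {d : ℕ} (v : Fin d → ℕ) : hProd R (vecExp v) = ∏ i, hSymm R (v i) := by
  rw [hProd, vecExp, Finsupp.prod_embDomain, Finsupp.prod_fintype _ _ (by simp [hSymm_zero])]
  rfl

theorem vecExp_comp_perm {d : ℕ} (v : Fin d → ℕ) (σ : Equiv.Perm (Fin d)) :
    ∃ τ : Equiv.Perm ℕ+, vecExp (v ∘ σ) = (vecExp v).embDomain τ.toEmbedding := by
  refine ⟨(σ.viaFintypeEmbedding (firstVars d))⁻¹, ?_⟩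
  ext x
  obtain ⟨y, rfl⟩ := (σ.viaFintypeEmbedding (firstVars d))⁻¹.surjective x
  rw [show ((σ.viaFintypeEmbedding (firstVars d))⁻¹ y) =
    ((σ.viaFintypeEmbedding (firstVars d))⁻¹).toEmbedding y from rfl, Finsupp.embDomain_apply_self]
  by_cases hy : y ∈ Set.range (firstVars d)
  · obtain ⟨i, rfl⟩ := hy
    have : ((σ.viaFintypeEmbedding (firstVars d))⁻¹).toEmbedding (firstVars d i) =
        firstVars d (σ⁻¹ i) := by
      change (σ.viaFintypeEmbedding (firstVars d))⁻¹ (firstVars d i) = _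
      rw [Equiv.Perm.inv_eq_iff_eq, Equiv.Perm.viaFintypeEmbedding_apply_image]
      simp
    rw [this, vecExp, vecExp, Finsupp.embDomain_apply_self, Finsupp.embDomain_apply_self]
    simp
  · have : ((σ.viaFintypeEmbedding (firstVars d))⁻¹).toEmbedding y = y := by
      change (σ.viaFintypeEmbedding (firstVars d))⁻¹ y = _
      rw [Equiv.Perm.inv_eq_iff_eq, Equiv.Perm.viaFintypeEmbedding_apply_notMem_range _ _ hy]
    rw [this, vecExp, vecExp, Finsupp.embDomain_of_notMem_range _ _ _ hy,
      Finsupp.embDomain_of_notMem_range _ _ _ hy]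

/-- Every exponent vector of degree `d` is a rearrangement of one in the first `d` variables. -/
theorem exists_vecExp (α : ℕ+ →₀ ℕ) : ∃ (τ : Equiv.Perm ℕ+) (v : Fin α.degree → ℕ),
    α = (vecExp v).embDomain τ.toEmbedding := by
  classical
  set d := α.degree with hd
  have hcard : α.support.card ≤ d := by
    rw [hd, Finsupp.degree_apply, Finset.card_eq_sum_ones]
    refine Finset.sum_le_sum fun i hi => ?_
    have := Finsupp.mem_support_iff.mp hi
    omega
  obtain ⟨e⟩ : Nonempty (α.support ↪ Fin d) := by
    rw [Function.Embedding.nonempty_iff_card_le]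
    simpa using hcard
  -- The support is injected into the first `d` variables. This partial injection extends to a
  -- permutation of the finite set `T`, and by the identity to all variables.
  set T : Finset ℕ+ := α.support ∪ Finset.univ.map (firstVars d) with hT
  let p : T → Prop := fun x => (x : ℕ+) ∈ α.support
  let q : T → Prop := fun x => ∃ s : α.support, firstVars d (e s) = x
  have hmem (s : α.support) : firstVars d (e s) ∈ T :=
    Finset.mem_union_right _ (Finset.mem_map_of_mem _ (Finset.mem_univ _))
  let e' : {x // p x} ≃ {x // q x} := Equiv.ofBijective
    (fun x => ⟨⟨firstVars d (e ⟨x.1.1, x.2⟩), hmem _⟩, ⟨x.1.1, x.2⟩, rfl⟩) (by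
      constructor
      · rintro ⟨⟨x, hx⟩, hx'⟩ ⟨⟨y, hy⟩, hy'⟩ h
        simp only [Subtype.mk.injEq, EmbeddingLike.apply_eq_iff_eq] at h
        simpa using h
      · rintro ⟨⟨y, hy⟩, s, hs⟩
        refine ⟨⟨⟨s, Finset.mem_union_left _ s.2⟩, s.2⟩, ?_⟩
        simpa using hs)
  let τ₀ : Equiv.Perm T := e'.extendSubtype
  let τ : Equiv.Perm ℕ+ := (Equiv.Perm.ofSubtype (p := (· ∈ T)) τ₀)
  have hτ (s : α.support) : τ s = firstVars d (e s) := by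
    have hs : (s : ℕ+) ∈ T := Finset.mem_union_left _ s.2
    change Equiv.Perm.ofSubtype (p := (· ∈ T)) τ₀ s = _
    rw [Equiv.Perm.ofSubtype_apply_of_mem τ₀ hs]
    have := e'.extendSubtype_apply_of_mem ⟨s, hs⟩ s.2
    change ((e'.extendSubtype ⟨s, hs⟩ : T) : ℕ+) = _
    rw [this]
    rfl
  refine ⟨τ⁻¹, fun i => α (τ⁻¹ (firstVars d i)), ?_⟩
  ext x
  obtain ⟨y, rfl⟩ := τ⁻¹.surjective x
  rw [show τ⁻¹ y = (τ⁻¹).toEmbedding y from rfl, Finsupp.embDomain_apply_self]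
  by_cases hy : y ∈ Set.range (firstVars d)
  · obtain ⟨i, rfl⟩ := hy
    rw [vecExp, Finsupp.embDomain_apply_self]
    rfl
  · rw [vecExp, Finsupp.embDomain_of_notMem_range _ _ _ hy]
    by_contra h
    apply hy
    have h' : τ⁻¹ y ∈ α.support := Finsupp.mem_support_iff.mpr h
    refine ⟨e ⟨_, h'⟩, ?_⟩
    rw [← hτ ⟨_, h'⟩]
    simp

/-- Restriction of a symmetric function to the first `d` variables. -/
def restrictVars (R : Type) [CommRing R] (d : ℕ) : SymmFunc R →ₐ[R] MvPowerSeries (Fin d) R :=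
  (MvPowerSeries.killCompl (firstVars d)).comp (SymmFunc R).val

theorem coeff_restrictVars {d : ℕ} (v : Fin d → ℕ) (f : SymmFunc R) :
    MvPowerSeries.coeff (Finsupp.equivFunOnFinite.symm v) (restrictVars R d f) =
      coeffL R (vecExp v) f := by
  change MvPowerSeries.coeff _ (MvPowerSeries.killCompl _ _) = _
  rw [MvPowerSeries.coeff_killCompl]
  rfl

theorem restrictVars_hSymm {d : ℕ} (m : ℤ) :
    restrictVars R d (hSymm R m) = homogInt (Fin d) R m := by
  ext α
  obtain ⟨v, rfl⟩ := Finsupp.equivFunOnFinite.symm.surjective α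
  rw [coeff_restrictVars, coeffL_hSymm, vecExp_degree, homogInt]
  split_ifs with h1 h2 h2
  · rw [coeff_homogSum, if_pos]
    refine ⟨?_, Finset.subset_univ _⟩
    rw [Finsupp.degree_eq_sum]
    simp only [Finsupp.coe_equivFunOnFinite_symm]
    omega
  · omega
  · rw [coeff_homogSum, if_neg]
    rintro ⟨h, -⟩
    rw [Finsupp.degree_eq_sum] at h
    simp only [Finsupp.coe_equivFunOnFinite_symm] at h
    omega
  · simp

theorem restrictVars_jacobiTrudi {d e : ℕ} (ν : ℕ → ℕ) :
    restrictVars R d (jacobiTrudi (hSymm R) e ν) = jacobiTrudi (homogInt (Fin d) R) e ν := by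
  rw [jacobiTrudi, AlgHom.map_det, jacobiTrudi]
  congr 1
  ext1 i j
  simp [restrictVars_hSymm]

/-- The coefficient of `x^(ν + δ)` in the product with the Vandermonde determinant in `d`
variables. -/
def alternantCoeff (R : Type) [CommRing R] (d : ℕ) (ν : ℕ → ℕ) : SymmFunc R →ₗ[R] R :=
  MvPowerSeries.coeff (Finsupp.equivFunOnFinite.symm fun i : Fin d => ν i + (d - 1 - i)) ∘ₗ
    LinearMap.mulLeft R (alternant R d fun _ => 0) ∘ₗ (restrictVars R d).toLinearMap

theorem alternantCoeff_apply (d : ℕ) (ν : ℕ → ℕ) (f : SymmFunc R) :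
    alternantCoeff R d ν f =
      MvPowerSeries.coeff (Finsupp.equivFunOnFinite.symm fun i : Fin d => ν i + (d - 1 - i))
        (alternant R d (fun _ => 0) * restrictVars R d f) := rfl

/-- By the bialternant formula this is a coefficient of the alternant of `ν`. Both exponent vectors
`μ + δ` and `ν + δ` are strictly decreasing, so only the identity permutation can match them. -/
theorem alternantCoeff_jacobiTrudi {d : ℕ} (μ ν : ℕ → ℕ) (hμ : Antitone μ) (hν : Antitone ν) :
    alternantCoeff R d μ (jacobiTrudi (hSymm R) d ν) =
      if ∀ i < d, μ i = ν i then 1 else 0 := by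
  rw [alternantCoeff_apply, restrictVars_jacobiTrudi, mul_comm, jacobiTrudi_mul_alternant_zero,
    alternant_eq_sum, map_sum]
  simp only [MvPowerSeries.coeff_monomial, EmbeddingLike.apply_eq_iff_eq, funext_iff]
  have key (σ : Equiv.Perm (Fin d))
      (h : ∀ i : Fin d, μ i + (d - 1 - i) = ν (σ i) + (d - 1 - σ i)) : σ = 1 := by
    have hmono : StrictMono σ := by
      intro i j hij
      by_contra hle
      have h1 := hν (show ((σ j : Fin d) : ℕ) ≤ σ i from not_lt.mp hle)
      have h2 := hμ (show (i : ℕ) ≤ j from hij.le)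
      have h3 := h i
      have h4 := h j
      have h5 : (i : ℕ) < j := hij
      have h6 : ((σ j : Fin d) : ℕ) ≤ σ i := not_lt.mp hle
      have := (σ i).isLt
      have := j.isLt
      omega
    ext i
    have := Subsingleton.elim (hmono.orderIsoOfSurjective σ σ.surjective) (OrderIso.refl (Fin d))
    simpa using congrArg (fun e : Fin d ≃o Fin d => ((e i : Fin d) : ℕ)) this
  split_ifs with h
  · rw [Finset.sum_eq_single 1]
    · rw [if_pos]
      · simp
      · intro i
        simp [h i i.isLt]
    · intro σ _ hσ
      exact if_neg fun h' => hσ (key σ h')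
    · simp
  · refine Finset.sum_eq_zero fun σ _ => if_neg fun h' => h fun i hi => ?_
    have hσ := key σ h'
    subst hσ
    simpa using h' ⟨i, hi⟩

/-- The exponent vector `v_i - i + σ(i)` of a term of the Jacobi–Trudi determinant. -/
def jtTerm {d : ℕ} (v : ℕ → ℕ) (σ : Equiv.Perm (Fin d)) (i : Fin d) : ℤ :=
  (v i : ℤ) - (i : ℕ) + (σ i : ℕ)

theorem jacobiTrudi_eq_sum {A : Type} [CommRing A] (H : ℤ → A) (d : ℕ) (ν : ℕ → ℕ) :
    jacobiTrudi H d ν = ∑ σ : Equiv.Perm (Fin d),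
      ((Equiv.Perm.sign σ : ℤ) : A) * ∏ i, H (jtTerm ν σ i) := by
  rw [jacobiTrudi, ← Matrix.det_transpose, Matrix.det_apply']
  rfl

/-- Expanding the Vandermonde factor leaves the exponents `ν_i + (d-1-i) - (d-1-σ i) = ν_i - i + σ
i`, which are the indices in the Jacobi–Trudi expansion, with the same signs. -/
theorem alternantCoeff_eq_sum (d : ℕ) (ν : ℕ → ℕ) :
    alternantCoeff R d ν = ∑ σ : Equiv.Perm (Fin d), ((Equiv.Perm.sign σ : ℤ) : R) •
      if ∀ i, 0 ≤ jtTerm ν σ i then coeffL R (vecExp fun i => (jtTerm ν σ i).toNat) else 0 := by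
  ext f
  rw [alternantCoeff_apply, alternant_eq_sum, Finset.sum_mul, map_sum, LinearMap.sum_apply]
  refine Finset.sum_congr rfl fun σ _ => ?_
  rw [MvPowerSeries.coeff_monomial_mul, LinearMap.smul_apply]
  have hle : (Finsupp.equivFunOnFinite.symm (fun i : Fin d => 0 + (d - 1 - (σ i : ℕ))) ≤
      Finsupp.equivFunOnFinite.symm fun i : Fin d => ν i + (d - 1 - i)) ↔
      ∀ i, 0 ≤ jtTerm ν σ i := by
    rw [Finsupp.le_def]
    refine forall_congr' fun i => ?_
    simp only [Finsupp.equivFunOnFinite_symm_apply_apply, jtTerm]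
    have := (σ i).isLt
    have := i.isLt
    omega
  by_cases h : ∀ i, 0 ≤ jtTerm ν σ i
  · rw [if_pos (hle.mpr h), if_pos h, ← coeff_restrictVars, smul_eq_mul]
    congr 3
    ext i
    simp only [Finsupp.equivFunOnFinite_symm_apply_apply, jtTerm, Finsupp.tsub_apply]
    have := (σ i).isLt
    have := i.isLt
    omega
  · rw [if_neg (fun h' => h (hle.mp h')), if_neg h]
    simp

/-- The last row of the larger matrix is `(0, …, 0, 1)`. -/
theorem jacobiTrudi_succ {A : Type} [CommRing A] (H : ℤ → A) (h0 : H 0 = 1)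
    (hneg : ∀ m < 0, H m = 0) (d : ℕ) (ν : ℕ → ℕ) (hν : ν d = 0) :
    jacobiTrudi H (d + 1) ν = jacobiTrudi H d ν := by
  rw [jacobiTrudi, Matrix.det_succ_row _ (Fin.last d), Fin.sum_univ_castSucc,
    Finset.sum_eq_zero, zero_add]
  · simp only [Matrix.of_apply, Fin.val_last, hν, Nat.cast_zero, zero_sub, neg_add_cancel, h0,
      mul_one]
    rw [← two_mul, pow_mul]
    simp only [even_two, Even.neg_pow, one_pow, one_mul, jacobiTrudi]
    congr 1
    ext1 i j
    simp
  · intro j _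
    rw [Matrix.of_apply, hneg]
    · simp
    · simp [hν]

theorem jacobiTrudi_stable {A : Type} [CommRing A] (H : ℤ → A) (h0 : H 0 = 1)
    (hneg : ∀ m < 0, H m = 0) (d e : ℕ) (hde : d ≤ e) (ν : ℕ → ℕ) (hν : ∀ i, d ≤ i → ν i = 0) :
    jacobiTrudi H e ν = jacobiTrudi H d ν := by
  induction e, hde using Nat.le_induction with
  | base => rfl
  | succ e he ih => rw [jacobiTrudi_succ H h0 hneg e ν (hν e he), ih]

theorem schur_eq_jacobiTrudi (μ : YoungDiagram) (d : ℕ) (hd : μ.colLen 0 ≤ d) :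
    schur R μ = jacobiTrudi (hSymm R) d μ.rowLen := by
  rw [jacobiTrudi_stable _ hSymm_zero hSymm_neg _ d hd]
  · rfl
  · intro i hi
    by_contra h
    have : (i, 0) ∈ μ := YoungDiagram.mem_iff_lt_rowLen.mpr (by omega)
    have := YoungDiagram.mem_iff_lt_colLen.mp this
    omega

end SymmetricFunctions

end RiseDelta
end

noncomputable section

namespace RiseDelta

/-! ### Row lengths of Young diagrams -/

section Young

theorem colLen_le_card (μ : YoungDiagram) : μ.colLen 0 ≤ μ.card := by
  rw [YoungDiagram.colLen_eq_card]
  exact Finset.card_le_card (Finset.filter_subset _ _)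

theorem rowLen_eq_zero_of_colLen_le (μ : YoungDiagram) (i : ℕ) (hi : μ.colLen 0 ≤ i) :
    μ.rowLen i = 0 := by
  by_contra h
  have : (i, 0) ∈ μ := YoungDiagram.mem_iff_lt_rowLen.mpr (by omega)
  have := YoungDiagram.mem_iff_lt_colLen.mp this
  omega

theorem card_eq_sum_rowLen (μ : YoungDiagram) (d : ℕ) (hd : μ.colLen 0 ≤ d) :
    μ.card = ∑ i ∈ Finset.range d, μ.rowLen i := by
  rw [YoungDiagram.card, Finset.card_eq_sum_card_fiberwise (f := Prod.fst) (t := Finset.range d)]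
  · refine Finset.sum_congr rfl fun i _ => ?_
    rw [YoungDiagram.rowLen_eq_card]
    rfl
  · rintro ⟨i, j⟩ h
    have h1 : (i, 0) ∈ μ := μ.isLowerSet (show (i, 0) ≤ (i, j) from ⟨le_rfl, Nat.zero_le _⟩) h
    have := YoungDiagram.mem_iff_lt_colLen.mp h1
    simp only [Finset.coe_range, Set.mem_Iio]
    omega

theorem youngDiagram_ext_rowLen {μ ν : YoungDiagram} (h : ∀ i, μ.rowLen i = ν.rowLen i) :
    μ = ν := by
  ext ⟨i, j⟩
  rw [YoungDiagram.mem_cells, YoungDiagram.mem_cells, YoungDiagram.mem_iff_lt_rowLen,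
    YoungDiagram.mem_iff_lt_rowLen, h]

theorem finite_card_le (D : ℕ) : {μ : YoungDiagram | μ.card ≤ D}.Finite := by
  refine Set.Finite.of_injOn (f := YoungDiagram.cells)
    (t := ((Finset.range D ×ˢ Finset.range D).powerset : Set (Finset (ℕ × ℕ)))) ?_
    (fun μ _ ν _ h => YoungDiagram.ext h) (Finset.finite_toSet _)
  intro μ hμ
  simp only [Set.mem_ofPred_eq] at hμ
  simp only [Finset.coe_powerset, Set.mem_preimage, Set.mem_powerset_iff, Finset.coe_subset]
  rintro ⟨i, j⟩ hij
  rw [YoungDiagram.mem_cells] at hij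
  have h1 : (i, 0) ∈ μ := μ.isLowerSet (show (i, 0) ≤ (i, j) from ⟨le_rfl, Nat.zero_le _⟩) hij
  have h2 := YoungDiagram.mem_iff_lt_colLen.mp h1
  have h3 := colLen_le_card μ
  have h4 := YoungDiagram.mem_iff_lt_rowLen.mp hij
  have h5 : μ.rowLen i ≤ μ.card := by
    rw [YoungDiagram.rowLen_eq_card]
    exact Finset.card_le_card (Finset.filter_subset _ _)
  simp only [Finset.mem_product, Finset.mem_range]
  omega

/-- The Young diagram with row lengths `v 0 ≥ v 1 ≥ ⋯ ≥ v (d - 1)`. -/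
def youngOfVec {d : ℕ} (v : Fin d → ℕ) (hv : Antitone v) : YoungDiagram :=
  YoungDiagram.ofRowLens (List.ofFn v) hv.sortedGE_ofFn

theorem rowLen_ofRowLens' (w : List ℕ) (hw : w.SortedGE) (i : ℕ) :
    (YoungDiagram.ofRowLens w hw).rowLen i = w.getD i 0 := by
  refine eq_of_forall_lt_iff fun j => ?_
  rw [← YoungDiagram.mem_iff_lt_rowLen, YoungDiagram.mem_ofRowLens]
  constructor
  · rintro ⟨h, h'⟩
    rwa [List.getD_eq_getElem _ _ h]
  · intro h
    by_cases hi : i < w.length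
    · exact ⟨hi, by rwa [List.getD_eq_getElem _ _ hi] at h⟩
    · rw [List.getD_eq_default _ _ (by omega)] at h
      omega

theorem rowLen_youngOfVec {d : ℕ} (v : Fin d → ℕ) (hv : Antitone v) (i : ℕ) :
    (youngOfVec v hv).rowLen i = if h : i < d then v ⟨i, h⟩ else 0 := by
  rw [youngOfVec, rowLen_ofRowLens']
  split_ifs with h
  · rw [List.getD_eq_getElem _ _ (by simpa using h)]
    simp
  · rw [List.getD_eq_default]
    simpa using h

theorem colLen_le_of_rowLen (μ : YoungDiagram) (d : ℕ) (h : μ.rowLen d = 0) :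
    μ.colLen 0 ≤ d := by
  by_contra hlt
  have := YoungDiagram.mem_iff_lt_rowLen.mp
    (YoungDiagram.mem_iff_lt_colLen.mpr (not_le.mp hlt))
  omega

theorem card_youngOfVec {d : ℕ} (v : Fin d → ℕ) (hv : Antitone v) :
    (youngOfVec v hv).card = ∑ i, v i := by
  rw [card_eq_sum_rowLen _ d (colLen_le_of_rowLen _ _ (by simp [rowLen_youngOfVec])),
    Finset.sum_range]
  simp [rowLen_youngOfVec]

end Young

/-! ### Schur basis, Hall form and skewing operators -/

section Hall

variable {R : Type} [CommRing R]

/-- The coefficient functional dual to the Schur function `s_μ`. -/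
def schurDual (R : Type) [CommRing R] (μ : YoungDiagram) : SymmFunc R →ₗ[R] R :=
  alternantCoeff R μ.card μ.rowLen

/-- The pair of `s_μ` and its dual functional. -/
def schurPair (R : Type) [CommRing R] (μ : YoungDiagram) :
    SymmFunc R × (SymmFunc R →ₗ[R] R) := (schur R μ, schurDual R μ)

/-- The pair of `h_α` and its dual functional. -/
def homogPair (R : Type) [CommRing R] (α : ℕ+ →₀ ℕ) :
    SymmFunc R × (SymmFunc R →ₗ[R] R) := (hProd R α, coeffL R α)

theorem homogPair_embDomain (σ : Equiv.Perm ℕ+) (α : ℕ+ →₀ ℕ) :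
    homogPair R (α.embDomain σ.toEmbedding) = homogPair R α := by
  refine Prod.ext (hProd_embDomain _ _) (LinearMap.ext fun f => coeffL_embDomain _ _ _)

theorem homogPair_comp_perm {d : ℕ} (v : Fin d → ℕ) (σ : Equiv.Perm (Fin d)) :
    homogPair R (vecExp (v ∘ σ)) = homogPair R (vecExp v) := by
  obtain ⟨τ, hτ⟩ := vecExp_comp_perm v σ
  rw [hτ, homogPair_embDomain]

/-- Schur functions expand in the `h_α` exactly as their dual functionals expand in the coefficient
functionals. Keeping both in one vector lets a single triangular inversion serve both. -/
theorem jacobiTrudiPair_eq_sum (d : ℕ) (ν : ℕ → ℕ) :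
    ((jacobiTrudi (hSymm R) d ν, alternantCoeff R d ν) : SymmFunc R × (SymmFunc R →ₗ[R] R)) =
      ∑ σ : Equiv.Perm (Fin d), ((Equiv.Perm.sign σ : ℤ) : R) •
        if ∀ i, 0 ≤ jtTerm ν σ i then homogPair R (vecExp fun i => (jtTerm ν σ i).toNat) else 0 := by
  refine Prod.ext ?_ ?_
  · rw [Prod.fst_sum]
    simp only [Prod.smul_fst]
    rw [jacobiTrudi_eq_sum]
    refine Finset.sum_congr rfl fun σ _ => ?_
    rw [Algebra.smul_def, map_intCast]
    congr 1
    split_ifs with h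
    · rw [homogPair, hProd_vecExp]
      exact Finset.prod_congr rfl fun i _ => by rw [Int.toNat_of_nonneg (h i)]
    · push Not at h
      obtain ⟨i, hi⟩ := h
      exact Finset.prod_eq_zero (Finset.mem_univ i) (hSymm_neg _ hi)
  · rw [Prod.snd_sum]
    simp only [Prod.smul_snd]
    rw [alternantCoeff_eq_sum]
    refine Finset.sum_congr rfl fun σ _ => ?_
    congr 1
    split_ifs <;> rfl

theorem sum_jtTerm {d : ℕ} (ν : ℕ → ℕ) (σ : Equiv.Perm (Fin d)) :
    ∑ i, jtTerm ν σ i = ∑ i : Fin d, (ν i : ℤ) := by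
  simp only [jtTerm, Finset.sum_add_distrib, Finset.sum_sub_distrib]
  rw [Equiv.sum_comp σ fun i : Fin d => ((i : ℕ) : ℤ)]
  ring

/-- In the expansion of `(ν_i + (σ i - i))²` the cross terms have nonnegative sum by the
rearrangement inequality, and the squares of `σ i - i` have positive sum for `σ ≠ 1`. This gives the
triangularity of the Jacobi–Trudi expansion. -/
theorem sum_sq_lt_jtTerm {d : ℕ} (ν : ℕ → ℕ) (hν : Antitone ν) (σ : Equiv.Perm (Fin d))
    (hσ : σ ≠ 1) : ∑ i : Fin d, (ν i : ℤ) ^ 2 < ∑ i, jtTerm ν σ i ^ 2 := by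
  have h1 : ∑ i : Fin d, (ν i : ℤ) * (i : ℕ) ≤ ∑ i : Fin d, (ν i : ℤ) * (σ i : ℕ) := by
    have hanti : Antivary (fun i : Fin d => (ν i : ℤ)) (fun i : Fin d => ((i : ℕ) : ℤ)) := by
      intro i j hij
      have : (i : ℕ) ≤ j := by
        have : ((i : ℕ) : ℤ) < (j : ℕ) := hij
        omega
      exact Nat.cast_le.mpr (hν this)
    exact hanti.sum_mul_le_sum_mul_comp_perm
  have h2 : 0 < ∑ i : Fin d, (((σ i : ℕ) : ℤ) - (i : ℕ)) ^ 2 := by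
    obtain ⟨i, hi⟩ : ∃ i, σ i ≠ i := by
      by_contra h
      push Not at h
      exact hσ (Equiv.ext h)
    refine Finset.sum_pos' (fun _ _ => sq_nonneg _) ⟨i, Finset.mem_univ i, ?_⟩
    have : ((σ i : ℕ) : ℤ) - (i : ℕ) ≠ 0 := by
      intro h
      apply hi
      ext
      omega
    positivity
  have h3 : ∑ i, jtTerm ν σ i ^ 2 = ∑ i : Fin d, (ν i : ℤ) ^ 2 +
      2 * (∑ i : Fin d, (ν i : ℤ) * (σ i : ℕ) - ∑ i : Fin d, (ν i : ℤ) * (i : ℕ)) +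
      ∑ i : Fin d, (((σ i : ℕ) : ℤ) - (i : ℕ)) ^ 2 := by
    rw [← Finset.sum_sub_distrib, Finset.mul_sum, ← Finset.sum_add_distrib,
      ← Finset.sum_add_distrib]
    exact Finset.sum_congr rfl fun i _ => by rw [jtTerm]; ring
  linarith

theorem schurPair_youngOfVec {d : ℕ} (v : Fin d → ℕ) (hv : Antitone v) (hsum : ∑ i, v i = d) :
    schurPair R (youngOfVec v hv) = (jacobiTrudi (hSymm R) d (youngOfVec v hv).rowLen,
      alternantCoeff R d (youngOfVec v hv).rowLen) := by
  have hcard := card_youngOfVec v hv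
  rw [schurPair, schurDual, schur_eq_jacobiTrudi _ d, hcard, hsum]
  have := colLen_le_card (youngOfVec v hv)
  omega

/-- After sorting, the identity term of the Jacobi–Trudi expansion is the given vector, and all
other terms have a larger sum of squares. That sum is at most `d²`, so the induction terminates. -/
theorem homogPair_vecExp_mem_span {d : ℕ} (v : Fin d → ℕ) (hsum : ∑ i, v i = d) :
    homogPair R (vecExp v) ∈ Submodule.span R (Set.range (schurPair R)) := by
  induction hN : d ^ 2 - ∑ i, v i ^ 2 using Nat.strong_induction_on generalizing v with
  | _ N ih =>
  obtain ⟨σ₀, hσ₀⟩ : ∃ σ : Equiv.Perm (Fin d), Antitone (v ∘ σ) :=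
    ⟨Tuple.sort (OrderDual.toDual ∘ v), Tuple.monotone_sort (OrderDual.toDual ∘ v)⟩
  have hsum' : ∑ i, (v ∘ σ₀) i = d := by
    exact (Equiv.sum_comp σ₀ v).trans hsum
  have hsq : ∑ i, (v ∘ σ₀) i ^ 2 = ∑ i, v i ^ 2 := Equiv.sum_comp σ₀ fun i => v i ^ 2
  rw [← homogPair_comp_perm v σ₀]
  set w := v ∘ σ₀ with hw
  set ν := (youngOfVec w hσ₀).rowLen with hνdef
  have hν (i : Fin d) : ν i = w i := by simp [hνdef, rowLen_youngOfVec]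
  have hanti : Antitone ν := fun i j hij => YoungDiagram.rowLen_anti _ i j hij
  have hexp := jacobiTrudiPair_eq_sum (R := R) d ν
  rw [← schurPair_youngOfVec w hσ₀ hsum',
    ← Finset.add_sum_erase _ _ (Finset.mem_univ (1 : Equiv.Perm (Fin d)))] at hexp
  have h1 (i : Fin d) : jtTerm ν 1 i = w i := by simp [jtTerm, hν]
  have hone : (if ∀ i, 0 ≤ jtTerm ν (1 : Equiv.Perm (Fin d)) i then
      homogPair R (vecExp fun i => (jtTerm ν (1 : Equiv.Perm (Fin d)) i).toNat) else 0) =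
      homogPair R (vecExp w) := by
    simp [h1]
  rw [hone] at hexp
  simp only [Equiv.Perm.sign_one, Units.val_one, Int.cast_one, one_smul] at hexp
  rw [eq_sub_of_add_eq hexp.symm]
  refine Submodule.sub_mem _ (Submodule.subset_span ⟨_, rfl⟩) (Submodule.sum_mem _ fun σ hσ => ?_)
  refine Submodule.smul_mem _ _ ?_
  split_ifs with h
  · have hs : ∑ i, (jtTerm ν σ i).toNat = d := by
      zify
      simp only [Int.toNat_of_nonneg (h _)]
      rw [sum_jtTerm]
      simp only [hν]
      exact_mod_cast hsum'
    refine ih _ ?_ _ hs rfl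
    have hlt := sum_sq_lt_jtTerm ν hanti σ (Finset.ne_of_mem_erase hσ)
    have hlt' : ∑ i, w i ^ 2 < ∑ i, (jtTerm ν σ i).toNat ^ 2 := by
      zify
      simpa only [Int.toNat_of_nonneg (h _), hν] using hlt
    have hle : ∑ i, (jtTerm ν σ i).toNat ^ 2 ≤ d ^ 2 := by
      conv_rhs => rw [← hs]
      exact Finset.sum_sq_le_sq_sum_of_nonneg fun _ _ => Nat.zero_le _
    omega
  · exact Submodule.zero_mem _

theorem homogPair_mem_span (α : ℕ+ →₀ ℕ) :
    homogPair R α ∈ Submodule.span R (Set.range (schurPair R)) := by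
  obtain ⟨τ, v, hv⟩ := exists_vecExp α
  have hsum : ∑ i, v i = α.degree := by
    conv_rhs => rw [hv]
    rw [degree_embDomain, vecExp_degree]
  rw [hv, homogPair_embDomain]
  exact homogPair_vecExp_mem_span v hsum

theorem schurDual_eq_zero {μ : YoungDiagram} {f : SymmFunc R}
    (h : ∀ α : ℕ+ →₀ ℕ, α.degree = μ.card → coeffL R α f = 0) : schurDual R μ f = 0 := by
  rw [schurDual, alternantCoeff_eq_sum, LinearMap.sum_apply]
  refine Finset.sum_eq_zero fun σ _ => ?_
  rw [LinearMap.smul_apply]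
  split_ifs with hσ
  · rw [h, smul_zero]
    rw [vecExp_degree]
    zify
    simp only [Int.toNat_of_nonneg (hσ _)]
    rw [sum_jtTerm]
    have := card_eq_sum_rowLen μ μ.card (colLen_le_card μ)
    rw [Finset.sum_range] at this
    exact_mod_cast this.symm
  · simp

theorem coeffL_schur_eq_zero {μ : YoungDiagram} {α : ℕ+ →₀ ℕ} (h : α.degree ≠ μ.card) :
    coeffL R α (schur R μ) = 0 := by
  have hexp := congrArg Prod.fst (jacobiTrudiPair_eq_sum (R := R) μ.card μ.rowLen)
  dsimp only at hexp
  rw [schur_eq_jacobiTrudi μ μ.card (colLen_le_card μ), hexp, Prod.fst_sum, map_sum]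
  refine Finset.sum_eq_zero fun σ _ => ?_
  rw [Prod.smul_fst, map_smul]
  split_ifs with hσ
  · rw [homogPair]
    suffices H : ∀ β : ℕ+ →₀ ℕ, β.degree = μ.card → coeffL R α (hProd R β) = 0 by
      rw [H, smul_zero]
      rw [vecExp_degree]
      zify
      simp only [Int.toNat_of_nonneg (hσ _)]
      rw [sum_jtTerm]
      have := card_eq_sum_rowLen μ μ.card (colLen_le_card μ)
      rw [Finset.sum_range] at this
      exact_mod_cast this.symm
    intro β hβ
    have key : ∀ (s : Finset ℕ+) (b : ℕ+ → ℕ) (γ : ℕ+ →₀ ℕ), γ.degree ≠ ∑ i ∈ s, b i →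
        coeffL R γ (∏ i ∈ s, hSymm R (b i)) = 0 := by
      intro s b
      induction s using Finset.induction_on with
      | empty =>
        intro γ hγ
        rw [Finset.prod_empty, coeffL_apply, OneMemClass.coe_one, MvPowerSeries.coeff_one, if_neg]
        rintro rfl
        simp at hγ
      | insert i s hi ih =>
        intro γ hγ
        rw [Finset.prod_insert hi, coeffL_apply, MulMemClass.coe_mul, MvPowerSeries.coeff_mul]
        refine Finset.sum_eq_zero fun p hp => ?_
        rw [Finset.HasAntidiagonal.mem_antidiagonal] at hp
        rw [Finset.sum_insert hi, ← hp, map_add] at hγ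
        rw [← coeffL_apply, ← coeffL_apply, coeffL_hSymm]
        by_cases h1 : (p.1.degree : ℤ) = (b i : ℤ)
        · rw [ih p.2 (by omega), mul_zero]
        · rw [if_neg h1, zero_mul]
    refine key _ _ _ ?_
    rw [Finsupp.degree_apply] at hβ
    rw [hβ]
    exact h
  · simp

theorem schurDual_schur (μ ν : YoungDiagram) [Decidable (μ = ν)] :
    schurDual R μ (schur R ν) = if μ = ν then 1 else 0 := by
  by_cases hcard : μ.card = ν.card
  · rw [schur_eq_jacobiTrudi ν μ.card (hcard ▸ colLen_le_card ν), schurDual,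
      alternantCoeff_jacobiTrudi _ _ (fun i j h => μ.rowLen_anti i j h)
        (fun i j h => ν.rowLen_anti i j h)]
    have : (∀ i < μ.card, μ.rowLen i = ν.rowLen i) ↔ μ = ν := by
      refine ⟨fun h => youngDiagram_ext_rowLen fun i => ?_, fun h i _ => by rw [h]⟩
      by_cases hi : i < μ.card
      · exact h i hi
      · rw [rowLen_eq_zero_of_colLen_le, rowLen_eq_zero_of_colLen_le]
        · have := colLen_le_card ν
          omega
        · have := colLen_le_card μ
          omega
    simp [this]
  · rw [if_neg (fun h => hcard (congrArg YoungDiagram.card h))]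
    exact schurDual_eq_zero fun α hα => coeffL_schur_eq_zero (by omega)

/-- The second components of `homogPair_mem_span` show that every coefficient functional is a
combination of the functionals `schurDual`. -/
theorem eq_zero_of_schurDual {f : SymmFunc R} (h : ∀ μ, schurDual R μ f = 0) : f = 0 := by
  refine symmFunc_ext fun α => ?_
  have key : ∀ p ∈ Submodule.span R (Set.range (schurPair R)), p.2 f = 0 := by
    intro p hp
    induction hp using Submodule.span_induction with
    | mem p hp =>
      obtain ⟨μ, rfl⟩ := hp
      exact h μ
    | zero => rfl
    | add p p' _ _ h1 h2 =>
      rw [Prod.snd_add, LinearMap.add_apply, h1, h2, add_zero]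
    | smul r p _ h1 =>
      rw [Prod.smul_snd, LinearMap.smul_apply, h1, smul_zero]
  rw [map_zero]
  exact key _ (homogPair_mem_span α)

theorem finite_support_schurDual (f : SymmFunc R) :
    (Function.support fun μ => schurDual R μ f).Finite := by
  obtain ⟨d, hd⟩ := f.2.2
  refine (finite_card_le d).subset fun μ hμ => ?_
  by_contra hlt
  refine hμ (schurDual_eq_zero fun α hα => ?_)
  by_contra hne
  have := hd α hne
  simp only [Set.mem_ofPred_eq] at hlt
  omega

/-- The Schur functions form a basis of `Λ`. -/
def schurBasis (R : Type) [CommRing R] : Module.Basis YoungDiagram R (SymmFunc R) :=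
  Module.Basis.ofRepr
    { toFun := fun f => Finsupp.ofSupportFinite _ (finite_support_schurDual f)
      map_add' := fun f g => by
        ext μ
        simp [Finsupp.ofSupportFinite_coe]
      map_smul' := fun r f => by
        ext μ
        simp [Finsupp.ofSupportFinite_coe]
      invFun := Finsupp.linearCombination R (schur R)
      left_inv := fun f => by
        classical
        rw [← sub_eq_zero]
        refine eq_zero_of_schurDual fun μ => ?_
        rw [map_sub, Finsupp.linearCombination_apply, Finsupp.sum, map_sum]
        simp only [map_smul, schurDual_schur, smul_eq_mul, mul_ite, mul_one, mul_zero,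
          Finset.sum_ite_eq]
        split_ifs with h
        · rw [Finsupp.ofSupportFinite_coe, sub_self]
        · rw [Finsupp.notMem_support_iff, Finsupp.ofSupportFinite_coe] at h
          rw [h, sub_self]
      right_inv := fun c => by
        classical
        ext μ
        rw [Finsupp.ofSupportFinite_coe, Finsupp.linearCombination_apply, Finsupp.sum, map_sum]
        simp only [map_smul, schurDual_schur, smul_eq_mul, mul_ite, mul_one, mul_zero,
          Finset.sum_ite_eq]
        split_ifs with h
        · rfl
        · exact (Finsupp.notMem_support_iff.mp h).symm }

theorem schurBasis_apply (μ : YoungDiagram) : schurBasis R μ = schur R μ := by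
  change Finsupp.linearCombination R (schur R) (Finsupp.single μ 1) = _
  simp

theorem existsUnique_hallForm : ∃! B : LinearMap.BilinForm R (SymmFunc R), IsHallForm R B := by
  classical
  refine ⟨(schurBasis R).constr R fun μ => schurDual R μ, fun μ ν => ?_, fun B hB => ?_⟩
  · rw [← schurBasis_apply μ, Module.Basis.constr_basis, schurDual_schur]
  · refine (schurBasis R).ext fun μ => (schurBasis R).ext fun ν => ?_
    rw [Module.Basis.constr_basis, schurBasis_apply, schurBasis_apply, hB μ ν, schurDual_schur]

theorem isHallForm_hallForm : IsHallForm R (hallForm R) :=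
  Classical.epsilon_spec existsUnique_hallForm.exists

theorem hallForm_schur (μ : YoungDiagram) : hallForm R (schur R μ) = schurDual R μ := by
  classical
  refine (schurBasis R).ext fun ν => ?_
  rw [schurBasis_apply, isHallForm_hallForm μ ν, schurDual_schur]

/-- The first component represents the second through the Hall form for each `schurPair`, hence on
their whole span, which contains `homogPair R α`. Thus the `h_α` are dual to the monomials. -/
theorem hallForm_hProd (α : ℕ+ →₀ ℕ) : hallForm R (hProd R α) = coeffL R α := by
  have key : ∀ p ∈ Submodule.span R (Set.range (schurPair R)), hallForm R p.1 = p.2 := by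
    intro p hp
    induction hp using Submodule.span_induction with
    | mem p hp =>
      obtain ⟨μ, rfl⟩ := hp
      exact hallForm_schur μ
    | zero => simp
    | add p p' _ _ h1 h2 => rw [Prod.fst_add, map_add, h1, h2, Prod.snd_add]
    | smul r p _ h1 => rw [Prod.smul_fst, map_smul, h1, Prod.smul_snd]
  exact key _ (homogPair_mem_span α)

theorem hallForm_comm (f g : SymmFunc R) : hallForm R f g = hallForm R g f := by
  classical
  have : hallForm R = (hallForm R).flip := by
    refine (schurBasis R).ext fun μ => (schurBasis R).ext fun ν => ?_
    change _ = hallForm R (schurBasis R ν) (schurBasis R μ)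
    rw [schurBasis_apply, schurBasis_apply, isHallForm_hallForm μ ν, isHallForm_hallForm ν μ]
    simp [eq_comm]
  conv_lhs => rw [this]
  rfl

theorem span_hProd : Submodule.span R (Set.range (hProd R)) = ⊤ := by
  rw [eq_top_iff, ← (schurBasis R).span_eq, Submodule.span_le]
  rintro _ ⟨μ, rfl⟩
  have hexp := congrArg Prod.fst (jacobiTrudiPair_eq_sum (R := R) μ.card μ.rowLen)
  dsimp only at hexp
  rw [schurBasis_apply, schur_eq_jacobiTrudi μ μ.card (colLen_le_card μ), hexp, Prod.fst_sum]
  refine Submodule.sum_mem _ fun σ _ => ?_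
  rw [Prod.smul_fst]
  refine Submodule.smul_mem _ _ ?_
  split_ifs
  · exact Submodule.subset_span ⟨_, rfl⟩
  · exact Submodule.zero_mem _

theorem schurDual_mul_schur_eq_zero (s : SymmFunc R) {μ ν : YoungDiagram} (h : ν.card < μ.card) :
    schurDual R ν (s * schur R μ) = 0 := by
  refine schurDual_eq_zero fun α hα => ?_
  rw [coeffL_apply, MulMemClass.coe_mul, MvPowerSeries.coeff_mul]
  refine Finset.sum_eq_zero fun p hp => ?_
  rw [← coeffL_apply p.2, coeffL_schur_eq_zero, mul_zero]
  rw [Finset.HasAntidiagonal.mem_antidiagonal] at hp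
  rw [← hp, map_add] at hα
  omega

theorem existsUnique_skewing (s : SymmFunc R) :
    ∃! T : SymmFunc R →ₗ[R] SymmFunc R, IsSkewing R s T := by
  classical
  -- The expansion of the image of `s_ν` may be cut off at `|μ| ≤ |ν|`, because `s * s_μ` has no
  -- part of degree below `|μ|` and so pairs to zero with smaller `s_ν`.
  refine ⟨(schurBasis R).constr R fun ν => ∑ μ ∈ (finite_card_le ν.card).toFinset,
    hallForm R (schur R ν) (s * schur R μ) • schur R μ, ?_, ?_⟩
  · set T := (schurBasis R).constr R fun ν => ∑ μ ∈ (finite_card_le ν.card).toFinset,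
      hallForm R (schur R ν) (s * schur R μ) • schur R μ with hT
    have : hallForm R ∘ₗ T = (LinearMap.mul R (SymmFunc R) s).dualMap ∘ₗ hallForm R := by
      refine (schurBasis R).ext fun ν => (schurBasis R).ext fun μ => ?_
      rw [LinearMap.comp_apply, hT, Module.Basis.constr_basis, LinearMap.comp_apply,
        schurBasis_apply, schurBasis_apply, LinearMap.dualMap_apply, LinearMap.mul_apply',
        map_sum, LinearMap.sum_apply]
      simp only [map_smul, LinearMap.smul_apply, isHallForm_hallForm _ μ, smul_eq_mul, mul_ite,
        mul_one, mul_zero]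
      rw [Finset.sum_ite_eq']
      split_ifs with h
      · rfl
      · rw [hallForm_schur, schurDual_mul_schur_eq_zero]
        simpa using h
    intro f g
    exact LinearMap.congr_fun (LinearMap.congr_fun this f) g
  · intro T hT
    refine (schurBasis R).ext fun ν => ?_
    rw [← sub_eq_zero]
    refine eq_zero_of_schurDual fun μ => ?_
    rw [map_sub, ← hallForm_schur, hallForm_comm, hallForm_comm (schur R μ), hT,
      Module.Basis.constr_basis, schurBasis_apply, map_sum, LinearMap.sum_apply]
    simp only [map_smul, LinearMap.smul_apply, isHallForm_hallForm _ μ, smul_eq_mul, mul_ite,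
      mul_one, mul_zero]
    rw [Finset.sum_ite_eq', sub_eq_zero]
    split_ifs with h
    · rfl
    · rw [hallForm_schur, schurDual_mul_schur_eq_zero]
      simpa using h

theorem isSkewing_skew (s : SymmFunc R) : IsSkewing R s (skew R s) :=
  Classical.epsilon_spec (existsUnique_skewing s).exists

theorem coeffL_skew (s f : SymmFunc R) (α : ℕ+ →₀ ℕ) :
    coeffL R α (skew R s f) = hallForm R f (s * hProd R α) := by
  rw [← hallForm_hProd, hallForm_comm, isSkewing_skew s]

end Hall

end RiseDelta
end

noncomputable section

namespace RiseDelta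

/-! ### Skewing by a rectangle -/

section Rectangle

variable {R : Type} [CommRing R]

/-- The signed sum over words that arises from the expansion of a determinant of Hessenberg type
along its first row: a block of zeros followed by its length increased by one (by `a` in the first
block) contributes the sign given by the parity of the number of zeros. -/
def signedSum {A : Type} [AddCommGroup A] : ℕ → ℕ → (List ℕ → A) → A
  | a, 0, c => if a = 1 then c [] else 0
  | a, l + 1, c => signedSum 1 l (fun L => c (a :: L)) - signedSum (a + 1) l (fun L => c (0 :: L))

/-- The Jacobi–Trudi matrix of a rectangle with `l` rows of length `k - 1`, with the first column
replaced by `H (k - a - i)`. -/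
def rectMatrix {A : Type} (H : ℤ → A) (k : ℤ) (a l : ℕ) : Matrix (Fin l) (Fin l) A :=
  Matrix.of fun i j => if (j : ℕ) = 0 then H (k - a - (i : ℕ)) else H (k - 1 - (i : ℕ) + (j : ℕ))

theorem rectMatrix_one_eq {A : Type} (H : ℤ → A) (k : ℤ) (l : ℕ) :
    rectMatrix H k 1 l = Matrix.of fun i j : Fin l => H (k - 1 - (i : ℕ) + (j : ℕ)) := by
  ext1 i j
  simp only [rectMatrix, Matrix.of_apply]
  split_ifs with h
  · congr 1
    rw [h]
    push_cast
    ring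
  · rfl

/-- Laplace expansion along the first row `h_{k-a}, h_k, h_{k+1}, …`. Deleting column `0` gives the
matrix with parameter `1`. Deleting column `1` keeps the first column, shifted down by one row,
which raises `a` by one. From column `2` on the entries are orthogonal to `f`. The side condition on
`l` and `a` is there since an empty determinant is `1`, whereas the signed sum of length `0`
vanishes unless `a = 1`. -/
theorem hallForm_det_rectMatrix (f : SymmFunc R) (k : ℕ)
    (hf : ∀ a : ℤ, k < a → ∀ g, hallForm R f (hSymm R a * g) = 0) (l : ℕ) :
    ∀ (a : ℕ) (g : SymmFunc R), 1 ≤ a → (l ≠ 0 ∨ a = 1) →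
      hallForm R f ((rectMatrix (hSymm R) k a l).det * g) =
        signedSum a l fun L => hallForm R f ((L.map fun b : ℕ => hSymm R ((k : ℤ) - b)).prod * g) := by
  induction l with
  | zero =>
    intro a g _ h
    simp [signedSum, h.resolve_left (by simp)]
  | succ l ih =>
    intro a g ha _
    have hminor0 : (rectMatrix (hSymm R) k a (l + 1)).submatrix Fin.succ (Fin.succAbove 0) =
        rectMatrix (hSymm R) k 1 l := by
      rw [rectMatrix_one_eq]
      ext1 i j
      simp only [rectMatrix, Matrix.submatrix_apply, Matrix.of_apply, Fin.succAbove_zero,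
        Fin.val_succ, Nat.add_eq_zero_iff, one_ne_zero, and_false, if_false]
      congr 1
      push_cast
      ring
    have hmain : hallForm R f ((rectMatrix (hSymm R) k a (l + 1)).det * g) =
        hallForm R f ((rectMatrix (hSymm R) k 1 l).det * (hSymm R ((k : ℤ) - a) * g)) -
        if l = 0 then 0 else
          hallForm R f ((rectMatrix (hSymm R) k (a + 1) l).det * (hSymm R k * g)) := by
      rw [Matrix.det_succ_row_zero, Fin.sum_univ_succ, hminor0]
      rcases l with _ | l
      · simp [rectMatrix]
      · rw [Fin.sum_univ_succ, if_neg (by omega)]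
        have hminor1 : (rectMatrix (hSymm R) k a (l + 2)).submatrix Fin.succ
            (Fin.succAbove (Fin.succ 0)) = rectMatrix (hSymm R) k (a + 1) (l + 1) := by
          ext1 i j
          simp only [rectMatrix, Matrix.submatrix_apply, Matrix.of_apply, Fin.val_succ]
          rcases Fin.eq_zero_or_eq_succ j with rfl | ⟨j, rfl⟩
          · rw [Fin.succAbove_of_castSucc_lt _ _ (by simp)]
            simp only [Fin.val_castSucc, Fin.val_zero, if_true]
            congr 1
            push_cast
            ring
          · rw [Fin.succAbove_of_le_castSucc _ _ (by simp [Fin.le_def])]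
            simp only [Fin.val_succ, Nat.add_eq_zero_iff, one_ne_zero, and_false, if_false]
            congr 1
            push_cast
            ring
        rw [hminor1, add_mul, add_mul, map_add, map_add]
        have hrest : hallForm R f ((∑ i : Fin l, (-1) ^ ((i.succ.succ : Fin (l + 2)) : ℕ) *
            rectMatrix (hSymm R) k a (l + 2) 0 i.succ.succ *
            ((rectMatrix (hSymm R) k a (l + 2)).submatrix Fin.succ
              (Fin.succAbove i.succ.succ)).det) * g) = 0 := by
          rw [Finset.sum_mul, map_sum]
          refine Finset.sum_eq_zero fun i _ => ?_
          have : rectMatrix (hSymm R) k a (l + 2) 0 i.succ.succ =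
              hSymm R ((k : ℤ) + 1 + (i : ℕ)) := by
            simp only [rectMatrix, Matrix.of_apply, Fin.val_succ]
            rw [if_neg (by omega)]
            congr 1
            simp
            ring
          rw [this, mul_comm ((-1 : SymmFunc R) ^ _), mul_assoc, mul_assoc]
          exact hf _ (by omega) _
        rw [hrest, add_zero, sub_eq_add_neg, ← map_neg]
        congr 2
        · simp only [rectMatrix, Matrix.of_apply, Fin.val_zero, if_true]
          simp only [pow_zero, one_mul, Nat.cast_zero, sub_zero]
          ring
        · simp only [rectMatrix, Matrix.of_apply, Fin.val_zero, Fin.val_succ]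
          simp only [zero_add, pow_one, Nat.cast_zero, sub_zero, Nat.cast_one, sub_add_cancel,
            one_ne_zero, if_false]
          ring
    rw [hmain, signedSum]
    congr 1
    · rw [ih 1 _ le_rfl (Or.inr rfl)]
      congr 1
      funext L
      rw [List.map_cons, List.prod_cons]
      congr 1
      ring
    · split_ifs with hl
      · subst hl
        rw [signedSum, if_neg (by omega)]
      · rw [ih (a + 1) _ (by omega) (Or.inl hl)]
        congr 1
        funext L
        rw [List.map_cons, List.prod_cons]
        congr 1
        simp only [Nat.cast_zero, sub_zero]
        ring

theorem schur_rectPartition (l b : ℕ) :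
    schur R (rectPartition l b) = (rectMatrix (hSymm R) (b + 1) 1 l).det := by
  have hrow (i : ℕ) : (rectPartition l b).rowLen i = if i < l then b else 0 := by
    rw [rectPartition, rowLen_ofRowLens']
    split_ifs with h
    · rw [List.getD_eq_getElem _ _ (by simpa using h)]
      simp
    · rw [List.getD_eq_default]
      simpa using h
  rw [schur_eq_jacobiTrudi _ l (colLen_le_of_rowLen _ _ (by simp [hrow])), jacobiTrudi,
    rectMatrix_one_eq]
  congr 1
  ext1 i j
  simp [hrow]

/-- The exponent vector whose entries are the members of a list. -/
def listExp (L : List ℕ) : ℕ+ →₀ ℕ := vecExp L.get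

theorem hProd_listExp (L : List ℕ) : hProd R (listExp L) = (L.map fun a : ℕ => hSymm R (a : ℤ)).prod := by
  rw [listExp, hProd_vecExp]
  conv_rhs => rw [← List.ofFn_get L]
  rw [List.map_ofFn, List.prod_ofFn]
  rfl

theorem exists_listExp (α : ℕ+ →₀ ℕ) : ∃ (τ : Equiv.Perm ℕ+) (L : List ℕ),
    α = (listExp L).embDomain τ.toEmbedding := by
  obtain ⟨τ, v, hv⟩ := exists_vecExp α
  refine ⟨τ, List.ofFn v, hv.trans ?_⟩
  congr 1
  have key : ∀ (n : ℕ) (u : Fin n → ℕ) (L : List ℕ) (h : L.length = n),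
      (∀ i, u i = L.get (Fin.cast h.symm i)) → vecExp u = listExp L := by
    rintro n u L rfl h
    rw [listExp]
    congr 1
    funext i
    exact h i
  exact key _ v _ (List.length_ofFn) fun i => by simp

/-- If all exponents occurring in `f` are at most `k`, then `f` is orthogonal to the multiples of
`h_a` for `a > k`. -/
theorem hallForm_hSymm_mul_eq_zero (f : SymmFunc R) (k : ℕ)
    (hf : ∀ (α : ℕ+ →₀ ℕ) i, k < α i → coeffL R α f = 0) (a : ℤ) (ha : k < a) (g : SymmFunc R) :
    hallForm R f (hSymm R a * g) = 0 := by
  have hg : g ∈ Submodule.span R (Set.range (hProd R)) := by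
    rw [span_hProd]
    trivial
  induction hg using Submodule.span_induction with
  | mem g hg =>
    obtain ⟨β, rfl⟩ := hg
    -- With a variable not used by `β`, the product `h_a h_β` is again a product of the same kind,
    -- having the exponent `a` at `i`. Its pairing with `f` is thus a coefficient of `f` with an
    -- exponent above `k`.
    obtain ⟨i, hi⟩ := Infinite.exists_notMem_finset β.support
    lift a to ℕ using by omega
    have hprod : hSymm R (a : ℤ) * hProd R β = hProd R (Finsupp.single i a + β) := by
      rw [hProd, hProd, Finsupp.prod_add_index_of_disjoint]
      · rw [Finsupp.prod_single_index]
        exact hSymm_zero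
      · exact Finset.disjoint_of_subset_left Finsupp.support_single_subset (by simpa using hi)
    rw [hprod, hallForm_comm, hallForm_hProd]
    refine hf _ i ?_
    rw [Finsupp.add_apply, Finsupp.single_eq_same]
    omega
  | zero => simp
  | add x y _ _ hx hy => rw [mul_add, map_add, hx, hy, add_zero]
  | smul r x _ hx => rw [mul_smul_comm, map_smul, hx, smul_zero]

/-- The coefficients of the result of skewing by a rectangle. -/
theorem coeffL_skew_rect (f : SymmFunc R) (k l : ℕ) (hk : 1 ≤ k)
    (hf : ∀ (α : ℕ+ →₀ ℕ) i, k < α i → coeffL R α f = 0) (M : List ℕ) :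
    coeffL R (listExp M) (skew R (schur R (rectPartition l (k - 1))) f) =
      signedSum 1 l fun L => if ∀ a ∈ L, a ≤ k then
        coeffL R (listExp (M ++ L.map fun a => k - a)) f else 0 := by
  rw [coeffL_skew, schur_rectPartition,
    show ((k - 1 : ℕ) : ℤ) + 1 = (k : ℤ) by omega,
    hallForm_det_rectMatrix f k (hallForm_hSymm_mul_eq_zero f k hf) l 1 _ le_rfl (Or.inr rfl)]
  congr 1
  funext L
  split_ifs with h
  · rw [hallForm_comm, ← hallForm_hProd, hProd_listExp, hProd_listExp, List.map_append,
      List.prod_append, mul_comm, List.map_map]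
    congr 3
    refine congrArg List.prod (List.map_congr_left fun a ha => ?_)
    rw [Function.comp_apply, Nat.cast_sub (h a ha)]
  · push Not at h
    obtain ⟨a, ha, hlt⟩ := h
    rw [List.prod_eq_zero, zero_mul, map_zero]
    rw [List.mem_map]
    exact ⟨a, ha, hSymm_neg _ (by omega)⟩

end Rectangle

end RiseDelta
end

noncomputable section

namespace RiseDelta

/-! ### Ascents of two-letter words on unit interval graphs -/

section UnitInterval

variable {α A : Type} [DecidableEq α] [CommRing A]

/-- The number of edges that go from `S` to its complement. -/
def edgeAsc (E : Finset (α × α)) (S : Finset α) : ℕ :=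
  (E.filter fun e => e.1 ∈ S ∧ e.2 ∉ S).card

/-- By the interval property each vertex `w` strictly between the ends `u`, `v` of the longest edge
is joined to both. With `u` inside and `v` outside the set, exactly one of `(u, w)` and `(w, v)`
ascends, whichever side `w` is on. Maximality of the edge excludes all other ascending edges at `u`
or `v`, so these two vertices contribute a constant. -/
theorem edgeAsc_insert_longest (κ : α → ℤ) (hκ : Function.Injective κ) (V : Finset α)
    (E : Finset (α × α)) (hV : ∀ e ∈ E, e.1 ∈ V ∧ e.2 ∈ V ∧ κ e.1 < κ e.2)
    (hE : ∀ e ∈ E, ∀ u ∈ V, ∀ v ∈ V, κ e.1 ≤ κ u → κ u < κ v → κ v ≤ κ e.2 → (u, v) ∈ E)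
    (e : α × α) (he : e ∈ E) (hmax : ∀ e' ∈ E, κ e'.2 - κ e'.1 ≤ κ e.2 - κ e.1)
    (S : Finset α) (hS : S ⊆ (V.erase e.1).erase e.2) :
    edgeAsc (E.erase e) (insert e.1 S) =
      (V.filter fun w => κ e.1 < κ w ∧ κ w < κ e.2).card +
      edgeAsc (E.filter fun e' => e'.1 ∈ (V.erase e.1).erase e.2 ∧ e'.2 ∈ (V.erase e.1).erase e.2)
        S := by
  obtain ⟨u, v⟩ := e
  dsimp only at *
  set B := V.filter fun w => κ u < κ w ∧ κ w < κ v with hB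
  obtain ⟨huV, hvV, huv⟩ := hV _ he
  dsimp only at *
  have hSu : u ∉ S := fun h => by simpa using hS h
  have hSv : v ∉ S := fun h => by simpa using hS h
  have hsplit : (E.erase (u, v)).filter (fun e => e.1 ∈ insert u S ∧ e.2 ∉ insert u S) =
      ((B.filter (· ∉ S)).image (fun w => (u, w)) ∪ (B.filter (· ∈ S)).image (fun w => (w, v))) ∪
      (E.filter fun e' => e'.1 ∈ (V.erase u).erase v ∧ e'.2 ∈ (V.erase u).erase v).filter
        (fun e => e.1 ∈ S ∧ e.2 ∉ S) := by
    ext ⟨x, y⟩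
    simp only [Finset.mem_filter, Finset.mem_erase, Finset.mem_insert, Finset.mem_union,
      Finset.mem_image, Prod.mk.injEq, hB, not_or]
    constructor
    · rintro ⟨⟨hne, hxy⟩, hx, hyu, hyS⟩
      obtain ⟨hxV, hyV, hlt⟩ := hV _ hxy
      dsimp only at hxV hyV hlt
      have hm := hmax _ hxy
      dsimp only at hm
      by_cases hxu : x = u
      · subst hxu
        have hyv : y ≠ v := fun h => hne (by rw [h])
        have : κ y ≠ κ v := fun h => hyv (hκ h)
        exact Or.inl (Or.inl ⟨y, ⟨⟨hyV, hlt, by omega⟩, hyS⟩, rfl, rfl⟩)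
      · have hxS : x ∈ S := hx.resolve_left hxu
        have hxv : x ≠ v := fun h => hSv (h ▸ hxS)
        by_cases hyv : y = v
        · subst hyv
          have : κ x ≠ κ u := fun h => hxu (hκ h)
          exact Or.inl (Or.inr ⟨x, ⟨⟨hxV, by omega, hlt⟩, hxS⟩, rfl, rfl⟩)
        · exact Or.inr ⟨⟨hxy, ⟨hxv, hxu, hxV⟩, hyv, hyu, hyV⟩, hxS, hyS⟩
    · rintro ((⟨w, ⟨⟨hwV, h1, h2⟩, hwS⟩, rfl, rfl⟩ | ⟨w, ⟨⟨hwV, h1, h2⟩, hwS⟩, rfl, rfl⟩) |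
        ⟨⟨hxy, ⟨hxv, hxu, hxV⟩, hyv, hyu, hyV⟩, hxS, hyS⟩)
      · refine ⟨⟨fun h => ?_, hE _ he u huV w hwV le_rfl h1 h2.le⟩, Or.inl rfl, fun h => ?_, hwS⟩
        · rw [(Prod.mk.inj h).2] at h2
          exact lt_irrefl _ h2
        · rw [h] at h1
          exact lt_irrefl _ h1
      · refine ⟨⟨fun h => ?_, hE _ he w hwV v hvV h1.le h2 le_rfl⟩, Or.inr hwS, fun h => ?_, hSv⟩
        · rw [(Prod.mk.inj h).1] at h1
          exact lt_irrefl _ h1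
        · rw [h] at huv
          exact lt_irrefl _ huv
      · exact ⟨⟨fun h => hxu (Prod.mk.inj h).1, hxy⟩, Or.inr hxS, hyu, hyS⟩
  rw [edgeAsc, hsplit, Finset.card_union_of_disjoint, Finset.card_union_of_disjoint,
    Finset.card_image_of_injective _ (fun a b h => (Prod.mk.inj h).2),
    Finset.card_image_of_injective _ (fun a b h => (Prod.mk.inj h).1), edgeAsc]
  · congr 1
    rw [add_comm, Finset.card_filter_add_card_filter_not]
  · rw [Finset.disjoint_left]
    intro x hx hx'
    simp only [Finset.mem_image, Finset.mem_filter] at hx hx'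
    obtain ⟨w, hw, rfl⟩ := hx
    obtain ⟨w', hw', h⟩ := hx'
    exact hSu ((Prod.mk.inj h).1 ▸ hw'.2)
  · rw [Finset.disjoint_left]
    intro x hx hx'
    simp only [Finset.mem_union, Finset.mem_image, Finset.mem_filter, Finset.mem_erase] at hx hx'
    rcases hx with ⟨w, hw, rfl⟩ | ⟨w, hw, rfl⟩
    · exact hx'.1.2.1.2.1 rfl
    · exact hx'.1.2.2.1 rfl

/-- The distribution of the number of ascending edges of a subset of the vertices of a unit
interval graph is unchanged when the roles of the subset and its complement are exchanged in the
bookkeeping of cardinalities. -/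
theorem sum_pow_edgeAsc_symm (q : A) (κ : α → ℤ) (hκ : Function.Injective κ)
    (V : Finset α) (E : Finset (α × α)) (hV : ∀ e ∈ E, e.1 ∈ V ∧ e.2 ∈ V ∧ κ e.1 < κ e.2)
    (hE : ∀ e ∈ E, ∀ u ∈ V, ∀ v ∈ V, κ e.1 ≤ κ u → κ u < κ v → κ v ≤ κ e.2 → (u, v) ∈ E)
    (c : ℕ → ℕ → A) :
    ∑ S ∈ V.powerset, q ^ edgeAsc E S * c S.card (V \ S).card =
      ∑ S ∈ V.powerset, q ^ edgeAsc E S * c (V \ S).card S.card := by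
  induction hn : E.card using Nat.strong_induction_on generalizing V E c with
  | _ n ih =>
  rcases E.eq_empty_or_nonempty with rfl | hne
  · simp only [edgeAsc, Finset.filter_empty, Finset.card_empty, pow_zero, one_mul]
    refine Finset.sum_nbij' (V \ ·) (V \ ·) (by simp) (by simp) ?_ ?_ ?_
    · intro S hS
      exact Finset.sdiff_sdiff_eq_self (Finset.mem_powerset.mp hS)
    · intro S hS
      exact Finset.sdiff_sdiff_eq_self (Finset.mem_powerset.mp hS)
    · intro S hS
      rw [Finset.sdiff_sdiff_eq_self (Finset.mem_powerset.mp hS)]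
  obtain ⟨e, he, hmax⟩ := E.exists_max_image (fun e => κ e.2 - κ e.1) hne
  obtain ⟨huV, hvV, huv⟩ := hV e he
  have huv' : e.1 ≠ e.2 := fun h => by
    rw [h] at huv
    exact lt_irrefl _ huv
  set V' := (V.erase e.1).erase e.2 with hV'
  set E' := E.filter fun e' => e'.1 ∈ V' ∧ e'.2 ∈ V' with hE'
  set b := (V.filter fun w => κ e.1 < κ w ∧ κ w < κ e.2).card with hb
  have hV'V : V' ⊆ V := (Finset.erase_subset _ _).trans (Finset.erase_subset _ _)
  -- Deletion of the longest edge: `q^(x+1) = q^x + (q-1) q^x` when it ascends. In the correction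
  -- term one end lies in `S` and the other outside, so removing both ends raises both arguments of
  -- `c` by one, which is compatible with exchanging them.
  have hrec (c : ℕ → ℕ → A) : ∑ S ∈ V.powerset, q ^ edgeAsc E S * c S.card (V \ S).card =
      ∑ S ∈ V.powerset, q ^ edgeAsc (E.erase e) S * c S.card (V \ S).card +
      (q - 1) * q ^ b * ∑ S ∈ V'.powerset,
        q ^ edgeAsc E' S * c (S.card + 1) ((V' \ S).card + 1) := by
    have h1 (S : Finset α) : q ^ edgeAsc E S = q ^ edgeAsc (E.erase e) S +
        if e.1 ∈ S ∧ e.2 ∉ S then (q - 1) * q ^ edgeAsc (E.erase e) S else 0 := by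
      have : edgeAsc E S = edgeAsc (E.erase e) S + if e.1 ∈ S ∧ e.2 ∉ S then 1 else 0 := by
        conv_lhs => rw [edgeAsc, ← Finset.insert_erase he, Finset.filter_insert]
        split_ifs with h
        · rw [Finset.card_insert_of_notMem (by simp)]
          rfl
        · rfl
      rw [this]
      split_ifs
      · rw [pow_succ]
        ring
      · simp
    have h2 : ∑ S ∈ V.powerset, (if e.1 ∈ S ∧ e.2 ∉ S then
        (q - 1) * q ^ edgeAsc (E.erase e) S else 0) * c S.card (V \ S).card =
        ∑ S ∈ V'.powerset, (q - 1) * q ^ b *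
          (q ^ edgeAsc E' S * c (S.card + 1) ((V' \ S).card + 1)) := by
      simp only [ite_mul, zero_mul]
      rw [← Finset.sum_filter]
      refine Finset.sum_nbij' (fun S => S.erase e.1) (fun S => insert e.1 S) ?_ ?_ ?_ ?_ ?_
      · intro S hS
        simp only [Finset.mem_filter, Finset.mem_powerset] at hS ⊢
        intro x hx
        simp only [hV', Finset.mem_erase] at hx ⊢
        exact ⟨fun h => hS.2.2 (h ▸ hx.2), hx.1, hS.1 hx.2⟩
      · intro S hS
        simp only [Finset.mem_filter, Finset.mem_powerset] at hS ⊢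
        refine ⟨Finset.insert_subset huV (hS.trans hV'V), Finset.mem_insert_self _ _, ?_⟩
        rw [Finset.mem_insert]
        rintro (h | h)
        · exact huv' h.symm
        · simpa [hV'] using hS h
      · intro S hS
        simp only [Finset.mem_filter] at hS
        exact Finset.insert_erase hS.2.1
      · intro S hS
        rw [Finset.mem_powerset] at hS
        exact Finset.erase_insert fun h => by simpa [hV'] using hS h
      · intro S hS
        simp only [Finset.mem_filter, Finset.mem_powerset] at hS
        obtain ⟨hSV, huS, hvS⟩ := hS
        have hsub : S.erase e.1 ⊆ V' := by
          intro x hx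
          simp only [hV', Finset.mem_erase] at hx ⊢
          exact ⟨fun h => hvS (h ▸ hx.2), hx.1, hSV hx.2⟩
        have h3 := edgeAsc_insert_longest κ hκ V E hV hE e he hmax (S.erase e.1) hsub
        rw [Finset.insert_erase huS] at h3
        have h4 : (S.erase e.1).card + 1 = S.card := Finset.card_erase_add_one huS
        have h5 : (V' \ S.erase e.1).card + 1 = (V \ S).card := by
          have : V' \ S.erase e.1 = (V \ S).erase e.2 := by
            ext x
            simp only [hV', Finset.mem_sdiff, Finset.mem_erase, not_and]
            constructor
            · rintro ⟨⟨h1, h2, h3⟩, h4⟩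
              exact ⟨h1, h3, h4 h2⟩
            · rintro ⟨h1, h2, h3⟩
              exact ⟨⟨h1, fun h => h3 (h ▸ huS), h2⟩, fun _ => h3⟩
          rw [this, Finset.card_erase_add_one (by simp [hvV, hvS])]
        rw [h3, h4, h5, pow_add]
        ring
    rw [Finset.mul_sum, ← h2, ← Finset.sum_add_distrib]
    exact Finset.sum_congr rfl fun S _ => by rw [h1, add_mul]
  have hcard : (E.erase e).card < n := hn ▸ Finset.card_erase_lt_of_mem he
  have hcard' : E'.card < n := by
    rw [← hn]
    refine Finset.card_lt_card ⟨Finset.filter_subset _ _, fun h => ?_⟩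
    have := h he
    simp [hE', hV'] at this
  rw [hrec c, hrec fun x y => c y x]
  congr 1
  · refine ih _ hcard V (E.erase e) (fun e' h => hV e' (Finset.mem_of_mem_erase h)) ?_ c rfl
    -- Without its longest edge the graph keeps the interval property: that edge could only be
    -- forced by an edge at least as long, which would have the same ends.
    intro e' he' u hu v hv h1 h2 h3
    refine Finset.mem_erase.mpr ⟨?_, hE e' (Finset.mem_of_mem_erase he') u hu v hv h1 h2 h3⟩
    rintro rfl
    have := hmax e' (Finset.mem_of_mem_erase he')
    dsimp only at *
    apply Finset.ne_of_mem_erase he'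
    refine Prod.ext (hκ ?_) (hκ ?_) <;> dsimp only <;> omega
  · congr 1
    refine ih _ hcard' V' E' ?_ ?_ (fun x y => c (x + 1) (y + 1)) rfl
    · intro e' h
      simp only [hE', Finset.mem_filter] at h
      exact ⟨h.2.1, h.2.2, (hV e' h.1).2.2⟩
    · intro e' he' u hu v hv h1 h2 h3
      simp only [hE', Finset.mem_filter] at he' ⊢
      exact ⟨hE e' he'.1 u (hV'V hu) v (hV'V hv) h1 h2 h3, hu, hv⟩

end UnitInterval

end RiseDelta
end

noncomputable section

namespace RiseDelta

/-! ### Transfer functions for fillings of columns -/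

section Transfer

variable {F : Type} [Field F] {k : ℕ}

/-- Column `i` at height `p i` comes after the box of column `j` at height `y` in reading order. -/
def After (p : Fin k → ℤ) (y : ℤ) (j i : Fin k) : Prop :=
  (i < j ∧ y < p i) ∨ (j < i ∧ y ≤ p i)

instance (p : Fin k → ℤ) (y : ℤ) (j i : Fin k) : Decidable (After p y j i) := by
  unfold After
  infer_instance

/-- The number of columns that come after the box of column `j` at height `y`. -/
def rankOf (p : Fin k → ℤ) (y : ℤ) (j : Fin k) : ℕ :=
  ∑ i, if After p y j i then 1 else 0

/-- The sum of the ranks of the next boxes of the columns in `ε`. -/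
def rankSum (p : Fin k → ℤ) (ε : Finset (Fin k)) : ℕ := ∑ j ∈ ε, rankOf p (p j) j

/-- Add a box to each of the columns in `ε`. -/
def addBoxes (p : Fin k → ℤ) (ε : Finset (Fin k)) (j : Fin k) : ℤ :=
  p j + if j ∈ ε then 1 else 0

/-- The generating function of fillings of the columns between the heights `p` and `p'`, in which
the `x`-th label is used `L x` times, and each box is weighted by its rank at the time it is
added. -/
def transfer (q : F) : List ℕ → (Fin k → ℤ) → (Fin k → ℤ) → F
  | [], p, p' => if p = p' then 1 else 0
  | a :: L, p, p' => ∑ ε ∈ Finset.powersetCard a Finset.univ,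
      q ^ rankSum p ε * transfer q L (addBoxes p ε) p'

theorem rankSum_eq (p : Fin k → ℤ) (ε : Finset (Fin k)) :
    rankSum p ε = ∑ j, ∑ i, if j ∈ ε ∧ After p (p j) j i then 1 else 0 := by
  rw [rankSum, ← Finset.sum_filter_add_sum_filter_not Finset.univ (· ∈ ε)]
  have h2 : ∑ j with j ∉ ε, (∑ i, if j ∈ ε ∧ After p (p j) j i then 1 else 0) = 0 := by
    refine Finset.sum_eq_zero fun j hj => ?_
    simp [(Finset.mem_filter.mp hj).2]
  rw [h2, add_zero, Finset.filter_mem_eq_inter, Finset.univ_inter]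
  refine Finset.sum_congr rfl fun j hj => ?_
  simp [rankOf, hj]

theorem double_sum_eq_of_symm (X Y : Fin k → Fin k → ℕ)
    (h : ∀ i j, X i j + X j i = Y i j + Y j i) : ∑ i, ∑ j, X i j = ∑ i, ∑ j, Y i j := by
  have key (Z : Fin k → Fin k → ℕ) :
      2 * ∑ i, ∑ j, Z i j = ∑ i, ∑ j, (Z i j + Z j i) := by
    simp only [Finset.sum_add_distrib]
    rw [Finset.sum_comm (f := fun i j => Z j i)]
    ring
  have := (key X).trans (Eq.trans (by simp only [h]) (key Y).symm)
  omega

/-- The pairs of columns of `J` whose next boxes attack each other. -/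
def attackEdges (p : Fin k → ℤ) (J : Finset (Fin k)) : Finset (Fin k × Fin k) :=
  (J ×ˢ J).filter fun e => (p e.1 = p e.2 ∧ e.1 < e.2) ∨ (p e.1 + 1 = p e.2 ∧ e.2 < e.1)

/-- Two consecutive labels are placed: `I` receives both, `J` exactly one, and `S ⊆ J` receives the
smaller. Relative to the choice `S = ∅`, the rank changes only through pairs of columns in `J` whose
next boxes attack each other, by one for each attack from `S` to its complement. The check is local
to an unordered pair of columns. -/
theorem rankSum_two_steps (p : Fin k → ℤ) (I J S : Finset (Fin k)) (hIJ : Disjoint I J)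
    (hS : S ⊆ J) :
    rankSum p (I ∪ S) + rankSum (addBoxes p (I ∪ S)) (I ∪ J \ S) =
      rankSum p I + rankSum (addBoxes p I) (I ∪ J) + edgeAsc (attackEdges p J) S := by
  have hasc : edgeAsc (attackEdges p J) S = ∑ i, ∑ j, if i ∈ S ∧ j ∈ J ∧ j ∉ S ∧
      ((p i = p j ∧ i < j) ∨ (p i + 1 = p j ∧ j < i)) then 1 else 0 := by
    rw [← Finset.sum_product', Finset.univ_product_univ, ← Finset.card_filter, edgeAsc, attackEdges]
    congr 1
    ext ⟨i, j⟩
    simp only [Finset.mem_filter, Finset.mem_product, Finset.mem_univ, true_and]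
    constructor
    · rintro ⟨⟨⟨-, h1⟩, h2⟩, h3, h4⟩
      exact ⟨h3, h1, h4, h2⟩
    · rintro ⟨h3, h1, h4, h2⟩
      exact ⟨⟨⟨hS h3, h1⟩, h2⟩, h3, h4⟩
  simp only [rankSum_eq, hasc, ← Finset.sum_add_distrib]
  refine double_sum_eq_of_symm _ _ fun i j => ?_
  rcases eq_or_ne i j with rfl | hne
  · simp [After]
  have hS' (x : Fin k) : x ∈ S → x ∈ J := fun h => hS h
  have hIJ' (x : Fin k) : x ∈ I → x ∉ J := fun h => Finset.disjoint_left.mp hIJ h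
  have state (x : Fin k) : (x ∈ I ∧ x ∉ J ∧ x ∉ S) ∨ (x ∉ I ∧ x ∉ J ∧ x ∉ S) ∨
      (x ∉ I ∧ x ∈ J ∧ x ∈ S) ∨ (x ∉ I ∧ x ∈ J ∧ x ∉ S) := by
    have := hS' x
    have := hIJ' x
    tauto
  rcases lt_or_gt_of_ne hne with hlt | hlt
  · have hn : ¬ j < i := hlt.asymm
    rcases state i with ⟨h1, h2, h3⟩ | ⟨h1, h2, h3⟩ | ⟨h1, h2, h3⟩ | ⟨h1, h2, h3⟩ <;>
    rcases state j with ⟨h4, h5, h6⟩ | ⟨h4, h5, h6⟩ | ⟨h4, h5, h6⟩ | ⟨h4, h5, h6⟩ <;>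
    simp only [After, addBoxes, Finset.mem_union, Finset.mem_sdiff, h1, h2, h3, h4, h5, h6, hlt, hn,
      true_and, false_and, and_true, and_false, or_true, false_or, or_false, if_true,
      if_false, not_true, not_false_eq_true, add_zero, zero_add] <;>
    split_ifs <;> omega
  · have hn : ¬ i < j := hlt.asymm
    rcases state i with ⟨h1, h2, h3⟩ | ⟨h1, h2, h3⟩ | ⟨h1, h2, h3⟩ | ⟨h1, h2, h3⟩ <;>
    rcases state j with ⟨h4, h5, h6⟩ | ⟨h4, h5, h6⟩ | ⟨h4, h5, h6⟩ | ⟨h4, h5, h6⟩ <;>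
    simp only [After, addBoxes, Finset.mem_union, Finset.mem_sdiff, h1, h2, h3, h4, h5, h6, hlt, hn,
      true_and, false_and, and_true, and_false, or_true, false_or, or_false, if_true,
      if_false, not_true, not_false_eq_true, add_zero, zero_add] <;>
    split_ifs <;> omega

theorem addBoxes_addBoxes (p : Fin k → ℤ) (I J S : Finset (Fin k)) (hIJ : Disjoint I J)
    (hS : S ⊆ J) :
    addBoxes (addBoxes p (I ∪ S)) (I ∪ J \ S) = addBoxes (addBoxes p I) (I ∪ J) := by
  funext x
  have h1 : x ∈ S → x ∈ J := fun h => hS h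
  have h2 : x ∈ I → x ∉ J := fun h => Finset.disjoint_left.mp hIJ h
  simp only [addBoxes, Finset.mem_union, Finset.mem_sdiff]
  by_cases hI : x ∈ I <;> by_cases hJ : x ∈ J <;> by_cases hS : x ∈ S <;> simp_all

/-- Reading order places the next box of column `j` at the integer `k * p j + j`. Attacking pairs
are those at a distance strictly between `0` and `k`, so they form a unit interval graph. -/
theorem sum_attackEdges_symm (q : F) (p : Fin k → ℤ) (J : Finset (Fin k)) (c : ℕ → ℕ → F) :
    ∑ S ∈ J.powerset, q ^ edgeAsc (attackEdges p J) S * c S.card (J \ S).card =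
      ∑ S ∈ J.powerset, q ^ edgeAsc (attackEdges p J) S * c (J \ S).card S.card := by
  have hk (u v : Fin k) (a b : ℤ) : (k * a + (u : ℕ) < k * b + (v : ℕ) ↔
      a < b ∨ (a = b ∧ u < v)) := by
    have hu : ((u : ℕ) : ℤ) < k := by exact_mod_cast u.isLt
    have hv : ((v : ℕ) : ℤ) < k := by exact_mod_cast v.isLt
    rw [Fin.lt_def]
    constructor
    · intro h
      by_contra hcon
      push Not at hcon
      obtain ⟨h1, h2⟩ := hcon
      rcases h1.lt_or_eq with h3 | h3
      · have : (k : ℤ) * (b + 1) ≤ k * a := by gcongr; omega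
        nlinarith
      · subst h3
        have := h2 rfl
        omega
    · rintro (h | ⟨rfl, h⟩)
      · have : (k : ℤ) * (a + 1) ≤ k * b := by gcongr; omega
        nlinarith
      · omega
  have hatt (u v : Fin k) : ((p u = p v ∧ u < v) ∨ (p u + 1 = p v ∧ v < u)) ↔
      (k * p u + (u : ℕ) < k * p v + (v : ℕ) ∧ (k : ℤ) * p v + (v : ℕ) < k * (p u + 1) + (u : ℕ)) := by
    rw [hk, hk]
    constructor
    · rintro (⟨h1, h2⟩ | ⟨h1, h2⟩)
      · exact ⟨Or.inr ⟨h1, h2⟩, Or.inl (by omega)⟩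
      · exact ⟨Or.inl (by omega), Or.inr ⟨h1.symm, h2⟩⟩
    · rintro ⟨h1 | ⟨h1, h1'⟩, h2 | ⟨h2, h2'⟩⟩
      · omega
      · exact Or.inr ⟨h2.symm, h2'⟩
      · exact Or.inl ⟨h1, h1'⟩
      · omega
  refine sum_pow_edgeAsc_symm q (fun j => (k : ℤ) * p j + (j : ℕ)) ?_ J (attackEdges p J) ?_ ?_ c
  · intro u v h
    dsimp only at h
    by_contra hne
    rcases lt_trichotomy (p u) (p v) with h1 | h1 | h1
    · exact absurd ((hk u v _ _).mpr (Or.inl h1)) (by omega)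
    · rw [h1] at h
      apply hne
      ext
      omega
    · exact absurd ((hk v u _ _).mpr (Or.inl h1)) (by omega)
  · rintro ⟨u, v⟩ he
    simp only [attackEdges, Finset.mem_filter, Finset.mem_product, hatt] at he
    exact ⟨he.1.1, he.1.2, he.2.1⟩
  · rintro ⟨u, v⟩ he u' hu v' hv h1 h2 h3
    simp only [attackEdges, Finset.mem_filter, Finset.mem_product, hatt] at he ⊢
    dsimp only at h1 h2 h3
    refine ⟨⟨hu, hv⟩, h2, ?_⟩
    have := he.2.2
    rw [mul_add] at this ⊢
    omega

/-- A pair of sets is encoded by its intersection `I`, its symmetric difference `J` and the part `S`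
of `J` in the first set. -/
theorem sum_pairs_eq {A : Type} [AddCommMonoid A] (g : Finset (Fin k) → Finset (Fin k) → A) :
    ∑ ε, ∑ ε', g ε ε' = ∑ I : Finset (Fin k), ∑ J ∈ (Finset.univ \ I).powerset,
      ∑ S ∈ J.powerset, g (I ∪ S) (I ∪ J \ S) := by
  rw [← Finset.sum_product', Finset.univ_product_univ]
  simp only [Finset.sum_sigma']
  refine Finset.sum_bij' (fun x _ => ⟨x.1 ∩ x.2, (x.1 \ x.2) ∪ (x.2 \ x.1), x.1 \ x.2⟩)
    (fun y _ => (y.1 ∪ y.2.2, y.1 ∪ y.2.1 \ y.2.2)) ?_ ?_ ?_ ?_ ?_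
  · intro x _
    simp only [Finset.mem_sigma, Finset.mem_univ, Finset.mem_powerset, true_and]
    refine ⟨fun a ha => ?_, Finset.subset_union_left⟩
    simp only [Finset.mem_union, Finset.mem_sdiff, Finset.mem_univ, Finset.mem_inter] at ha ⊢
    tauto
  · intro y _
    exact Finset.mem_univ _
  · rintro ⟨x, y⟩ _
    refine Prod.ext ?_ ?_ <;> dsimp only <;> ext a <;>
      simp only [Finset.mem_union, Finset.mem_sdiff, Finset.mem_inter] <;> tauto
  · rintro ⟨I, J, S⟩ h
    simp only [Finset.mem_sigma, Finset.mem_univ, Finset.mem_powerset, true_and] at h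
    have h1 (a : Fin k) : a ∈ J → a ∉ I := fun ha => (Finset.mem_sdiff.mp (h.1 ha)).2
    have h2 (a : Fin k) : a ∈ S → a ∈ J := fun ha => h.2 ha
    have e1 : (I ∪ S) ∩ (I ∪ J \ S) = I := by
      ext a
      have := h1 a
      have := h2 a
      simp only [Finset.mem_union, Finset.mem_sdiff, Finset.mem_inter]
      tauto
    have e3 : (I ∪ S) \ (I ∪ J \ S) = S := by
      ext a
      have := h1 a
      have := h2 a
      simp only [Finset.mem_union, Finset.mem_sdiff]
      tauto
    have e2 : (I ∪ S) \ (I ∪ J \ S) ∪ (I ∪ J \ S) \ (I ∪ S) = J := by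
      rw [e3]
      ext a
      have := h1 a
      have := h2 a
      simp only [Finset.mem_union, Finset.mem_sdiff]
      tauto
    dsimp only
    rw [e1, e2, e3]
  · rintro ⟨x, y⟩ _
    dsimp only
    congr 1 <;> ext a <;>
      simp only [Finset.mem_union, Finset.mem_sdiff, Finset.mem_inter] <;> tauto

/-- For fixed columns receiving both labels or exactly one, the final profile is fixed. What remains
is the ascent distribution over subsets `S` of `J`, which allows exchanging the sizes of `S` and `J
\ S`. -/
theorem transfer_swap (q : F) (a b : ℕ) (L : List ℕ) (p p' : Fin k → ℤ) :
    transfer q (a :: b :: L) p p' = transfer q (b :: a :: L) p p' := by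
  have key (a b : ℕ) : transfer q (a :: b :: L) p p' =
      ∑ I : Finset (Fin k), ∑ J ∈ (Finset.univ \ I).powerset,
        q ^ (rankSum p I + rankSum (addBoxes p I) (I ∪ J)) *
        transfer q L (addBoxes (addBoxes p I) (I ∪ J)) p' *
        ∑ S ∈ J.powerset, q ^ edgeAsc (attackEdges p J) S *
          (if I.card + S.card = a ∧ I.card + (J \ S).card = b then 1 else 0) := by
    have h1 : transfer q (a :: b :: L) p p' = ∑ ε : Finset (Fin k), ∑ ε' : Finset (Fin k),
        if ε.card = a ∧ ε'.card = b then q ^ (rankSum p ε + rankSum (addBoxes p ε) ε') *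
          transfer q L (addBoxes (addBoxes p ε) ε') p' else 0 := by
      simp only [transfer, ite_and, ← Finset.sum_filter, Finset.mul_sum, Finset.powersetCard_eq_filter,
        Finset.powerset_univ]
      simp only [Finset.sum_filter]
      refine Finset.sum_congr rfl fun ε _ => ?_
      split_ifs
      · refine Finset.sum_congr rfl fun ε' _ => ?_
        split_ifs
        · rw [pow_add, mul_assoc]
        · rfl
      · simp
    rw [h1, sum_pairs_eq]
    refine Finset.sum_congr rfl fun I _ => Finset.sum_congr rfl fun J hJ => ?_
    rw [Finset.mul_sum]
    refine Finset.sum_congr rfl fun S hS => ?_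
    have hIJ : Disjoint I J := Finset.disjoint_of_subset_right (Finset.mem_powerset.mp hJ)
      Finset.disjoint_sdiff
    rw [Finset.mem_powerset] at hS
    rw [rankSum_two_steps p I J S hIJ hS, addBoxes_addBoxes p I J S hIJ hS,
      Finset.card_union_of_disjoint (Finset.disjoint_of_subset_right hS hIJ),
      Finset.card_union_of_disjoint (Finset.disjoint_of_subset_right Finset.sdiff_subset hIJ)]
    split_ifs
    · rw [pow_add]
      ring
    · simp
  rw [key a b, key b a]
  refine Finset.sum_congr rfl fun I _ => Finset.sum_congr rfl fun J _ => ?_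
  congr 1
  rw [sum_attackEdges_symm q p J fun x y => if I.card + x = a ∧ I.card + y = b then 1 else 0]
  simp only [and_comm]

theorem transfer_perm (q : F) {L L' : List ℕ} (h : L.Perm L') :
    ∀ p p' : Fin k → ℤ, transfer q L p p' = transfer q L' p p' := by
  induction h with
  | nil => exact fun _ _ => rfl
  | cons a _ ih => exact fun p p' => Finset.sum_congr rfl fun ε _ => by rw [ih]
  | swap a b L => exact transfer_swap q b a L
  | trans _ _ ih1 ih2 => exact fun p p' => (ih1 p p').trans (ih2 p p')

theorem addBoxes_empty (p : Fin k → ℤ) : addBoxes p ∅ = p := by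
  funext j
  simp [addBoxes]

theorem transfer_zero_cons (q : F) (L : List ℕ) (p p' : Fin k → ℤ) :
    transfer q (0 :: L) p p' = transfer q L p p' := by
  simp [transfer, rankSum, addBoxes_empty]

theorem transfer_filter_ne_zero (q : F) (L : List ℕ) :
    ∀ p p' : Fin k → ℤ, transfer q (L.filter (· ≠ 0)) p p' = transfer q L p p' := by
  induction L with
  | nil => exact fun _ _ => rfl
  | cons a L ih =>
    intro p p'
    by_cases ha : a = 0
    · subst ha
      rw [transfer_zero_cons, ← ih]
      rfl
    · rw [List.filter_cons_of_pos (by simpa using ha)]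
      exact Finset.sum_congr rfl fun ε _ => by rw [ih]

theorem transfer_append (q : F) (L L' : List ℕ) (p' : Fin k → ℤ) (P : Finset (Fin k → ℤ)) :
    ∀ p : Fin k → ℤ, (∀ x : Fin k → ℤ, (∀ j, p j ≤ x j ∧ x j ≤ p j + L.length) → x ∈ P) →
      transfer q (L ++ L') p p' = ∑ x ∈ P, transfer q L p x * transfer q L' x p' := by
  induction L with
  | nil =>
    intro p hP
    have : p ∈ P := hP p fun j => by simp
    simp [transfer, this]
  | cons a L ih =>
    intro p hP
    rw [List.cons_append, transfer]
    simp only [transfer, Finset.sum_mul]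
    rw [Finset.sum_comm]
    refine Finset.sum_congr rfl fun ε _ => ?_
    rw [ih (addBoxes p ε), Finset.mul_sum]
    · exact Finset.sum_congr rfl fun x _ => by ring
    · intro x hx
      refine hP x fun j => ?_
      have := hx j
      simp only [addBoxes, List.length_cons, Nat.cast_add, Nat.cast_one] at this ⊢
      split_ifs at this <;> omega

end Transfer

end RiseDelta
end

noncomputable section

namespace RiseDelta

/-! ### The signed sum over fillings by complements -/

section SignedSum

theorem signedSum_congr {A : Type} [AddCommGroup A] (l : ℕ) :
    ∀ (a : ℕ) (c c' : List ℕ → A), (∀ L : List ℕ, L.length = l → c L = c' L) →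
      signedSum a l c = signedSum a l c' := by
  induction l with
  | zero =>
    intro a c c' h
    rw [signedSum, signedSum, h [] rfl]
  | succ l ih =>
    intro a c c' h
    rw [signedSum, signedSum, ih 1 _ _ fun L hL => h (a :: L) (by simp [hL]),
      ih (a + 1) _ _ fun L hL => h (0 :: L) (by simp [hL])]

theorem signedSum_sum {A ι : Type} [Ring A] (s : Finset ι) (w : ι → A) (l : ℕ) :
    ∀ (a : ℕ) (c : ι → List ℕ → A), signedSum a l (fun L => ∑ i ∈ s, w i * c i L) =
      ∑ i ∈ s, w i * signedSum a l (c i) := by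
  induction l with
  | zero =>
    intro a c
    simp only [signedSum]
    split_ifs <;> simp
  | succ l ih =>
    intro a c
    simp only [signedSum, ih, ← Finset.sum_sub_distrib, mul_sub]

end SignedSum

/-! ### Complementary fillings and the collapse of their signed sum -/

section ClosedForm

variable {F : Type} [Field F] {k : ℕ}

/-- Remove a box from each of the columns in `η`. -/
def removeBoxes (p : Fin k → ℤ) (η : Finset (Fin k)) (j : Fin k) : ℤ :=
  p j - if j ∈ η then 1 else 0

/-- The transfer function for the complementary columns. -/
def cotransfer (x : F) : List ℕ → (Fin k → ℤ) → (Fin k → ℤ) → F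
  | [], p, p' => if p = p' then 1 else 0
  | a :: L, p, p' => ∑ η ∈ Finset.powersetCard a Finset.univ,
      x ^ rankSum p η * cotransfer x L (removeBoxes p η) p'

/-- Of any two columns exactly one comes after the next box of the other, so every unordered pair
contributes one whatever the profile. -/
theorem rankSum_univ_eq (p p' : Fin k → ℤ) : rankSum p Finset.univ = rankSum p' Finset.univ := by
  rw [rankSum_eq, rankSum_eq]
  refine double_sum_eq_of_symm _ _ fun i j => ?_
  rcases lt_trichotomy i j with h | rfl | h
  · have hn : ¬ j < i := h.asymm
    simp only [After, h, hn, Finset.mem_univ, true_and, false_and, or_false, false_or]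
    split_ifs <;> omega
  · simp [After]
  · have hn : ¬ i < j := h.asymm
    simp only [After, h, hn, Finset.mem_univ, true_and, false_and, or_false, false_or]
    split_ifs <;> omega

/-- The sum of all ranks. -/
def totalRank (k : ℕ) : ℕ := rankSum (fun _ : Fin k => 0) Finset.univ

theorem rankSum_add_rankSum_compl (p : Fin k → ℤ) (η : Finset (Fin k)) :
    rankSum p η + rankSum p ηᶜ = totalRank k := by
  rw [totalRank, rankSum_univ_eq _ p, rankSum, rankSum, rankSum, Finset.sum_add_sum_compl]

theorem addBoxes_compl (p : Fin k → ℤ) (η : Finset (Fin k)) :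
    addBoxes p ηᶜ = fun j => removeBoxes p η j + 1 := by
  funext j
  simp only [addBoxes, removeBoxes, Finset.mem_compl]
  split_ifs <;> simp_all

theorem rankSum_translate (p : Fin k → ℤ) (ε : Finset (Fin k)) :
    rankSum (fun j => p j + 1) ε = rankSum p ε := by
  exact Finset.sum_congr rfl fun j _ => Finset.sum_congr rfl fun i _ =>
    if_congr (by simp [After]) rfl rfl

theorem transfer_translate (q : F) (L : List ℕ) : ∀ p p' : Fin k → ℤ,
    transfer q L (fun j => p j + 1) p' = transfer q L p (fun j => p' j - 1) := by
  induction L with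
  | nil =>
    intro p p'
    rw [transfer, transfer]
    congr 1
    rw [funext_iff, funext_iff]
    exact propext (forall_congr' fun j => by omega)
  | cons a L ih =>
    intro p p'
    refine Finset.sum_congr rfl fun ε _ => ?_
    rw [rankSum_translate, ← ih]
    congr 2
    funext j
    simp only [addBoxes]
    ring

/-- Adding boxes outside `η` is removing boxes on `η` followed by a translation by one, which ranks
do not see. The ranks over `η` and over its complement add up to `totalRank k`, whence `q⁻¹` and the
global power. The guard on the left discards the truncated values of `k - a`; on the right no
`a`-subset exists when `a > k`. -/
theorem transfer_compl (q : F) (hq : q ≠ 0) (L : List ℕ) : ∀ p p' : Fin k → ℤ,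
    (if ∀ a ∈ L, a ≤ k then transfer q (L.map fun a => k - a) p p' else 0) =
      q ^ (L.length * totalRank k) * cotransfer q⁻¹ L p (fun j => p' j - L.length) := by
  induction L with
  | nil =>
    intro p p'
    simp [transfer, cotransfer]
  | cons a L ih =>
    intro p p'
    by_cases ha : a ≤ k
    · have h1 : (∀ b ∈ a :: L, b ≤ k) ↔ ∀ b ∈ L, b ≤ k := by simp [ha]
      rw [if_congr h1 rfl rfl, List.map_cons, transfer, cotransfer, Finset.mul_sum]
      have hite (P : Prop) [Decidable P] (g : Finset (Fin k) → F) (s : Finset (Finset (Fin k))) :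
          (if P then ∑ ε ∈ s, g ε else 0) = ∑ ε ∈ s, if P then g ε else 0 := by
        split_ifs <;> simp
      rw [hite]
      refine Finset.sum_nbij' (fun ε => εᶜ) (fun η => ηᶜ) ?_ ?_ ?_ ?_ ?_
      · intro ε hε
        rw [Finset.mem_powersetCard] at hε ⊢
        refine ⟨Finset.subset_univ _, ?_⟩
        rw [Finset.card_compl, hε.2, Fintype.card_fin]
        omega
      · intro η hη
        rw [Finset.mem_powersetCard] at hη ⊢
        refine ⟨Finset.subset_univ _, ?_⟩
        rw [Finset.card_compl, hη.2, Fintype.card_fin]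
      · simp
      · simp
      · intro ε _
        obtain ⟨η, rfl⟩ : ∃ η, ηᶜ = ε := ⟨εᶜ, by simp⟩
        rw [compl_compl, addBoxes_compl, transfer_translate, ← mul_ite_zero, ih,
          List.length_cons, ← rankSum_add_rankSum_compl p η]
        have h2 : (fun j => p' j - 1 - (L.length : ℤ)) =
            fun j => p' j - ((L.length + 1 : ℕ) : ℤ) := by
          funext j
          push_cast
          ring
        rw [h2, add_mul, one_mul, pow_add, pow_add, inv_pow]
        field_simp
    · rw [if_neg (fun h => ha (h a (by simp))), cotransfer,
        Finset.powersetCard_eq_empty.mpr (by simpa using ha), Finset.sum_empty, mul_zero]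

/-- The statistic of the only surviving filling. -/
def minRank (p p' : Fin k → ℤ) : ℕ := ∑ j, ∑ y ∈ Finset.Ioc (p' j) (p j), rankOf p' y j

/-- One step of the transfer function for complementary columns. -/
def costep (x : F) (b : ℕ) (f : (Fin k → ℤ) → F) (p : Fin k → ℤ) : F :=
  ∑ η ∈ Finset.powersetCard b Finset.univ, x ^ rankSum p η * f (removeBoxes p η)

/-- The sum is grouped by the number `i` of zeros before the first nonzero letter, which is then `a
+ i`. Zeros leave the profile unchanged and only contribute the sign. -/
theorem signedSum_cotransfer (x : F) (p p' : Fin k → ℤ) (l : ℕ) : ∀ a : ℕ, 1 ≤ a →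
    signedSum a l (fun L => cotransfer x L p p') =
      ∑ i ∈ Finset.range l, (-1) ^ i * costep x (a + i)
        (fun z => signedSum 1 (l - 1 - i) fun L => cotransfer x L z p') p +
      if l = 0 ∧ a = 1 ∧ p = p' then 1 else 0 := by
  induction l with
  | zero =>
    intro a _
    simp [signedSum, cotransfer, ite_and]
  | succ l ih =>
    intro a ha
    rw [signedSum, Finset.sum_range_succ', if_neg (by omega), add_zero, sub_eq_neg_add]
    congr 1
    · have h0 (L : List ℕ) : cotransfer x (0 :: L) p p' = cotransfer x L p p' := by
        have : removeBoxes p ∅ = p := by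
          funext j
          simp [removeBoxes]
        simp [cotransfer, rankSum, this]
      simp only [h0]
      rw [ih (a + 1) (by omega), if_neg (by omega), add_zero, ← Finset.sum_neg_distrib]
      refine Finset.sum_congr rfl fun i _ => ?_
      rw [show l + 1 - 1 - (i + 1) = l - 1 - i by omega, show a + (i + 1) = a + 1 + i by ring,
        pow_succ]
      ring
    · rw [pow_zero, one_mul, add_zero, costep, ← signedSum_sum]
      rfl

/-- A column where `p` and `p'` differ does not come after the lexicographically last such box in
`p`, and even less in the lower profile `p'`. All other columns agree in both profiles. -/
theorem rankOf_eq_of_lexMax (p p' : Fin k → ℤ) (hle : ∀ j, p' j ≤ p j) (j : Fin k)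
    (hmax : ∀ i, p' i < p i → p i < p j ∨ (p i = p j ∧ i ≤ j)) :
    rankOf p' (p j) j = rankOf p (p j) j := by
  refine Finset.sum_congr rfl fun i _ => ?_
  refine if_congr ?_ rfl rfl
  rcases (hle i).lt_or_eq with hi | hi
  · have h1 := hmax i hi
    simp only [After]
    constructor
    · rintro (⟨h2, h3⟩ | ⟨h2, h3⟩)
      · omega
      · omega
    · rintro (⟨h2, h3⟩ | ⟨h2, h3⟩)
      · omega
      · rcases h1 with h1 | h1
        · omega
        · exact absurd h2 (not_lt.mpr h1.2)
  · simp only [After, hi]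

theorem minRank_removeBoxes (p p' : Fin k → ℤ) (η : Finset (Fin k)) (hη : ∀ j ∈ η, p' j < p j) :
    minRank p p' = minRank (removeBoxes p η) p' + ∑ j ∈ η, rankOf p' (p j) j := by
  have h1 : ∑ j ∈ η, rankOf p' (p j) j = ∑ j, if j ∈ η then rankOf p' (p j) j else 0 := by
    rw [← Finset.sum_filter, Finset.filter_mem_eq_inter, Finset.univ_inter]
  rw [h1, minRank, minRank, ← Finset.sum_add_distrib]
  refine Finset.sum_congr rfl fun j _ => ?_
  simp only [removeBoxes]
  split_ifs with hj
  · have : Finset.Ioc (p' j) (p j) = insert (p j) (Finset.Ioc (p' j) (p j - 1)) := by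
      ext y
      have := hη j hj
      simp only [Finset.mem_Ioc, Finset.mem_insert]
      omega
    rw [this, Finset.sum_insert (by simp), add_comm]
  · rw [sub_zero, add_zero]

/-- The value of the signed sum over fillings by complements. -/
def closedForm (x : F) (l : ℕ) (p p' : Fin k → ℤ) : F :=
  if (∀ j, p' j ≤ p j) ∧ ∑ j, (p j - p' j) = l then x ^ minRank p p' else 0

theorem sum_removeBoxes (p p' : Fin k → ℤ) (η : Finset (Fin k)) :
    ∑ j, (removeBoxes p η j - p' j) = ∑ j, (p j - p' j) - η.card := by
  simp only [removeBoxes]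
  have : ∑ j : Fin k, (if j ∈ η then (1 : ℤ) else 0) = η.card := by
    rw [← Finset.sum_filter, Finset.filter_mem_eq_inter, Finset.univ_inter]
    simp
  rw [← this, ← Finset.sum_sub_distrib]
  exact Finset.sum_congr rfl fun j _ => by ring

/-- After extracting `x ^ minRank p p'`, the alternating sum over sets of removed boxes is a product
of factors `1 - x^(rank in p) / x^(rank in p')` over the columns where `p' < p`. The
lexicographically last of these has equal ranks and annihilates the product. -/
theorem sum_costep_closedForm (x : F) (hx : x ≠ 0) (l : ℕ) (hl : l ≠ 0) (p p' : Fin k → ℤ) :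
    ∑ b ∈ Finset.range (l + 1), (-1) ^ b * costep x b (fun z => closedForm x (l - b) z p') p =
      0 := by
  have h1 : ∑ b ∈ Finset.range (l + 1), (-1) ^ b * costep x b (fun z => closedForm x (l - b) z p') p
      = ∑ b ∈ Finset.range (l + 1), ∑ η ∈ Finset.powersetCard b (Finset.univ : Finset (Fin k)),
        if (∀ j, p' j ≤ removeBoxes p η j) ∧ ∑ j, (p j - p' j) = l then
          (-1) ^ η.card * x ^ rankSum p η * x ^ minRank (removeBoxes p η) p' else 0 := by
    refine Finset.sum_congr rfl fun b hb => ?_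
    rw [costep, Finset.mul_sum]
    refine Finset.sum_congr rfl fun η hη => ?_
    have hcard := (Finset.mem_powersetCard.mp hη).2
    have hb' := Finset.mem_range.mp hb
    have hiff : (∑ j, (p j - p' j) - (b : ℤ) = ((l - b : ℕ) : ℤ)) ↔ ∑ j, (p j - p' j) = (l : ℤ) := by
      omega
    simp only [closedForm, sum_removeBoxes, hcard, hiff]
    split_ifs <;> ring
  rw [h1]
  by_cases hsum : (∀ j, p' j ≤ p j) ∧ ∑ j, (p j - p' j) = l
  · obtain ⟨hle, hsum⟩ := hsum
    set s : Finset (Fin k) := Finset.univ.filter fun j => p' j < p j with hs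
    have hsub (η : Finset (Fin k)) : (∀ j, p' j ≤ removeBoxes p η j) ↔ η ⊆ s := by
      constructor
      · intro h j hj
        have := h j
        simp only [removeBoxes, hj, if_true] at this
        simp only [hs, Finset.mem_filter, Finset.mem_univ, true_and]
        omega
      · intro h j
        have h2 := hle j
        simp only [removeBoxes]
        split_ifs with hj
        · have := h hj
          simp only [hs, Finset.mem_filter, Finset.mem_univ, true_and] at this
          omega
        · omega
    -- This guarantees that the range of `b` includes the size of every subset of `s`, so that the
    -- double sum runs over the full powerset.
    have hscard : s.card ≤ l := by
      have : (s.card : ℤ) ≤ ∑ j, (p j - p' j) := by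
        rw [Finset.card_eq_sum_ones, hs, Finset.sum_filter]
        push_cast
        refine Finset.sum_le_sum fun j _ => ?_
        have := hle j
        split_ifs <;> omega
      omega
    have h2 : ∑ b ∈ Finset.range (l + 1), ∑ η ∈ Finset.powersetCard b (Finset.univ : Finset (Fin k)),
        (if (∀ j, p' j ≤ removeBoxes p η j) ∧ ∑ j, (p j - p' j) = l then
          (-1) ^ η.card * x ^ rankSum p η * x ^ minRank (removeBoxes p η) p' else 0) =
        ∑ η ∈ s.powerset,
          (-1) ^ η.card * x ^ rankSum p η * x ^ minRank (removeBoxes p η) p' := by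
      simp only [hsub, hsum, and_true, Finset.powersetCard_eq_filter, Finset.powerset_univ]
      simp only [Finset.sum_filter]
      rw [Finset.sum_comm]
      have h3 (η : Finset (Fin k)) : ∑ b ∈ Finset.range (l + 1), (if η.card = b then
          if η ⊆ s then (-1 : F) ^ η.card * x ^ rankSum p η * x ^ minRank (removeBoxes p η) p'
          else 0 else 0) = if η ⊆ s then
            (-1 : F) ^ η.card * x ^ rankSum p η * x ^ minRank (removeBoxes p η) p' else 0 := by
        rw [Finset.sum_ite_eq]
        split_ifs with h4 h5 h5
        · rfl
        · rfl
        · have := Finset.card_le_card h5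
          simp only [Finset.mem_range] at h4
          omega
        · rfl
      simp only [h3]
      rw [← Finset.sum_filter]
      exact Finset.sum_congr (by ext; simp) fun _ _ => rfl
    rw [h2]
    have h3 : ∀ η ∈ s.powerset,
        (-1) ^ η.card * x ^ rankSum p η * x ^ minRank (removeBoxes p η) p' =
        x ^ minRank p p' * ∏ j ∈ η, -(x ^ rankOf p (p j) j * (x ^ rankOf p' (p j) j)⁻¹) := by
      intro η hη
      have hη' : ∀ j ∈ η, p' j < p j := fun j hj => by
        simpa [hs] using Finset.mem_powerset.mp hη hj
      rw [minRank_removeBoxes p p' η hη', Finset.prod_neg, Finset.prod_mul_distrib,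
        Finset.prod_inv_distrib, Finset.prod_pow_eq_pow_sum, Finset.prod_pow_eq_pow_sum, pow_add,
        rankSum]
      field_simp
    rw [Finset.sum_congr rfl h3, ← Finset.mul_sum, ← Finset.prod_one_add]
    have hne : s.Nonempty := by
      by_contra hemp
      rw [Finset.not_nonempty_iff_eq_empty] at hemp
      apply hl
      have : ∑ j, (p j - p' j) = 0 := by
        refine Finset.sum_eq_zero fun j _ => ?_
        have h4 := hle j
        have h5 : j ∉ s := by simp [hemp]
        simp only [hs, Finset.mem_filter, Finset.mem_univ, true_and] at h5
        omega
      omega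
    obtain ⟨j, hj, hmax⟩ := s.exists_max_image (fun j => toLex (p j, j)) hne
    rw [Finset.prod_eq_zero hj, mul_zero]
    rw [rankOf_eq_of_lexMax p p' hle j, mul_inv_cancel₀ (pow_ne_zero _ hx), add_neg_cancel]
    intro i hi
    have := hmax i (by simpa [hs] using hi)
    rwa [Prod.Lex.toLex_le_toLex] at this
  · refine Finset.sum_eq_zero fun b _ => Finset.sum_eq_zero fun η _ => if_neg fun h => hsum ?_
    refine ⟨fun j => (h.1 j).trans ?_, h.2⟩
    simp only [removeBoxes]
    split_ifs <;> omega

/-- By induction the recursion for the signed sum consists of the terms `b ≥ 1` of the vanishing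
alternating sum, with the opposite sign. It therefore equals the term `b = 0`, the closed form
itself. -/
theorem signedSum_cotransfer_eq (x : F) (hx : x ≠ 0) (p' : Fin k → ℤ) (l : ℕ) :
    ∀ p : Fin k → ℤ, signedSum 1 l (fun L => cotransfer x L p p') = closedForm x l p p' := by
  induction l using Nat.strong_induction_on with
  | _ l ih =>
  intro p
  rw [signedSum_cotransfer x p p' l 1 le_rfl]
  rcases Nat.eq_zero_or_pos l with rfl | hl
  · rw [Finset.range_zero, Finset.sum_empty, zero_add, closedForm]
    by_cases h : p = p'
    · subst h
      simp [minRank]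
    · rw [if_neg (by tauto), if_neg]
      rintro ⟨h1, h2⟩
      apply h
      funext j
      have h3 := (Finset.sum_eq_zero_iff_of_nonneg fun j _ => sub_nonneg.mpr (h1 j)).mp
        (by simpa using h2) j (Finset.mem_univ j)
      omega
  · have h1 := sum_costep_closedForm x hx l hl.ne' p p'
    rw [Finset.sum_range_succ'] at h1
    have h2 : costep x 0 (fun z => closedForm x (l - 0) z p') p = closedForm x l p p' := by
      have : removeBoxes p ∅ = p := by
        funext j
        simp [removeBoxes]
      simp [costep, rankSum, this]
    rw [pow_zero, one_mul, h2] at h1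
    rw [if_neg (by omega), add_zero, ← sub_eq_zero, ← neg_eq_zero, neg_sub, ← h1, sub_eq_neg_add,
      ← Finset.sum_neg_distrib]
    congr 1
    refine Finset.sum_congr rfl fun i hi => ?_
    have hi' := Finset.mem_range.mp hi
    rw [pow_succ, add_comm 1 i, funext fun z => ih (l - 1 - i) (by omega) z,
      show l - 1 - i = l - (i + 1) by omega]
    ring

end ClosedForm

end RiseDelta
end

noncomputable section

namespace RiseDelta

/-! ### Labeled paths and fillings of columns -/

/-- A path with `N` north steps in `k` columns whose labels increase up each column. -/
structure LabeledPath (N k : ℕ) where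
  col : Fin N → Fin k
  mono : Monotone col
  label : Fin N → ℕ+
  strict : ∀ r s : Fin N, r < s → col r = col s → label r < label s

namespace LabeledPath

variable {N k : ℕ} (P : LabeledPath N k)

theorem lt_iff (r s : Fin N) :
    r < s ↔ P.col r < P.col s ∨ (P.col r = P.col s ∧ P.label r < P.label s) := by
  constructor
  · intro h
    rcases (P.mono h.le).lt_or_eq with h1 | h1
    · exact Or.inl h1
    · exact Or.inr ⟨h1, P.strict r s h h1⟩
  · rintro (h | ⟨h1, h2⟩)
    · by_contra hle
      exact absurd (P.mono (not_lt.mp hle)) (not_le.mpr h)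
    · by_contra hle
      rcases (not_lt.mp hle).lt_or_eq with h3 | h3
      · exact absurd (P.strict s r h3 h1.symm) h2.asymm
      · rw [h3] at h2
        exact lt_irrefl _ h2

theorem eq_of_col_label {r s : Fin N} (h1 : P.col r = P.col s) (h2 : P.label r = P.label s) :
    r = s := by
  rcases lt_trichotomy r s with h | h | h
  · exact absurd (P.strict r s h h1) (by simp [h2])
  · exact h
  · exact absurd (P.strict s r h h1.symm) (by simp [h2])

/-- The number of boxes in column `i` with label smaller than `x`. -/
def colCount (i : Fin k) (x : ℕ+) : ℕ :=
  (Finset.univ.filter fun r => P.col r = i ∧ P.label r < x).card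

/-- The position of a box in its column. -/
def idx (r : Fin N) : ℕ := P.colCount (P.col r) (P.label r)

/-- The number of boxes in column `i`. -/
def height (i : Fin k) : ℕ := (Finset.univ.filter fun r => P.col r = i).card

/-- The number of boxes in the columns before `x`. -/
def before (x : ℕ) : ℕ := (Finset.univ.filter fun r => (P.col r : ℕ) < x).card

theorem val_eq (r : Fin N) : (r : ℕ) = P.before (P.col r) + P.idx r := by
  have h1 : (Finset.univ.filter fun s => s < r) =
      (Finset.univ.filter fun s => (P.col s : ℕ) < P.col r) ∪
      (Finset.univ.filter fun s => P.col s = P.col r ∧ P.label s < P.label r) := by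
    ext s
    simp only [Finset.mem_filter, Finset.mem_univ, true_and, Finset.mem_union]
    exact P.lt_iff s r
  have h2 : (Finset.univ.filter fun s => s < r).card = r := by
    rw [Finset.filter_gt_eq_Iio, Fin.card_Iio]
  rw [← h2, h1, Finset.card_union_of_disjoint]
  · rfl
  · rw [Finset.disjoint_left]
    intro s hs hs'
    simp only [Finset.mem_filter, Finset.mem_univ, true_and] at hs hs'
    rw [hs'.1] at hs
    exact lt_irrefl _ hs

theorem idx_lt_idx {r s : Fin N} (h1 : P.col r = P.col s) (h2 : P.label r < P.label s) :
    P.idx r < P.idx s := by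
  unfold idx colCount
  refine Finset.card_lt_card ⟨fun u hu => ?_, fun h => ?_⟩
  · simp only [Finset.mem_filter, Finset.mem_univ, true_and] at hu ⊢
    exact ⟨hu.1.trans h1, hu.2.trans h2⟩
  · have := h (Finset.mem_filter.mpr ⟨Finset.mem_univ r, h1, h2⟩)
    simp at this

/-- Labels increase up a column, so the boxes with labels below `x` occupy its lowest positions,
without gaps. -/
theorem sum_idx {A : Type} [AddCommMonoid A] (i : Fin k) (x : ℕ+) (g : ℕ → A) :
    ∑ r with P.col r = i ∧ P.label r < x, g (P.idx r) = ∑ h ∈ Finset.range (P.colCount i x), g h := by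
  have hinj : Set.InjOn P.idx
      ((Finset.univ.filter fun r => P.col r = i ∧ P.label r < x : Finset (Fin N)) : Set (Fin N)) := by
    intro r hr s hs h
    simp only [Finset.coe_filter, Finset.mem_univ, true_and, Set.mem_ofPred_eq] at hr hs
    have hcol := hr.1.trans hs.1.symm
    rcases lt_trichotomy (P.label r) (P.label s) with h1 | h1 | h1
    · exact absurd (P.idx_lt_idx hcol h1) (by omega)
    · exact P.eq_of_col_label hcol h1
    · exact absurd (P.idx_lt_idx hcol.symm h1) (by omega)
  have himg : (Finset.univ.filter fun r => P.col r = i ∧ P.label r < x).image P.idx =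
      Finset.range (P.colCount i x) := by
    refine Finset.eq_of_subset_of_card_le ?_ ?_
    · intro h hh
      simp only [Finset.mem_image, Finset.mem_filter, Finset.mem_univ, true_and] at hh
      obtain ⟨r, ⟨h1, h2⟩, rfl⟩ := hh
      rw [Finset.mem_range]
      unfold idx colCount
      refine Finset.card_lt_card ⟨fun u hu => ?_, fun h => ?_⟩
      · simp only [Finset.mem_filter, Finset.mem_univ, true_and] at hu ⊢
        exact ⟨hu.1.trans h1, hu.2.trans h2⟩
      · have := h (Finset.mem_filter.mpr ⟨Finset.mem_univ r, h1, h2⟩)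
        simp at this
    · rw [Finset.card_range, Finset.card_image_of_injOn hinj]
      rfl
  rw [← himg, Finset.sum_image hinj]

theorem exists_label_lt : ∃ x : ℕ+, ∀ r, P.label r < x := by
  obtain ⟨y, hy⟩ := (Set.finite_range P.label).bddAbove
  exact ⟨y + 1, fun r => PNat.lt_add_one_iff.mpr (hy ⟨r, rfl⟩)⟩

theorem colCount_eq_height {x : ℕ+} (hx : ∀ r, P.label r < x) (i : Fin k) :
    P.colCount i x = P.height i := by
  simp [colCount, height, hx]

theorem sum_eq_sum_height {A : Type} [AddCommMonoid A] (g : Fin k → ℕ → A) :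
    ∑ r, g (P.col r) (P.idx r) = ∑ i, ∑ h ∈ Finset.range (P.height i), g i h := by
  obtain ⟨x, hx⟩ := P.exists_label_lt
  rw [← Finset.sum_fiberwise (g := P.col)]
  refine Finset.sum_congr rfl fun i _ => ?_
  rw [← P.colCount_eq_height hx, ← P.sum_idx]
  refine Finset.sum_congr (by simp [hx]) fun r hr => ?_
  simp only [Finset.mem_filter, Finset.mem_univ, true_and] at hr
  rw [hr.1]

variable (d : Fin k → ℤ)

/-- The diagonal of a box, if the columns start at the levels `d`. -/
def diag (r : Fin N) : ℤ := d (P.col r) + P.idx r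

/-- The attack relation, if the columns start at the levels `d`. -/
def Att (r s : Fin N) : Prop :=
  (P.diag d r = P.diag d s ∧ P.col r < P.col s) ∨
    (P.diag d r = P.diag d s - 1 ∧ P.col s < P.col r)

instance (r s : Fin N) : Decidable (P.Att d r s) := by
  unfold Att
  infer_instance

/-- The heights of the columns after the labels smaller than `x` have been placed. -/
def levelAt (x : ℕ+) (i : Fin k) : ℤ := d i + P.colCount i x

/-- In each other column at most one position attacks `s`: the diagonal of `s` on its left, the one
below on its right. It carries a label below `x` precisely if the level at `x` exceeds that height
but the base level does not. Hence the attackers count the columns after `s` at level `x`, less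
those already after `s` at the base. -/
theorem card_att_add_rankOf (s : Fin N) (x : ℕ+) :
    (Finset.univ.filter fun r => P.Att d r s ∧ P.label r < x).card +
      rankOf d (P.diag d s) (P.col s) = rankOf (P.levelAt d x) (P.diag d s) (P.col s) := by
  have h1 : (Finset.univ.filter fun r => P.Att d r s ∧ P.label r < x).card =
      ∑ i, ∑ r with P.col r = i ∧ P.label r < x, if P.Att d r s then 1 else 0 := by
    rw [Finset.card_filter, ← Finset.sum_fiberwise (g := P.col)]
    refine Finset.sum_congr rfl fun i _ => ?_
    rw [Finset.sum_filter, Finset.sum_filter]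
    refine Finset.sum_congr rfl fun r _ => ?_
    simp only [ite_and]
    split_ifs <;> rfl
  rw [h1, rankOf, rankOf, ← Finset.sum_add_distrib]
  refine Finset.sum_congr rfl fun i _ => ?_
  have h2 : (∑ r with P.col r = i ∧ P.label r < x, if P.Att d r s then 1 else 0) =
      ∑ h ∈ Finset.range (P.colCount i x),
        if (d i + h = P.diag d s ∧ i < P.col s) ∨ (d i + h = P.diag d s - 1 ∧ P.col s < i)
        then 1 else 0 := by
    rw [← P.sum_idx i x]
    refine Finset.sum_congr rfl fun r hr => ?_
    simp only [Finset.mem_filter, Finset.mem_univ, true_and] at hr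
    simp only [Att, ← hr.1]
    rfl
  have h3 (z : ℤ) : (∑ h ∈ Finset.range (P.colCount i x), if d i + (h : ℤ) = z then 1 else 0) =
      if d i ≤ z ∧ z < d i + P.colCount i x then 1 else 0 := by
    split_ifs with hz
    · rw [Finset.sum_eq_single (z - d i).toNat]
      · rw [if_pos (by omega)]
      · intro h _ hne
        rw [if_neg (by omega)]
      · intro hn
        rw [Finset.mem_range] at hn
        omega
    · refine Finset.sum_eq_zero fun h hh => if_neg ?_
      rw [Finset.mem_range] at hh
      omega
  rw [h2]
  rcases lt_trichotomy i (P.col s) with h | h | h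
  · have hn : ¬ P.col s < i := h.asymm
    simp only [After, h, hn, and_true, and_false, or_false, h3, true_and, false_and, levelAt]
    split_ifs <;> omega
  · subst h
    simp [After]
  · have hn : ¬ i < P.col s := h.asymm
    simp only [After, h, hn, and_true, and_false, false_or, h3, true_and, false_and, levelAt]
    split_ifs <;> omega

/-- The number of attacking pairs with increasing labels. -/
def inv : ℕ := (Finset.univ.filter fun p : Fin N × Fin N =>
  P.Att d p.1 p.2 ∧ P.label p.1 < P.label p.2).card

/-- The number of attacking pairs. -/
def attCard : ℕ := (Finset.univ.filter fun p : Fin N × Fin N => P.Att d p.1 p.2).card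

theorem card_filter_prod (Q : Fin N → Fin N → Prop) [∀ r s, Decidable (Q r s)] :
    (Finset.univ.filter fun p : Fin N × Fin N => Q p.1 p.2).card =
      ∑ s, (Finset.univ.filter fun r => Q r s).card := by
  simp only [Finset.card_filter]
  rw [← Finset.univ_product_univ, Finset.sum_product_right]

/-- Each box is compared with the boxes of smaller label. The correction depends only on `d` and the
column heights, so the distribution over labelings is governed by the ranks alone. -/
theorem inv_add_base :
    P.inv d + ∑ i, ∑ h ∈ Finset.range (P.height i), rankOf d (d i + h) i =
      ∑ s, rankOf (P.levelAt d (P.label s)) (P.diag d s) (P.col s) := by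
  rw [inv, card_filter_prod fun r s => P.Att d r s ∧ P.label r < P.label s,
    ← P.sum_eq_sum_height fun i h => rankOf d (d i + h) i, ← Finset.sum_add_distrib]
  exact Finset.sum_congr rfl fun s _ => P.card_att_add_rankOf d s (P.label s)

/-- The same count with `x` above all labels, so that every column has reached its full height. -/
theorem attCard_add_base :
    P.attCard d + ∑ i, ∑ h ∈ Finset.range (P.height i), rankOf d (d i + h) i =
      ∑ i, ∑ h ∈ Finset.range (P.height i), rankOf (fun j => d j + P.height j) (d i + h) i := by
  obtain ⟨x, hx⟩ := P.exists_label_lt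
  rw [attCard, card_filter_prod fun r s => P.Att d r s,
    ← P.sum_eq_sum_height fun i h => rankOf d (d i + h) i,
    ← P.sum_eq_sum_height fun i h => rankOf (fun j => d j + P.height j) (d i + h) i,
    ← Finset.sum_add_distrib]
  refine Finset.sum_congr rfl fun s _ => ?_
  have := P.card_att_add_rankOf d s x
  have hl : P.levelAt d x = fun j => d j + P.height j :=
    funext fun j => by rw [levelAt, P.colCount_eq_height hx]
  rw [hl] at this
  simp only [hx, and_true] at this
  exact this

/-- The columns that contain the label `x + 1`. -/
def filling (M : ℕ) (x : Fin M) : Finset (Fin k) :=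
  Finset.univ.filter fun j => ∃ r, P.col r = j ∧ P.label r = firstVars M x

/-- All labels are at most `M`. -/
def LabelsLE (M : ℕ) : Prop := ∀ r, P.label r ∈ Set.range (firstVars M)

end LabeledPath

/-- The heights of the columns of a filling before the label `x + 1` is placed. -/
def fillLevel {k M : ℕ} (p : Fin k → ℤ) (ε : Fin M → Finset (Fin k)) (x : Fin M) (j : Fin k) : ℤ :=
  p j + (Finset.univ.filter fun y => y < x ∧ j ∈ ε y).card

/-- The sum of the ranks of all boxes of a filling. -/
def fillRank {k M : ℕ} (p : Fin k → ℤ) (ε : Fin M → Finset (Fin k)) : ℕ :=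
  ∑ x, rankSum (fillLevel p ε x) (ε x)

/-- The number of labels in column `j` of a filling. -/
def fillHeight {k M : ℕ} (ε : Fin M → Finset (Fin k)) (j : Fin k) : ℕ :=
  (Finset.univ.filter fun x => j ∈ ε x).card

namespace LabeledPath

variable {N k M : ℕ} (P : LabeledPath N k)

theorem mem_filling {x : Fin M} {j : Fin k} :
    j ∈ P.filling M x ↔ ∃ r, P.col r = j ∧ P.label r = firstVars M x := by
  simp [filling]

theorem firstVars_lt {x y : Fin M} : firstVars M x < firstVars M y ↔ x < y := by
  rw [← PNat.coe_lt_coe, Fin.lt_def]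
  exact Nat.succ_lt_succ_iff

theorem card_filling_filter (hM : P.LabelsLE M) (j : Fin k) (Q : ℕ+ → Prop) [DecidablePred Q] :
    (Finset.univ.filter fun y => Q (firstVars M y) ∧ j ∈ P.filling M y).card =
      (Finset.univ.filter fun r => P.col r = j ∧ Q (P.label r)).card := by
  rw [← Finset.card_map (firstVars M), ← Finset.card_image_of_injOn (f := P.label)]
  · congr 1
    ext z
    simp only [Finset.mem_map, Finset.mem_filter, Finset.mem_univ, true_and, Finset.mem_image,
      mem_filling]
    constructor
    · rintro ⟨x, ⟨hQ, r, hr, hx⟩, rfl⟩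
      exact ⟨r, ⟨hr, hx ▸ hQ⟩, hx⟩
    · rintro ⟨r, ⟨hr, hQ⟩, rfl⟩
      obtain ⟨x, hx⟩ := hM r
      exact ⟨x, ⟨hx ▸ hQ, r, hr, hx.symm⟩, hx⟩
  · intro r hr s hs h
    simp only [Finset.coe_filter, Finset.mem_univ, true_and, Set.mem_ofPred_eq] at hr hs
    exact P.eq_of_col_label (hr.1.trans hs.1.symm) h

theorem fillHeight_filling (hM : P.LabelsLE M) : fillHeight (P.filling M) = P.height := by
  funext j
  have := P.card_filling_filter hM j fun _ => True
  simpa [fillHeight, height] using this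

theorem fillLevel_filling (hM : P.LabelsLE M) (d : Fin k → ℤ) (x : Fin M) :
    fillLevel d (P.filling M) x = P.levelAt d (firstVars M x) := by
  funext j
  have := P.card_filling_filter hM j fun z => z < firstVars M x
  simp only [firstVars_lt] at this
  rw [fillLevel, levelAt, this]
  rfl

theorem sum_filling {A : Type} [AddCommMonoid A] (hM : P.LabelsLE M) (g : ℕ+ → Fin k → A) :
    ∑ x, ∑ j ∈ P.filling M x, g (firstVars M x) j = ∑ s, g (P.label s) (P.col s) := by
  rw [Finset.sum_sigma']
  symm
  choose f hf using hM
  refine Finset.sum_bij (fun s _ => ⟨f s, P.col s⟩) ?_ ?_ ?_ ?_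
  · intro s _
    simp only [Finset.mem_sigma, Finset.mem_univ, true_and, mem_filling]
    exact ⟨s, rfl, (hf s).symm⟩
  · intro r _ s _ h
    simp only [Sigma.mk.injEq, heq_eq_eq] at h
    refine P.eq_of_col_label h.2 ?_
    rw [← hf r, ← hf s, h.1]
  · rintro ⟨x, j⟩ h
    simp only [Finset.mem_sigma, Finset.mem_univ, true_and, mem_filling] at h
    obtain ⟨r, hr, hx⟩ := h
    refine ⟨r, Finset.mem_univ _, ?_⟩
    rw [hr, (firstVars M).injective ((hf r).trans hx)]
  · intro s _
    rw [hf]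

theorem fillRank_filling (hM : P.LabelsLE M) (d : Fin k → ℤ) :
    fillRank d (P.filling M) =
      ∑ s, rankOf (P.levelAt d (P.label s)) (P.diag d s) (P.col s) := by
  rw [fillRank]
  simp only [P.fillLevel_filling hM, rankSum]
  exact P.sum_filling hM fun z j => rankOf (P.levelAt d z) (P.levelAt d z j) j

theorem card_filling (x : Fin M) :
    (P.filling M x).card = (Finset.univ.filter fun r => P.label r = firstVars M x).card := by
  rw [← Finset.card_image_of_injOn (f := P.col)]
  · congr 1
    ext j
    simp only [mem_filling, Finset.mem_image, Finset.mem_filter, Finset.mem_univ, true_and]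
    exact ⟨fun ⟨r, h1, h2⟩ => ⟨r, h2, h1⟩, fun ⟨r, h1, h2⟩ => ⟨r, h2, h1⟩⟩
  · intro r hr s hs h
    simp only [Finset.coe_filter, Finset.mem_univ, true_and, Set.mem_ofPred_eq] at hr hs
    exact P.eq_of_col_label h (hr.trans hs.symm)

theorem content_eq_iff (a : Fin M → ℕ) :
    ∑ r, Finsupp.single (P.label r) 1 = vecExp a ↔
      P.LabelsLE M ∧ ∀ x, (P.filling M x).card = a x := by
  have hval (z : ℕ+) : (∑ r, Finsupp.single (P.label r) 1 : ℕ+ →₀ ℕ) z =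
      (Finset.univ.filter fun r => P.label r = z).card := by
    rw [Finsupp.finsetSum_apply, Finset.card_filter]
    exact Finset.sum_congr rfl fun r _ => by simp [Finsupp.single_apply]
  constructor
  · intro h
    have hM : P.LabelsLE M := by
      intro r
      by_contra hr
      have h1 := hval (P.label r)
      rw [h, vecExp, Finsupp.embDomain_of_notMem_range _ _ _ hr, eq_comm,
        Finset.card_eq_zero] at h1
      have : r ∈ Finset.univ.filter fun s => P.label s = P.label r := by simp
      rw [h1] at this
      simp at this
    refine ⟨hM, fun x => ?_⟩
    rw [P.card_filling, ← hval, h, vecExp, Finsupp.embDomain_apply_self]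
    rfl
  · rintro ⟨hM, h⟩
    ext z
    rw [hval]
    by_cases hz : z ∈ Set.range (firstVars M)
    · obtain ⟨x, rfl⟩ := hz
      rw [← P.card_filling, h, vecExp, Finsupp.embDomain_apply_self]
      rfl
    · rw [vecExp, Finsupp.embDomain_of_notMem_range _ _ _ hz, Finset.card_eq_zero,
        Finset.filter_eq_empty_iff]
      intro r _ hr
      exact hz (hr ▸ hM r)

/-- The rows enumerate the pairs (column, label) in strictly increasing lexicographic order, and a
strictly monotone enumeration is determined by its range. -/
theorem ext_filling {P P' : LabeledPath N k} (hP : P.LabelsLE M) (hP' : P'.LabelsLE M)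
    (h : P.filling M = P'.filling M) : P.col = P'.col ∧ P.label = P'.label := by
  let f (Q : LabeledPath N k) (r : Fin N) : Fin k ×ₗ ℕ+ := toLex (Q.col r, Q.label r)
  have hf (Q : LabeledPath N k) : StrictMono (f Q) := by
    intro r s hrs
    rw [Prod.Lex.toLex_lt_toLex]
    exact (Q.lt_iff r s).mp hrs
  have hrange (Q Q' : LabeledPath N k) (hQ : Q.LabelsLE M) (h : Q.filling M = Q'.filling M) :
      Set.range (f Q) ⊆ Set.range (f Q') := by
    rintro _ ⟨r, rfl⟩
    obtain ⟨x, hx⟩ := hQ r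
    have h1 : Q.col r ∈ Q'.filling M x := h ▸ Q.mem_filling.mpr ⟨r, rfl, hx.symm⟩
    obtain ⟨s, hs1, hs2⟩ := Q'.mem_filling.mp h1
    exact ⟨s, by simp only [f, hs1, hs2, hx]⟩
  have heq := ((hf P).range_inj (hf P')).mp
    (Set.Subset.antisymm (hrange P P' hP h) (hrange P' P hP' h.symm))
  have h2 (r : Fin N) : P.col r = P'.col r ∧ P.label r = P'.label r := by
    have := congrFun heq r
    simpa [f] using this
  exact ⟨funext fun r => (h2 r).1, funext fun r => (h2 r).2⟩

theorem exists_filling (ε : Fin M → Finset (Fin k)) (hN : ∑ x, (ε x).card = N) :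
    ∃ P : LabeledPath N k, P.LabelsLE M ∧ P.filling M = ε := by
  let e : (Σ _ : Fin M, Fin k) ↪ Fin k ×ₗ ℕ+ := ⟨fun y => toLex (y.2, firstVars M y.1), by
    rintro ⟨x, j⟩ ⟨x', j'⟩ h
    simpa [and_comm] using h⟩
  set Q : Finset (Fin k ×ₗ ℕ+) := (Finset.univ.sigma ε).map e with hQ
  have hcard : Q.card = N := by
    rw [hQ, Finset.card_map, Finset.card_sigma, hN]
  let g := Q.orderEmbOfFin hcard
  have hmono (r s : Fin N) (h : r < s) : (ofLex (g r)).1 < (ofLex (g s)).1 ∨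
      ((ofLex (g r)).1 = (ofLex (g s)).1 ∧ (ofLex (g r)).2 < (ofLex (g s)).2) :=
    Prod.Lex.lt_iff.mp (g.strictMono h)
  let P : LabeledPath N k :=
    { col := fun r => (ofLex (g r)).1
      mono := fun r s h => by
        rcases h.lt_or_eq with h1 | rfl
        · rcases hmono r s h1 with h2 | h2
          · exact h2.le
          · exact h2.1.le
        · exact le_rfl
      label := fun r => (ofLex (g r)).2
      strict := fun r s h h1 => by
        rcases hmono r s h with h2 | h2
        · exact absurd h1 h2.ne
        · exact h2.2 }
  have hmem (r : Fin N) : ∃ x, P.col r ∈ ε x ∧ firstVars M x = P.label r := by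
    have := Finset.orderEmbOfFin_mem Q hcard r
    obtain ⟨⟨x, j⟩, h1, h2⟩ := Finset.mem_map.mp this
    rw [Finset.mem_sigma] at h1
    have h3 : ofLex (g r) = (j, firstVars M x) := by
      change g r = _
      exact h2.symm
    refine ⟨x, ?_, ?_⟩
    · change (ofLex (g r)).1 ∈ _
      rw [h3]
      exact h1.2
    · change _ = (ofLex (g r)).2
      rw [h3]
  refine ⟨P, fun r => ?_, ?_⟩
  · obtain ⟨x, -, hx⟩ := hmem r
    exact ⟨x, hx⟩
  · funext x
    ext j
    rw [mem_filling]
    constructor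
    · rintro ⟨r, rfl, h2⟩
      obtain ⟨y, hy1, hy2⟩ := hmem r
      have := (firstVars M).injective (hy2.trans h2)
      exact this ▸ hy1
    · intro hj
      have h1 : toLex (j, firstVars M x) ∈ Q := by
        rw [hQ, Finset.mem_map]
        exact ⟨⟨x, j⟩, by simpa using hj, rfl⟩
      have h2 : toLex (j, firstVars M x) ∈ Set.range g := by
        rw [Finset.range_orderEmbOfFin]
        exact h1
      obtain ⟨r, hr⟩ := h2
      refine ⟨r, ?_, ?_⟩
      · change (ofLex (g r)).1 = _
        rw [hr]
        rfl
      · change (ofLex (g r)).2 = _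
        rw [hr]
        rfl

end LabeledPath

/-- Unrolls the recursion into one sum over assignments of a column set to each label; this is the
form that the bijections with paths use. -/
theorem transfer_ofFn {F : Type} [Field F] {k : ℕ} (q : F) (p' : Fin k → ℤ) (M : ℕ) :
    ∀ (a : Fin M → ℕ) (p : Fin k → ℤ), transfer q (List.ofFn a) p p' =
      ∑ ε : Fin M → Finset (Fin k),
        if (∀ x, (ε x).card = a x) ∧ (∀ j, p j + fillHeight ε j = p' j) then q ^ fillRank p ε
        else 0 := by
  induction M with
  | zero =>
    intro a p
    simp [transfer, fillHeight, fillRank, funext_iff]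
  | succ M ih =>
    intro a p
    rw [List.ofFn_succ, transfer, ← (Fin.consEquiv fun _ => Finset (Fin k)).sum_comp,
      Fintype.sum_prod_type, Finset.powersetCard_eq_filter, Finset.powerset_univ, Finset.sum_filter]
    refine Finset.sum_congr rfl fun η _ => ?_
    have hheight (y : Fin M → Finset (Fin k)) (j : Fin k) :
        (fillHeight (Fin.cons η y : Fin (M + 1) → Finset (Fin k)) j : ℤ) =
          (if j ∈ η then 1 else 0) + fillHeight y j := by
      simp only [fillHeight, Finset.card_filter, Fin.sum_univ_succ, Fin.cons_zero, Fin.cons_succ]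
      push_cast
      rfl
    have hlevel0 (y : Fin M → Finset (Fin k)) :
        fillLevel p (Fin.cons η y : Fin (M + 1) → Finset (Fin k)) 0 = p := by
      funext j
      simp [fillLevel]
    have hlevel (y : Fin M → Finset (Fin k)) (x : Fin M) :
        fillLevel p (Fin.cons η y : Fin (M + 1) → Finset (Fin k)) x.succ =
          fillLevel (addBoxes p η) y x := by
      funext j
      simp only [fillLevel, addBoxes, Finset.card_filter, Fin.sum_univ_succ, Fin.cons_zero,
        Fin.cons_succ, Fin.succ_lt_succ_iff, Fin.succ_pos, true_and]
      push_cast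
      ring
    have hrank (y : Fin M → Finset (Fin k)) :
        fillRank p (Fin.cons η y : Fin (M + 1) → Finset (Fin k)) =
          rankSum p η + fillRank (addBoxes p η) y := by
      simp only [fillRank, Fin.sum_univ_succ, hlevel0, hlevel, Fin.cons_zero, Fin.cons_succ]
    change _ = ∑ y : Fin M → Finset (Fin k),
      if (∀ x, ((Fin.cons η y : Fin (M + 1) → Finset (Fin k)) x).card = a x) ∧
        (∀ j, p j + fillHeight (Fin.cons η y : Fin (M + 1) → Finset (Fin k)) j = p' j) then
        q ^ fillRank p (Fin.cons η y : Fin (M + 1) → Finset (Fin k)) else 0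
    simp only [Fin.forall_fin_succ, Fin.cons_zero, Fin.cons_succ, hheight, hrank]
    split_ifs with hη
    · rw [ih, Finset.mul_sum]
      refine Finset.sum_congr rfl fun y _ => ?_
      simp only [hη, true_and, addBoxes, add_assoc, pow_add, mul_ite, mul_zero]
    · simp [hη]

end RiseDelta
end

noncomputable section

namespace RiseDelta

/-! ### Statistics of parking functions in terms of column heights -/

section Counting

/-- The sum of the values of `h` before `x`. -/
def psum {k : ℕ} (h : Fin k → ℕ) (x : ℕ) : ℕ := ∑ j ∈ Finset.univ.filter fun j : Fin k => (j : ℕ) < x, h j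

theorem psum_eq_card {N k : ℕ} (f : Fin N → Fin k) (x : ℕ) :
    psum (fun j => (Finset.univ.filter fun r => f r = j).card) x =
      (Finset.univ.filter fun r => (f r : ℕ) < x).card := by
  rw [psum, Finset.card_eq_sum_card_fiberwise (f := f) (t := Finset.univ.filter fun j : Fin k => (j : ℕ) < x)]
  · refine Finset.sum_congr rfl fun j hj => ?_
    congr 1
    ext r
    simp only [Finset.mem_filter, Finset.mem_univ, true_and] at hj ⊢
    exact ⟨fun h => ⟨h ▸ hj, h⟩, fun h => h.2⟩
  · intro r hr
    simpa using hr

theorem psum_succ {k : ℕ} (h : Fin k → ℕ) (j : Fin k) : psum h (j + 1) = psum h j + h j := by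
  have : (Finset.univ.filter fun i : Fin k => (i : ℕ) < j + 1) =
      insert j (Finset.univ.filter fun i : Fin k => (i : ℕ) < j) := by
    ext i
    simp only [Finset.mem_filter, Finset.mem_univ, true_and, Finset.mem_insert, Fin.ext_iff]
    omega
  rw [psum, psum, this, Finset.sum_insert (by simp), add_comm]

theorem psum_self {k : ℕ} (h : Fin k → ℕ) : psum h k = ∑ j, h j := by
  rw [psum]
  congr 1
  ext j
  simp

theorem psum_zero {k : ℕ} (h : Fin k → ℕ) : psum h 0 = 0 := by
  simp [psum]

theorem lt_card_iff {N : ℕ} {f : Fin N → ℕ} (hf : Monotone f) (r : Fin N) (x : ℕ) :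
    (r : ℕ) < (Finset.univ.filter fun s => f s < x).card ↔ f r < x := by
  constructor
  · intro h
    by_contra hle
    have : (Finset.univ.filter fun s => f s < x).card ≤ (Finset.Iio r).card := by
      refine Finset.card_le_card fun s hs => ?_
      simp only [Finset.mem_filter, Finset.mem_univ, true_and, Finset.mem_Iio] at hs ⊢
      by_contra hrs
      have := hf (not_lt.mp hrs)
      omega
    rw [Fin.card_Iio] at this
    omega
  · intro h
    have : (Finset.Iic r).card ≤ (Finset.univ.filter fun s => f s < x).card := by
      refine Finset.card_le_card fun s hs => ?_
      simp only [Finset.mem_filter, Finset.mem_univ, true_and, Finset.mem_Iic] at hs ⊢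
      exact (hf hs).trans_lt h
    rw [Fin.card_Iic] at this
    omega

theorem card_filter_le_lt {N : ℕ} (a b : ℕ) (hb : b ≤ N) :
    (Finset.univ.filter fun r : Fin N => a ≤ (r : ℕ) ∧ (r : ℕ) < b).card = b - a := by
  rw [← Nat.card_Ico, ← Finset.card_map Fin.valEmbedding]
  congr 1
  ext x
  simp only [Finset.mem_map, Finset.mem_filter, Finset.mem_univ, true_and, Finset.mem_Ico,
    Fin.valEmbedding_apply]
  constructor
  · rintro ⟨r, h, rfl⟩
    exact h
  · intro h
    exact ⟨⟨x, by omega⟩, h, rfl⟩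

/-- The total of the levels after the first, second, … column. -/
def areaOf (k : ℕ) (lev : ℕ → ℤ) : ℕ := (∑ x ∈ Finset.range k, lev (x + 1)).toNat

theorem sum_card_eq_areaOf {k : ℕ} (lev : ℕ → ℤ) (u v : ℕ → ℕ)
    (hlev : ∀ x, lev x = (u x : ℤ) - v x) (huv : ∀ x ≤ k, v x ≤ u x) :
    ∑ x : Fin k, (u (x + 1) - v (x + 1)) = areaOf k lev := by
  rw [areaOf, Finset.sum_range fun x => lev (x + 1)]
  zify
  rw [Int.toNat_of_nonneg]
  · refine Finset.sum_congr rfl fun x _ => ?_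
    rw [Nat.cast_sub (huv _ x.isLt), hlev]
  · refine Finset.sum_nonneg fun x _ => ?_
    have := huv (x + 1) x.isLt
    rw [hlev]
    omega

end Counting

namespace LabeledPath

variable {N k : ℕ} (P : LabeledPath N k)

theorem before_eq_psum (x : ℕ) : P.before x = psum P.height x := (psum_eq_card P.col x).symm

theorem lt_before_iff (r : Fin N) (x : ℕ) : (r : ℕ) < P.before x ↔ (P.col r : ℕ) < x :=
  lt_card_iff (f := fun r => (P.col r : ℕ)) (fun _ _ h => P.mono h) r x

theorem before_le (x : ℕ) : P.before x ≤ N := by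
  refine (Finset.card_le_univ _).trans ?_
  simp

theorem before_last : P.before k = N := by
  rw [before, Finset.filter_true_of_mem fun r _ => (P.col r).isLt]
  simp

end LabeledPath

/-! ### Statistics of rational parking functions -/

section WordParkingFunctions

variable {k m : ℕ}

/-- The levels of the columns of a rational parking function. -/
def wpfLevel (m : ℕ) {k : ℕ} (h : Fin k → ℕ) (x : ℕ) : ℤ := psum h x - m * x

/-- The statistic `pathdinv` in terms of the column heights. -/
def pathdinvOf (m : ℕ) {k : ℕ} (h : Fin k → ℕ) : ℕ :=
  ∑ j : Fin k, ∑ y ∈ Finset.range (h j), (Finset.univ.filter fun x : Fin k =>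
    x < j ∧ wpfLevel m h (x + 1) - 1 ≤ wpfLevel m h j + y ∧
      wpfLevel m h j + y < wpfLevel m h (x + 1) + m).card

theorem wpf_col_lt (P : WordParkingFunction (k * m) k) (r : Fin (k * m)) : P.path.col r < k := by
  have h := P.path.above r
  have hr := r.isLt
  by_contra hlt
  have h1 : k * m * k ≤ k * m * P.path.col r := Nat.mul_le_mul_left _ (not_lt.mp hlt)
  have h2 : k * (r : ℕ) < k * (k * m) := Nat.mul_lt_mul_of_pos_left hr (by
    by_contra h0
    have : k = 0 := by omega
    subst this
    simp at hr)
  have h3 := mul_comm (k * m) k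
  omega

/-- The labeled path underlying a rational parking function. -/
def wpfPath (P : WordParkingFunction (k * m) k) : LabeledPath (k * m) k where
  col r := ⟨P.path.col r, wpf_col_lt P r⟩
  mono _ _ h := P.path.mono h
  label := P.label
  strict r s h h' := P.strict r s h (congrArg Fin.val h')

theorem wpf_above (P : WordParkingFunction (k * m) k) (r : Fin (k * m)) :
    m * P.path.col r ≤ r := by
  have h := P.path.above r
  have hk : 0 < k := (Nat.zero_le _).trans_lt (wpf_col_lt P r)
  rw [mul_assoc] at h
  exact Nat.le_of_mul_le_mul_left h hk

theorem above_iff (P : LabeledPath (k * m) k) :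
    (∀ r, m * (P.col r : ℕ) ≤ r) ↔ ∀ x ≤ k, m * x ≤ psum P.height x := by
  simp only [← P.before_eq_psum]
  constructor
  · intro h x hx
    by_contra hlt
    have hlt' := not_le.mp hlt
    have h1 : P.before x < k * m := by
      have : m * x ≤ m * k := Nat.mul_le_mul_left m hx
      have := mul_comm k m
      omega
    have h2 := (P.lt_before_iff ⟨_, h1⟩ x).not.mp (lt_irrefl _)
    have h3 := h ⟨_, h1⟩
    have h4 : m * x ≤ m * (P.col ⟨_, h1⟩ : ℕ) := Nat.mul_le_mul_left m (not_lt.mp h2)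
    dsimp only at h3
    omega
  · intro h r
    have h1 := h (P.col r) (P.col r).isLt.le
    have h2 := P.val_eq r
    omega

theorem wpf_diagonal (P : WordParkingFunction (k * m) k) (r : Fin (k * m)) :
    diagonal m (P.path.col r) r =
      (wpfPath P).diag (fun j => wpfLevel m (wpfPath P).height j) r := by
  have h1 := (wpfPath P).val_eq r
  rw [(wpfPath P).before_eq_psum] at h1
  rw [diagonal, LabeledPath.diag, wpfLevel, h1]
  change _ - (m : ℤ) * ((wpfPath P).col r : ℕ) = _
  push_cast
  ring

theorem wpf_attacks (P : WordParkingFunction (k * m) k) (r s : Fin (k * m)) :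
    Attacks m (P.path.col r, (r : ℕ)) (P.path.col s, (s : ℕ)) ↔
      (wpfPath P).Att (fun j => wpfLevel m (wpfPath P).height j) r s := by
  rw [Attacks, wpf_diagonal, wpf_diagonal]
  rfl

theorem wpf_slope (P : WordParkingFunction (k * m) k) (r : Fin (k * m)) : k * m / k = m :=
  Nat.mul_div_cancel_left m ((Nat.zero_le _).trans_lt (wpf_col_lt P r))

theorem wpf_tdinv (P : WordParkingFunction (k * m) k) :
    P.tdinv = (wpfPath P).inv fun j => wpfLevel m (wpfPath P).height j := by
  classical
  rw [WordParkingFunction.tdinv, Nat.card_eq_fintype_card, Fintype.card_subtype, LabeledPath.inv]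
  congr 1
  ext ⟨r, s⟩
  simp only [Finset.mem_filter, Finset.mem_univ, true_and]
  rw [wpf_slope P r, wpf_attacks]
  rfl

theorem wpf_maxtdinv (P : WordParkingFunction (k * m) k) :
    P.path.maxtdinv = (wpfPath P).attCard fun j => wpfLevel m (wpfPath P).height j := by
  classical
  have hcard : (wpfPath P).attCard (fun j => wpfLevel m (wpfPath P).height j) =
      Nat.card {p : Fin (k * m) × Fin (k * m) //
        Attacks (k * m / k) (P.path.col p.1, (p.1 : ℕ)) (P.path.col p.2, (p.2 : ℕ))} := by
    rw [Nat.card_eq_fintype_card, Fintype.card_subtype, LabeledPath.attCard]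
    congr 1
    ext ⟨r, s⟩
    simp only [Finset.mem_filter, Finset.mem_univ, true_and]
    rw [wpf_slope P r, wpf_attacks]
  rw [RationalDyckPath.maxtdinv]
  refine IsGreatest.csSup_eq ⟨?_, ?_⟩
  -- All attacks become increasing if boxes are labeled by diagonal first and column second. The
  -- number `k * diagonal + column` encodes this order since columns are less than `k`.
  · let lab (r : Fin (k * m)) : ℕ+ :=
      Nat.succPNat (k * (r - m * P.path.col r) + P.path.col r)
    have hlab (r s : Fin (k * m)) : lab r < lab s ↔
        k * (r - m * P.path.col r) + P.path.col r < k * (s - m * P.path.col s) + P.path.col s := by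
      rw [← PNat.coe_lt_coe]
      exact Nat.succ_lt_succ_iff
    have hk (r : Fin (k * m)) : 0 < k := (Nat.zero_le _).trans_lt (wpf_col_lt P r)
    refine ⟨⟨P.path, lab, fun r s h h' => ?_⟩, rfl, ?_⟩
    · rw [hlab, h']
      have h1 := wpf_above P r
      rw [h'] at h1
      have h2 : (r : ℕ) < s := h
      have : k * (r - m * P.path.col s) < k * (s - m * P.path.col s) :=
        Nat.mul_lt_mul_of_pos_left (by omega) (hk r)
      omega
    · rw [hcard, WordParkingFunction.tdinv]
      refine Nat.card_congr (Equiv.subtypeEquivRight ?_)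
      rintro ⟨r, s⟩
      refine ⟨fun h => h.1, fun h => ⟨h, ?_⟩⟩
      dsimp only at h ⊢
      rw [hlab]
      have h1 := wpf_above P r
      have h2 := wpf_above P s
      have h3 := wpf_col_lt P r
      rw [wpf_slope P r] at h
      rcases h with ⟨h4, h5⟩ | ⟨h4, h5⟩
      · simp only [diagonal] at h4 h5
        have : (r : ℕ) - m * P.path.col r = s - m * P.path.col s := by
          zify [h1, h2]
          exact h4
        rw [this]
        omega
      · simp only [diagonal] at h4 h5
        have : (s : ℕ) - m * P.path.col s = (r - m * P.path.col r) + 1 := by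
          zify [h1, h2]
          linarith
        rw [this, mul_add]
        omega
  · rintro _ ⟨P', h, rfl⟩
    rw [hcard, WordParkingFunction.tdinv, h]
    exact Nat.card_le_card_of_injective (fun p => ⟨p.1, p.2.1⟩) fun p p' hp => by
      simpa [Subtype.ext_iff] using hp

/-- For a box in column `x` of row `r`, the arm is the column of the north step less `x + 1`, and
the leg is `r` less the number of north steps in columns up to `x`. After division by `k`, both
inequalities compare the diagonal of the north step in row `r` with the level of column `x + 1`. -/
theorem wpf_pathdinv (P : WordParkingFunction (k * m) k) :
    P.path.pathdinv = pathdinvOf m (wpfPath P).height := by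
  classical
  set Q := wpfPath P with hQ
  have hcol (r : Fin (k * m)) : P.path.col r = (Q.col r : ℕ) := rfl
  rw [pathdinvOf, ← Q.sum_eq_sum_height fun j y => (Finset.univ.filter fun x : Fin k =>
    x < j ∧ wpfLevel m Q.height (x + 1) - 1 ≤ wpfLevel m Q.height j + y ∧
      wpfLevel m Q.height j + y < wpfLevel m Q.height (x + 1) + m).card,
    RationalDyckPath.pathdinv, Nat.card_eq_fintype_card, Fintype.card_subtype, Finset.card_filter,
    ← Finset.univ_product_univ, Finset.sum_product_right]
  refine Finset.sum_congr rfl fun r _ => ?_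
  rw [← Finset.card_filter]
  congr 1
  ext x
  simp only [Finset.mem_filter, Finset.mem_univ, true_and]
  have hk : 0 < k := (Nat.zero_le _).trans_lt x.isLt
  rw [hcol, ← Fin.lt_def]
  refine and_congr_right fun hx => ?_
  have harm : P.path.arm x r = (Q.col r : ℕ) - (x + 1) := by
    rw [RationalDyckPath.arm, Nat.card_eq_fintype_card, Fintype.card_subtype,
      ← card_filter_le_lt (N := k) _ _ (Q.col r).isLt.le]
    congr 1
  have hleg : P.path.leg x r + Q.before (x + 1) = r := by
    rw [RationalDyckPath.leg, Nat.card_eq_fintype_card, Fintype.card_subtype]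
    have h1 : (Finset.Iio r).card = r := Fin.card_Iio r
    rw [← h1, ← Finset.card_filter_add_card_filter_not (s := Finset.Iio r)
      (fun y => (x : ℕ) < P.path.col y), LabeledPath.before]
    congr 2
    · ext y
      simp
    · ext y
      simp only [Finset.mem_filter, Finset.mem_univ, true_and, Finset.mem_Iio, hcol]
      constructor
      · intro h
        refine ⟨?_, by omega⟩
        by_contra hle
        have h2 : (Q.col r : ℕ) ≤ Q.col y := Q.mono (not_lt.mp hle)
        have h3 : (x : ℕ) < Q.col r := hx
        omega
      · intro h
        omega
  have hdiag := wpf_diagonal P r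
  rw [LabeledPath.diag, diagonal] at hdiag
  simp only [← hQ] at hdiag
  rw [← hdiag, hcol]
  have hlev : wpfLevel m Q.height (x + 1) = Q.before (x + 1) - m * (x + 1) := by
    rw [wpfLevel, Q.before_eq_psum]
    rfl
  rw [hlev, mul_comm (P.path.arm x r), mul_comm (P.path.arm x r + 1), mul_assoc, mul_assoc,
    Nat.mul_le_mul_left_iff hk, Nat.mul_lt_mul_left hk]
  obtain ⟨a, ha⟩ : ∃ a, (Q.col r : ℕ) = x + 1 + a :=
    Nat.exists_eq_add_of_le (show (x : ℕ) + 1 ≤ Q.col r from hx)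
  have ha' : P.path.arm x r = a := by omega
  rw [ha', ha]
  zify at hleg ⊢
  rw [← hleg]
  refine and_congr ⟨fun h => ?_, fun h => ?_⟩ ⟨fun h => ?_, fun h => ?_⟩ <;> linarith

theorem wpf_psum_ge (P : WordParkingFunction (k * m) k) :
    ∀ x ≤ k, m * x ≤ psum (wpfPath P).height x :=
  (above_iff (wpfPath P)).mp (wpf_above P)

theorem wpf_area (P : WordParkingFunction (k * m) k) :
    P.area = areaOf k (wpfLevel m (wpfPath P).height) := by
  classical
  set Q := wpfPath P with hQ
  rw [← sum_card_eq_areaOf _ (psum Q.height) (fun x => m * x) (fun x => by simp [wpfLevel])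
    (wpf_psum_ge P), WordParkingFunction.area, RationalDyckPath.area, Nat.card_eq_fintype_card,
    Fintype.card_subtype, Finset.card_filter, ← Finset.univ_product_univ, Finset.sum_product]
  refine Finset.sum_congr rfl fun x _ => ?_
  have hk : 0 < k := (Nat.zero_le _).trans_lt x.isLt
  rw [← Finset.card_filter, ← card_filter_le_lt (N := k * m) _ _
    (Q.before_eq_psum _ ▸ Q.before_le _)]
  congr 1
  ext r
  simp only [Finset.mem_filter, Finset.mem_univ, true_and]
  rw [← Q.before_eq_psum, Q.lt_before_iff, mul_assoc, Nat.mul_le_mul_left_iff hk, and_comm,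
    Nat.lt_succ_iff]
  rfl

/-- In `tdinv - maxtdinv` the base ranks cancel, leaving the rank of the filling minus the ranks
with respect to the tops of the columns. -/
theorem wpf_dinv (P : WordParkingFunction (k * m) k) {M : ℕ} (hM : (wpfPath P).LabelsLE M) :
    P.dinv = pathdinvOf m (wpfPath P).height +
      fillRank (fun j => wpfLevel m (wpfPath P).height j) ((wpfPath P).filling M) -
      (∑ i : Fin k, ∑ y ∈ Finset.range ((wpfPath P).height i),
        rankOf (fun j : Fin k => wpfLevel m (wpfPath P).height j + (wpfPath P).height j)
          (wpfLevel m (wpfPath P).height i + y) i : ℕ) := by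
  rw [WordParkingFunction.dinv, wpf_pathdinv, wpf_tdinv, wpf_maxtdinv,
    (wpfPath P).fillRank_filling hM, ← LabeledPath.inv_add_base, ← LabeledPath.attCard_add_base]
  push_cast
  ring

end WordParkingFunctions

end RiseDelta
end

noncomputable section

namespace RiseDelta

/-! ### Coefficients of the two series -/

/-- The sequences of column heights that are at most `B`. -/
def heightBox (k B : ℕ) : Finset (Fin k → ℕ) := Fintype.piFinset fun _ => Finset.range (B + 1)

theorem mem_heightBox {k B : ℕ} {h : Fin k → ℕ} : h ∈ heightBox k B ↔ ∀ j, h j ≤ B := by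
  simp [heightBox, Fintype.mem_piFinset]

theorem fillHeight_le {k M : ℕ} (ε : Fin M → Finset (Fin k)) (j : Fin k) : fillHeight ε j ≤ M := by
  refine (Finset.card_le_univ _).trans ?_
  simp

theorem sum_card_eq_sum_fillHeight {k M : ℕ} (ε : Fin M → Finset (Fin k)) :
    ∑ x, (ε x).card = ∑ j, fillHeight ε j := by
  simp only [fillHeight, Finset.card_filter]
  rw [Finset.sum_comm]
  simp

/-- The generating function of the fillings of the columns, where columns of heights `h` start at
the levels `d h` and are weighted by `wt h`. -/
def columnSum {F : Type} [Field F] {k : ℕ} (q : F) (B : ℕ) (wt : (Fin k → ℕ) → F)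
    (d : (Fin k → ℕ) → Fin k → ℤ) (L : List ℕ) : F :=
  ∑ h ∈ heightBox k B, wt h * transfer q L (d h) fun j => d h j + h j

theorem sum_filling_eq_columnSum {F : Type} [Field F] {k M B : ℕ} (hB : M ≤ B) (q : F)
    (wt : (Fin k → ℕ) → F) (d : (Fin k → ℕ) → Fin k → ℤ) (a : Fin M → ℕ) :
    ∑ ε : Fin M → Finset (Fin k), (if ∀ x, (ε x).card = a x then
      wt (fillHeight ε) * q ^ fillRank (d (fillHeight ε)) ε else 0) =
      columnSum q B wt d (List.ofFn a) := by
  simp only [columnSum, transfer_ofFn, Finset.mul_sum]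
  rw [Finset.sum_comm]
  refine Finset.sum_congr rfl fun ε _ => ?_
  rw [Finset.sum_eq_single (fillHeight ε)]
  · simp
  · intro h _ hne
    rw [if_neg, mul_zero]
    rintro ⟨-, h2⟩
    refine hne (funext fun j => ?_)
    have := h2 j
    omega
  · intro hn
    exact absurd (mem_heightBox.mpr fun j => (fillHeight_le ε j).trans hB) hn

/-- The sum of the ranks of the boxes of columns of heights `h` over the levels `d`, with respect
to these levels. -/
def baseRank {k : ℕ} (d : Fin k → ℤ) (h : Fin k → ℕ) : ℕ :=
  ∑ i, ∑ y ∈ Finset.range (h i), rankOf d (d i + y) i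

/-- The sum of the ranks of the boxes of columns of heights `h` over the levels `d`, with respect
to the levels of the tops of the columns. -/
def topRank {k : ℕ} (d : Fin k → ℤ) (h : Fin k → ℕ) : ℕ :=
  ∑ i, ∑ y ∈ Finset.range (h i), rankOf (fun j => d j + h j) (d i + y) i

theorem tVar_ne_zero : tVar ≠ 0 := by
  rw [tVar, Ne, FaithfulSMul.algebraMap_eq_zero_iff]
  exact MvPolynomial.X_ne_zero 1

theorem qVar_ne_zero : qVar ≠ 0 := by
  rw [qVar, Ne, FaithfulSMul.algebraMap_eq_zero_iff]
  exact MvPolynomial.X_ne_zero 0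

/-! ### Coefficients of the rational series -/

section WordParkingFunctions

variable {k m : ℕ}

/-- The weight of the rational parking functions with column heights `h`. -/
def wpfWeight (m : ℕ) {k : ℕ} (h : Fin k → ℕ) : QT :=
  if ∑ j, h j = k * m ∧ ∀ x ≤ k, m * x ≤ psum h x then
    tVar ^ areaOf k (wpfLevel m h) *
      qVar ^ ((pathdinvOf m h : ℤ) - topRank (fun j => wpfLevel m h j) h)
  else 0

theorem wpfPath_injective : Function.Injective (wpfPath (k := k) (m := m)) := by
  rintro ⟨⟨c, _, _⟩, l, _⟩ ⟨⟨c', _, _⟩, l', _⟩ h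
  have h1 : c = c' := funext fun r => congrArg Fin.val (congrFun (congrArg LabeledPath.col h) r)
  have h2 : l = l' := congrArg LabeledPath.label h
  subst h1 h2
  rfl

theorem exists_wpfPath_eq (P : LabeledPath (k * m) k) (h : ∀ x ≤ k, m * x ≤ psum P.height x) :
    ∃ Q : WordParkingFunction (k * m) k, wpfPath Q = P :=
  ⟨⟨⟨fun r => P.col r, fun _ _ hrs => P.mono hrs, fun r => by
      rw [mul_assoc]
      exact Nat.mul_le_mul_left k ((above_iff P).mpr h r)⟩, P.label,
    fun r s hrs h' => P.strict r s hrs (Fin.ext h')⟩, rfl⟩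

theorem LabeledPath.ext_of {N : ℕ} {P P' : LabeledPath N k}
    (h : P.col = P'.col ∧ P.label = P'.label) : P = P' := by
  obtain ⟨c, _, l, _⟩ := P
  obtain ⟨c', _, l', _⟩ := P'
  obtain ⟨rfl, rfl⟩ := h
  rfl

theorem LabeledPath.sum_height {N : ℕ} (P : LabeledPath N k) : ∑ j, P.height j = N := by
  rw [← psum_self, ← P.before_eq_psum, P.before_last]

/-- Parking functions of the given content are the fillings whose heights define a path above the
diagonal; other fillings have weight zero, hence the bijection on nonzero terms. Any `B ≥ M` works
because a column holds each of the `M` labels at most once. -/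
theorem wpfSeries_vecExp {M B : ℕ} (hB : M ≤ B) (a : Fin M → ℕ) :
    wpfSeries (k * m) k (vecExp a) =
      columnSum qVar B (wpfWeight m) (fun (h : Fin k → ℕ) j => wpfLevel m h j) (List.ofFn a) := by
  classical
  rw [← sum_filling_eq_columnSum hB, wpfSeries, ← Finset.sum_filter]
  have hmem (P : WordParkingFunction (k * m) k) :
      P ∈ (WordParkingFunction.finite_content (k * m) k (vecExp a)).toFinset ↔
        (wpfPath P).LabelsLE M ∧ ∀ x, ((wpfPath P).filling M x).card = a x := by
    rw [Set.Finite.mem_toFinset, ← LabeledPath.content_eq_iff]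
    rfl
  refine Finset.sum_bij_ne_zero (fun P _ _ => (wpfPath P).filling M) ?_ ?_ ?_ ?_
  · intro P hP _
    rw [Finset.mem_filter]
    exact ⟨Finset.mem_univ _, ((hmem P).mp hP).2⟩
  · intro P hP _ P' hP' _ h
    exact wpfPath_injective (LabeledPath.ext_of
      (LabeledPath.ext_filling ((hmem P).mp hP).1 ((hmem P').mp hP').1 h))
  · intro ε hε hne
    have hv := left_ne_zero_of_mul hne
    rw [wpfWeight] at hv
    have hv' := (ite_ne_right_iff.mp hv).1
    obtain ⟨P, hP1, hP2⟩ := LabeledPath.exists_filling (N := k * m) ε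
      ((sum_card_eq_sum_fillHeight ε).trans hv'.1)
    have hh : P.height = fillHeight ε := by rw [← P.fillHeight_filling hP1, hP2]
    obtain ⟨Q, rfl⟩ := exists_wpfPath_eq P (hh ▸ hv'.2)
    have hQ : Q ∈ (WordParkingFunction.finite_content (k * m) k (vecExp a)).toFinset := by
      rw [hmem, hP2]
      exact ⟨hP1, (Finset.mem_filter.mp hε).2⟩
    refine ⟨Q, hQ, ?_, hP2⟩
    exact mul_ne_zero (pow_ne_zero _ tVar_ne_zero) (zpow_ne_zero _ qVar_ne_zero)
  · intro P hP _
    have hM := ((hmem P).mp hP).1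
    rw [wpfWeight, (wpfPath P).fillHeight_filling hM, if_pos ⟨(wpfPath P).sum_height, wpf_psum_ge P⟩,
      wpf_area, wpf_dinv P hM, mul_assoc]
    congr 1
    rw [← zpow_natCast, ← zpow_add₀ qVar_ne_zero]
    congr 1
    rw [topRank]
    ring

end WordParkingFunctions

/-! ### Statistics and coefficients of the stacked series -/

section Stacked

variable {n k : ℕ}

/-- The levels of the columns of a stacked parking function, where `w` are the heights of the
stack. -/
def stackLevel {k : ℕ} (w h : Fin k → ℕ) (x : ℕ) : ℤ := psum h x - psum w x

/-- The sequences of column heights of stacks. -/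
def stackHeights (n k : ℕ) : Finset (Fin k → ℕ) :=
  (heightBox k n).filter fun w => (∀ j, 1 ≤ w j) ∧ ∑ j, w j = n

theorem mem_stackHeights {w : Fin k → ℕ} :
    w ∈ stackHeights n k ↔ (∀ j, 1 ≤ w j) ∧ ∑ j, w j = n := by
  rw [stackHeights, Finset.mem_filter, mem_heightBox, and_iff_right_iff_imp]
  rintro ⟨-, h⟩ j
  rw [← h]
  exact Finset.single_le_sum (fun _ _ => Nat.zero_le _) (Finset.mem_univ j)

/-- The weight of the stacked parking functions with column heights `h`, where `w` are the heights
of the stack. -/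
def stackWeight (n : ℕ) {k : ℕ} (w h : Fin k → ℕ) : QT :=
  if ∑ j, h j = n ∧ ∀ x ≤ k, psum w x ≤ psum h x then
    tVar ^ areaOf k (stackLevel w h) * qVar ^ (-(baseRank (fun j => stackLevel w h j) h : ℤ))
  else 0

theorem psum_stack_height (S : GridStack n k) (x : ℕ) :
    psum S.height x = (Finset.univ.filter fun r => (S.box r : ℕ) < x).card := by
  rw [← psum_eq_card]
  congr 1
  funext j
  rw [GridStack.height, Nat.card_eq_fintype_card, Fintype.card_subtype]

theorem lt_psum_stack_iff (S : GridStack n k) (r : Fin n) (x : ℕ) :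
    (r : ℕ) < psum S.height x ↔ (S.box r : ℕ) < x := by
  rw [psum_stack_height]
  exact lt_card_iff (f := fun r => (S.box r : ℕ)) (fun _ _ h => S.mono h) r x

theorem stack_height_mem (S : GridStack n k) : S.height ∈ stackHeights n k := by
  rw [mem_stackHeights]
  refine ⟨S.height_pos, ?_⟩
  rw [← psum_self, psum_stack_height, Finset.filter_true_of_mem fun r _ => (S.box r).isLt]
  simp

theorem stack_height_injective : Function.Injective (GridStack.height (n := n) (k := k)) := by
  intro S S' h
  have : S.box = S'.box := by
    funext r
    have h1 (x : ℕ) : (S.box r : ℕ) < x ↔ (S'.box r : ℕ) < x := by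
      rw [← lt_psum_stack_iff, ← lt_psum_stack_iff, h]
    have h2 := h1 (S.box r + 1)
    have h3 := h1 (S'.box r + 1)
    rw [Fin.ext_iff]
    omega
  obtain ⟨b, _, _⟩ := S
  obtain ⟨b', _, _⟩ := S'
  dsimp only at this
  subst this
  rfl

theorem exists_stack {w : Fin k → ℕ} (hw : w ∈ stackHeights n k) :
    ∃ S : GridStack n k, S.height = w := by
  have hle := mem_heightBox.mp (Finset.mem_filter.mp hw).1
  rw [mem_stackHeights] at hw
  -- The stack is the column function of the path in which column `j` carries the labels `1, …, w
  -- j`.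
  let ε (x : Fin n) : Finset (Fin k) := Finset.univ.filter fun j => (x : ℕ) < w j
  have hε : fillHeight ε = w := by
    funext j
    have := card_filter_le_lt (N := n) 0 (w j) (hle j)
    simpa [fillHeight, ε] using this
  obtain ⟨P, hP1, hP2⟩ := LabeledPath.exists_filling (N := n) ε
    (by rw [sum_card_eq_sum_fillHeight, hε, hw.2])
  have hh : P.height = w := by rw [← P.fillHeight_filling hP1, hP2, hε]
  refine ⟨⟨P.col, P.mono, fun j => ?_⟩, ?_⟩
  · have h1 := hw.1 j
    rw [← hh, LabeledPath.height, Nat.one_le_iff_ne_zero, ← Nat.pos_iff_ne_zero,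
      Finset.card_pos] at h1
    obtain ⟨r, hr⟩ := h1
    exact ⟨r, (Finset.mem_filter.mp hr).2⟩
  · refine Eq.trans (funext fun j => ?_) hh
    rw [GridStack.height, Nat.card_eq_fintype_card, Fintype.card_subtype]
    rfl

/-- The labeled path underlying a stacked parking function. -/
def stackPath (P : StackedParkingFunction n k) : LabeledPath n k where
  col r := ⟨P.col r, (P.below r).trans_lt (P.stack.box r).isLt⟩
  mono _ _ h := P.mono h
  label := P.label
  strict r s h h' := P.strict r s h (congrArg Fin.val h')

theorem below_iff (S : GridStack n k) (P : LabeledPath n k) :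
    (∀ r, (P.col r : ℕ) ≤ S.box r) ↔ ∀ x ≤ k, psum S.height x ≤ psum P.height x := by
  constructor
  · intro h x _
    rw [psum_stack_height, ← P.before_eq_psum]
    refine Finset.card_le_card fun r hr => ?_
    simp only [Finset.mem_filter, Finset.mem_univ, true_and] at hr ⊢
    exact (h r).trans_lt hr
  · intro h r
    have h1 := (lt_psum_stack_iff S r (S.box r + 1)).mpr (Nat.lt_succ_self _)
    have h2 := h1.trans_le (h _ (S.box r).isLt)
    rw [← P.before_eq_psum, P.lt_before_iff] at h2
    omega

theorem stackPath_injective (P P' : StackedParkingFunction n k)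
    (h : P.stack.height = P'.stack.height) (h' : stackPath P = stackPath P') : P = P' := by
  obtain ⟨S, c, _, _, l, _⟩ := P
  obtain ⟨S', c', _, _, l', _⟩ := P'
  have h0 : S = S' := stack_height_injective h
  have h1 : c = c' := funext fun r => congrArg Fin.val (congrFun (congrArg LabeledPath.col h') r)
  have h2 : l = l' := congrArg LabeledPath.label h'
  subst h0 h1 h2
  rfl

theorem stackPath_psum_le (P : StackedParkingFunction n k) :
    ∀ x ≤ k, psum P.stack.height x ≤ psum (stackPath P).height x :=
  (below_iff P.stack (stackPath P)).mp P.below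

/-- Each column together with the `w_j - 1` columns inserted after it has total width `w_j`. Hence
the column starts of the expanded path lie on the diagonals `stackLevel`. -/
theorem shift_eq_psum (S : GridStack n k) (x : Fin k) : S.shift x = psum S.height x := by
  have h1 : ∑ j ∈ Finset.univ.filter (fun j : Fin k => (j : ℕ) < x), S.height j =
      ∑ j ∈ Finset.univ.filter (fun j : Fin k => (j : ℕ) < x), (1 + (S.height j - 1)) :=
    Finset.sum_congr rfl fun j _ => by have := S.height_pos j; omega
  have h2 : (Finset.univ.filter fun j : Fin k => (j : ℕ) < x) = Finset.Iio x := by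
    ext j
    simp
  rw [psum, h1, Finset.sum_add_distrib, GridStack.shift, h2]
  simp

theorem stack_hdinv (P : StackedParkingFunction n k) :
    P.hdinv = (stackPath P).inv fun j => stackLevel P.stack.height (stackPath P).height j := by
  classical
  rw [StackedParkingFunction.hdinv, WordParkingFunction.tdinv, Nat.card_eq_fintype_card,
    Fintype.card_subtype, LabeledPath.inv]
  congr 1
  ext ⟨r, s⟩
  simp only [Finset.mem_filter, Finset.mem_univ, true_and]
  have hn : n / n = 1 := Nat.div_self ((Nat.zero_le _).trans_lt r.isLt)
  have hdiag (r : Fin n) : diagonal 1 (P.expand.path.col r) r =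
      (stackPath P).diag (fun j => stackLevel P.stack.height (stackPath P).height j) r := by
    have h1 := (stackPath P).val_eq r
    rw [(stackPath P).before_eq_psum] at h1
    have h2 : P.expand.path.col r = psum P.stack.height ((stackPath P).col r) :=
      shift_eq_psum P.stack ((stackPath P).col r)
    rw [diagonal, LabeledPath.diag, stackLevel, h2, h1]
    push_cast
    ring
  have hlt (r s : Fin n) : P.expand.path.col r < P.expand.path.col s ↔
      (stackPath P).col r < (stackPath P).col s := P.stack.shift_strictMono.lt_iff_lt
  rw [hn, Attacks, hdiag, hdiag, hlt, hlt]
  rfl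

theorem stack_area (P : StackedParkingFunction n k) :
    P.area = areaOf k (stackLevel P.stack.height (stackPath P).height) := by
  classical
  rw [← sum_card_eq_areaOf (stackLevel _ _) (psum (stackPath P).height) (psum P.stack.height) (fun x => rfl)
    (stackPath_psum_le P), StackedParkingFunction.area, Nat.card_eq_fintype_card,
    Fintype.card_subtype, Finset.card_filter, ← Finset.univ_product_univ, Finset.sum_product]
  refine Finset.sum_congr rfl fun x _ => ?_
  rw [← Finset.card_filter, ← card_filter_le_lt (N := n) _ _
    ((stackPath P).before_eq_psum _ ▸ (stackPath P).before_le _)]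
  congr 1
  ext r
  simp only [Finset.mem_filter, Finset.mem_univ, true_and]
  rw [← (stackPath P).before_eq_psum, (stackPath P).lt_before_iff, and_comm,
    Nat.lt_succ_iff, ← not_lt (b := psum _ _), lt_psum_stack_iff, not_lt, Nat.succ_le_iff]
  rfl

/-- A stack is equivalent to its column heights `w`. For fixed `w` the labeled paths are fillings,
those violating the stack condition having weight zero. -/
theorem stackedSeries_vecExp {M B : ℕ} (hB : M ≤ B) (a : Fin M → ℕ) :
    stackedSeries n k (vecExp a) = ∑ w ∈ stackHeights n k,
      columnSum qVar B (stackWeight n w) (fun h j => stackLevel w h j) (List.ofFn a) := by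
  classical
  simp only [← sum_filling_eq_columnSum hB]
  rw [← Finset.sum_product', stackedSeries]
  have hmem (P : StackedParkingFunction n k) :
      P ∈ (StackedParkingFunction.finite_content n k (vecExp a)).toFinset ↔
        (stackPath P).LabelsLE M ∧ ∀ x, ((stackPath P).filling M x).card = a x := by
    rw [Set.Finite.mem_toFinset, ← LabeledPath.content_eq_iff]
    rfl
  refine Finset.sum_bij_ne_zero (fun P _ _ => (P.stack.height, (stackPath P).filling M)) ?_ ?_ ?_ ?_
  · intro P hP _
    rw [Finset.mem_product]
    exact ⟨stack_height_mem _, Finset.mem_univ _⟩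
  · intro P hP _ P' hP' _ h
    obtain ⟨h1, h2⟩ := Prod.mk.inj h
    exact stackPath_injective P P' h1 (LabeledPath.ext_of
      (LabeledPath.ext_filling ((hmem P).mp hP).1 ((hmem P').mp hP').1 h2))
  · rintro ⟨w, ε⟩ hε hne
    obtain ⟨hcard, hne⟩ := ite_ne_right_iff.mp hne
    have hv := left_ne_zero_of_mul hne
    rw [stackWeight] at hv
    have hv' := (ite_ne_right_iff.mp hv).1
    obtain ⟨S, rfl⟩ := exists_stack (Finset.mem_product.mp hε).1
    obtain ⟨P, hP1, hP2⟩ := LabeledPath.exists_filling (N := n) ε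
      ((sum_card_eq_sum_fillHeight ε).trans hv'.1)
    have hh : P.height = fillHeight ε := by rw [← P.fillHeight_filling hP1, hP2]
    let Q : StackedParkingFunction n k :=
      ⟨S, fun r => P.col r, fun _ _ hrs => P.mono hrs, (below_iff S P).mpr (hh ▸ hv'.2), P.label,
        fun r s hrs h' => P.strict r s hrs (Fin.ext h')⟩
    have hQP : stackPath Q = P := rfl
    have hQ : Q ∈ (StackedParkingFunction.finite_content n k (vecExp a)).toFinset := by
      rw [hmem, hQP, hP2]
      exact ⟨hP1, hcard⟩
    refine ⟨Q, hQ, ?_, ?_⟩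
    · exact mul_ne_zero (pow_ne_zero _ tVar_ne_zero) (pow_ne_zero _ qVar_ne_zero)
    · rw [hQP, hP2]
  · intro P hP _
    obtain ⟨hM, hcard⟩ := (hmem P).mp hP
    dsimp only
    rw [if_pos hcard, stackWeight, (stackPath P).fillHeight_filling hM,
      if_pos ⟨(stackPath P).sum_height, stackPath_psum_le P⟩, stack_area, stack_hdinv, mul_assoc,
      (stackPath P).fillRank_filling hM, ← LabeledPath.inv_add_base]
    congr 1
    rw [← zpow_natCast, ← zpow_natCast, ← zpow_add₀ qVar_ne_zero]
    congr 1
    rw [baseRank]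
    push_cast
    ring

end Stacked

end RiseDelta
end

noncomputable section

namespace RiseDelta

/-! ### The two series are symmetric functions -/

/-- The multiset of the nonzero exponents. -/
def exponents {ι : Type} (α : ι →₀ ℕ) : Multiset ℕ := α.support.val.map α

theorem exponents_embDomain {ι κ : Type} (e : ι ↪ κ) (α : ι →₀ ℕ) :
    exponents (α.embDomain e) = exponents α := by
  rw [exponents, Finsupp.support_embDomain, Finset.map_val, Multiset.map_map, exponents]
  exact Multiset.map_congr rfl fun x _ => Finsupp.embDomain_apply_self e α x

theorem exponents_vecExp {d : ℕ} (v : Fin d → ℕ) :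
    exponents (vecExp v) = ((List.ofFn v).filter (· ≠ 0) : List ℕ) := by
  rw [vecExp, exponents_embDomain, exponents, ← Multiset.filter_coe, ← Fin.univ_val_map,
    Multiset.filter_map]
  refine Multiset.map_congr ?_ fun _ _ => rfl
  rw [← Finset.filter_val]
  congr 1
  ext i
  simp

theorem exists_eq_vecExp (α : ℕ+ →₀ ℕ) : ∃ (M : ℕ) (v : Fin M → ℕ), α = vecExp v := by
  refine ⟨α.support.sup fun x => (x : ℕ), fun i => α (firstVars _ i), ?_⟩
  ext x
  by_cases hx : x ∈ Set.range (firstVars (α.support.sup fun x => (x : ℕ)))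
  · obtain ⟨i, rfl⟩ := hx
    rw [vecExp, Finsupp.embDomain_apply_self]
    rfl
  · rw [vecExp, Finsupp.embDomain_of_notMem_range _ _ _ hx]
    by_contra hne
    have h1 : (x : ℕ) ≤ α.support.sup fun x => (x : ℕ) :=
      Finset.le_sup (f := fun x : ℕ+ => (x : ℕ)) (Finsupp.mem_support_iff.mpr hne)
    refine hx ⟨⟨x.natPred, lt_of_lt_of_le ?_ h1⟩, PNat.succPNat_natPred x⟩
    have := x.natPred_add_one
    omega

/-- A permutation of variables preserves the multiset of nonzero exponents, and `φ` depends on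
nothing else. The bound `B` is free so that two exponent vectors of different lengths can be
compared under the same bound. -/
theorem mem_symmFunc {R : Type} [CommRing R] (f : MvPowerSeries ℕ+ R) (d : ℕ)
    (hd : ∀ α, MvPowerSeries.coeff α f ≠ 0 → α.degree ≤ d) (φ : ℕ → List ℕ → R)
    (hφ : ∀ B (L L' : List ℕ), (L.filter (· ≠ 0)).Perm (L'.filter (· ≠ 0)) → φ B L = φ B L')
    (hf : ∀ (M B : ℕ) (a : Fin M → ℕ), M ≤ B → f (vecExp a) = φ B (List.ofFn a)) :
    f ∈ SymmFunc R := by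
  refine ⟨fun σ => ?_, d, hd⟩
  ext α
  obtain ⟨β, rfl⟩ : ∃ β : ℕ+ →₀ ℕ, β.embDomain σ.toEmbedding = α :=
    ⟨α.equivMapDomain σ.symm, by
      ext i
      obtain ⟨j, rfl⟩ := σ.surjective i
      exact (Finsupp.embDomain_apply_self σ.toEmbedding _ j).trans (by simp)⟩
  refine (MvPowerSeries.coeff_embDomain_rename σ.toEmbedding _ β).trans ?_
  change f β = f (β.embDomain σ.toEmbedding)
  have h := exponents_embDomain σ.toEmbedding β
  obtain ⟨M, a, ha⟩ := exists_eq_vecExp β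
  obtain ⟨M', a', ha'⟩ := exists_eq_vecExp (β.embDomain σ.toEmbedding)
  rw [ha', ha, exponents_vecExp, exponents_vecExp, Multiset.coe_eq_coe] at h
  rw [ha', ha, hf M (max M M') a (le_max_left _ _), hf M' (max M M') a' (le_max_right _ _)]
  exact hφ _ _ _ h.symm

theorem columnSum_congr {F : Type} [Field F] {k : ℕ} (q : F) (B : ℕ) (wt : (Fin k → ℕ) → F)
    (d : (Fin k → ℕ) → Fin k → ℤ) (L L' : List ℕ)
    (h : (L.filter (· ≠ 0)).Perm (L'.filter (· ≠ 0))) :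
    columnSum q B wt d L = columnSum q B wt d L' := by
  refine Finset.sum_congr rfl fun x _ => ?_
  rw [← transfer_filter_ne_zero q L, ← transfer_filter_ne_zero q L', transfer_perm q h]

theorem degree_sum_single {N : ℕ} (l : Fin N → ℕ+) :
    (∑ r, Finsupp.single (l r) 1 : ℕ+ →₀ ℕ).degree = N := by
  rw [map_sum]
  simp

theorem wpfSeries_mem (k m : ℕ) : wpfSeries (k * m) k ∈ SymmFunc QT := by
  refine mem_symmFunc _ (k * m) (fun α hα => ?_)
    (fun B L => columnSum qVar B (wpfWeight m) (fun (h : Fin k → ℕ) j => wpfLevel m h j) L)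
    (fun B L L' h => columnSum_congr _ _ _ _ _ _ h) fun M B a hB => wpfSeries_vecExp hB a
  obtain ⟨P, hP, -⟩ := Finset.exists_ne_zero_of_sum_ne_zero hα
  rw [Set.Finite.mem_toFinset] at hP
  rw [← show P.content = α from hP]
  exact (degree_sum_single P.label).le

theorem stackedSeries_mem (n k : ℕ) : stackedSeries n k ∈ SymmFunc QT := by
  refine mem_symmFunc _ n (fun α hα => ?_)
    (fun B L => ∑ w ∈ stackHeights n k,
      columnSum qVar B (stackWeight n w) (fun h j => stackLevel w h j) L)
    (fun B L L' h => Finset.sum_congr rfl fun w _ => columnSum_congr _ _ _ _ _ _ h)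
    fun M B a hB => stackedSeries_vecExp hB a
  obtain ⟨P, hP, -⟩ := Finset.exists_ne_zero_of_sum_ne_zero hα
  rw [Set.Finite.mem_toFinset] at hP
  rw [← show P.content = α from hP]
  exact (degree_sum_single P.label).le

/-- A label occupies a set of columns, so it cannot occur more than `k` times. -/
theorem columnSum_eq_zero {F : Type} [Field F] {k M : ℕ} (q : F) (B : ℕ) (wt : (Fin k → ℕ) → F)
    (d : (Fin k → ℕ) → Fin k → ℤ) (a : Fin M → ℕ) (x : Fin M) (hx : k < a x) :
    columnSum q B wt d (List.ofFn a) = 0 := by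
  refine Finset.sum_eq_zero fun h _ => ?_
  rw [transfer_ofFn, Finset.sum_eq_zero, mul_zero]
  refine fun ε _ => if_neg fun h => ?_
  have h1 := h.1 x
  have h2 := Finset.card_le_univ (ε x)
  rw [Fintype.card_fin] at h2
  omega

theorem wpfSeries_eq_zero (k m : ℕ) (α : ℕ+ →₀ ℕ) (i : ℕ+) (hi : k < α i) :
    wpfSeries (k * m) k α = 0 := by
  obtain ⟨M, a, rfl⟩ := exists_eq_vecExp α
  have hr : i ∈ Set.range (firstVars M) := by
    by_contra hr
    rw [vecExp, Finsupp.embDomain_of_notMem_range _ _ _ hr] at hi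
    omega
  obtain ⟨x, rfl⟩ := hr
  rw [vecExp, Finsupp.embDomain_apply_self] at hi
  rw [wpfSeries_vecExp le_rfl]
  exact columnSum_eq_zero _ _ _ _ _ x hi

end RiseDelta
end

noncomputable section

namespace RiseDelta

/-! ### Comparison of the exponents -/

section Exponents

theorem sum_Ico_lt (s e c : ℤ) (h : s ≤ e) :
    ∑ y ∈ Finset.Ico s e, (if y < c then 1 else 0 : ℤ) = max (c - s) 0 - max (c - e) 0 := by
  have : (Finset.Ico s e).filter (· < c) = Finset.Ico s (min e c) := by
    ext y
    simp only [Finset.mem_filter, Finset.mem_Ico]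
    omega
  rw [← Finset.sum_filter, this, Finset.sum_const, Int.card_Ico, nsmul_one]
  omega

theorem sum_range_eq_sum_Ico {A : Type} [AddCommMonoid A] (d : ℤ) (h : ℕ) (f : ℤ → A) :
    ∑ y ∈ Finset.range h, f (d + y) = ∑ y ∈ Finset.Ico d (d + h), f y := by
  refine Finset.sum_bij' (fun y _ => d + y) (fun y _ => (y - d).toNat) ?_ ?_ ?_ ?_ ?_
  · intro y hy
    rw [Finset.mem_range] at hy
    rw [Finset.mem_Ico]
    omega
  · intro y hy
    rw [Finset.mem_Ico] at hy
    rw [Finset.mem_range]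
    omega
  · intro y _
    simp
  · intro y hy
    rw [Finset.mem_Ico] at hy
    omega
  · intro y _
    rfl

/-- The sum of a function over the pairs `i < j < k`. -/
def pairSum (k : ℕ) (X : ℕ → ℕ → ℤ) : ℤ := ∑ j ∈ Finset.range k, ∑ i ∈ Finset.range j, X i j

theorem sum_lt_eq_pairSum (k : ℕ) (X : ℕ → ℕ → ℤ) :
    ∑ j : Fin k, ∑ i : Fin k, (if i < j then X i j else 0) = pairSum k X := by
  have h1 (j : Fin k) : (∑ i : Fin k, if i < j then X i j else 0) = ∑ i ∈ Finset.range j, X i j := by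
    have : (∑ i : Fin k, if i < j then X i j else 0) =
        ∑ i : Fin k, (fun i : ℕ => if i < (j : ℕ) then X i j else 0) i := rfl
    rw [this, ← Finset.sum_range (fun i : ℕ => if i < (j : ℕ) then X i j else 0),
      ← Finset.sum_filter]
    refine Finset.sum_congr ?_ fun _ _ => rfl
    ext i
    have := j.isLt
    simp only [Finset.mem_filter, Finset.mem_range]
    omega
  simp only [h1]
  exact (Finset.sum_range fun j => ∑ i ∈ Finset.range j, X i j).symm

theorem sum_gt_eq_pairSum (k : ℕ) (X : ℕ → ℕ → ℤ) :
    ∑ j : Fin k, ∑ i : Fin k, (if j < i then X j i else 0) = pairSum k X := by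
  rw [Finset.sum_comm, sum_lt_eq_pairSum]

theorem pairSum_add (k : ℕ) (X Y : ℕ → ℕ → ℤ) :
    pairSum k X + pairSum k Y = pairSum k fun i j => X i j + Y i j := by
  simp only [pairSum, Finset.sum_add_distrib]

theorem pairSum_sub (k : ℕ) (X Y : ℕ → ℕ → ℤ) :
    pairSum k X - pairSum k Y = pairSum k fun i j => X i j - Y i j := by
  simp only [pairSum, Finset.sum_sub_distrib]

theorem pairSum_congr {k : ℕ} {X Y : ℕ → ℕ → ℤ} (h : ∀ i j, i < j → j < k → X i j = Y i j) :
    pairSum k X = pairSum k Y :=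
  Finset.sum_congr rfl fun _ hj => Finset.sum_congr rfl fun _ hi =>
    h _ _ (Finset.mem_range.mp hi) (Finset.mem_range.mp hj)

theorem pairSum_telescope_left (k : ℕ) (g : ℕ → ℕ → ℤ) (h : ∀ j < k, g 0 j = g j j) :
    pairSum k (fun i j => g (i + 1) j - g i j) = 0 := by
  refine Finset.sum_eq_zero fun j hj => ?_
  rw [Finset.sum_range_sub fun i => g i j, h j (Finset.mem_range.mp hj), sub_self]

theorem pairSum_telescope_right (k : ℕ) (g : ℕ → ℕ → ℤ) (h : ∀ i < k, g i (i + 1) = g i k) :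
    pairSum k (fun i j => g i (j + 1) - g i j) = 0 := by
  have key : ∀ k, pairSum k (fun i j => g i (j + 1) - g i j) =
      ∑ i ∈ Finset.range k, (g i k - g i (i + 1)) := by
    intro k
    induction k with
    | zero => simp [pairSum]
    | succ k ih =>
      rw [pairSum, Finset.sum_range_succ, ← pairSum, ih, Finset.sum_range_succ, sub_self, add_zero,
        ← Finset.sum_add_distrib]
      exact Finset.sum_congr rfl fun i _ => by ring
  rw [key]
  exact Finset.sum_eq_zero fun i hi => by rw [h i (Finset.mem_range.mp hi), sub_self]

/-- Along each line of fixed `j - i` the sum telescopes; the remaining ends are the values `g i k`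
and `g 0 j`, which the hypotheses match. -/
theorem pairSum_telescope_diag (k : ℕ) (g : ℕ → ℕ → ℤ)
    (h : ∀ i < k, g 0 i = g i k) (h0 : g 0 0 = g 0 k) :
    pairSum k (fun i j => g (i + 1) (j + 1) - g i j) = 0 := by
  have key : ∀ k, pairSum k (fun i j => g (i + 1) (j + 1) - g i j) =
      ∑ i ∈ Finset.range k, (g i k - g 0 i) + (g 0 0 - g 0 k) := by
    intro k
    induction k with
    | zero => simp [pairSum]
    | succ k ih =>
      rw [pairSum, Finset.sum_range_succ, ← pairSum, ih]
      have h1 := Finset.sum_range_succ' (fun i => g i (k + 1)) k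
      have h2 := Finset.sum_range_succ (fun i => g 0 i) k
      simp only [Finset.sum_sub_distrib]
      rw [h1, h2]
      ring
  rw [key, h0, sub_self, add_zero]
  exact Finset.sum_eq_zero fun i hi => by rw [h i (Finset.mem_range.mp hi), sub_self]

/-- The sum of the ranks, with respect to `p`, of the boxes between the heights `d` and `e`. -/
theorem sum_rankOf_eq_pairSum (k : ℕ) (p d e : ℕ → ℤ) (h : ∀ j < k, d j ≤ e j) :
    ((∑ j : Fin k, ∑ y ∈ Finset.Ico (d j) (e j), rankOf (fun i : Fin k => p i) y j : ℕ) : ℤ) =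
      pairSum k fun i j => max (p i - d j) 0 - max (p i - e j) 0 +
        (max (p j + 1 - d i) 0 - max (p j + 1 - e i) 0) := by
  rw [← pairSum_add, ← sum_lt_eq_pairSum, ← sum_gt_eq_pairSum, ← Finset.sum_add_distrib]
  push_cast
  refine Finset.sum_congr rfl fun j _ => ?_
  rw [← Finset.sum_add_distrib]
  simp only [rankOf]
  push_cast
  rw [Finset.sum_comm]
  refine Finset.sum_congr rfl fun i _ => ?_
  have hj := h j j.isLt
  rcases lt_trichotomy i j with hij | rfl | hij
  · have hn : ¬ j < i := hij.asymm
    simp only [After, hij, hn, if_true, if_false, true_and, false_and, or_false, add_zero]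
    rw [sum_Ico_lt _ _ _ hj]
  · simp [After]
  · have hn : ¬ i < j := hij.asymm
    simp only [After, hij, hn, if_true, if_false, true_and, false_and, false_or, zero_add]
    rw [← sum_Ico_lt _ _ _ hj]
    exact Finset.sum_congr rfl fun y _ => if_congr Int.lt_add_one_iff.symm rfl rfl

/-- With `max z 0 = z + max (-z) 0`, the difference of the two summands is a signed sum of five
discrete differences: in `i`, in `j`, or in both. -/
theorem pairSum_exponents (k : ℕ) (m : ℤ) (a b : ℕ → ℤ) (h0 : a 0 = 0) (hk : a k = 0)
    (ha : ∀ x ≤ k, 0 ≤ a x) (hab : ∀ j < k, a j ≤ b j) (hb : ∀ j < k, a (j + 1) + 1 ≤ b j)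
    (hm : ∀ j < k, a j ≤ a (j + 1) + m) :
    (pairSum k fun i j => max (a (i + 1) + m - a j) 0 - max (a (i + 1) - a (j + 1)) 0 -
        (max (a (i + 1) - 1 - a j) 0 - max (a (i + 1) - 1 - (a (j + 1) + m)) 0)) +
      (pairSum k fun _ _ => m - 1) +
      (pairSum k fun i j => max (a i - a j) 0 - max (a i - b j) 0 +
        (max (a j + 1 - a i) 0 - max (a j + 1 - b i) 0)) =
    (pairSum k fun i j => max (a (i + 1) + m - a j) 0 - max (a (i + 1) + m - (a (j + 1) + m)) 0 +
        (max (a (j + 1) + m + 1 - a i) 0 - max (a (j + 1) + m + 1 - (a (i + 1) + m)) 0)) +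
      (pairSum k fun i j => max (a (i + 1) + 1 - (a (j + 1) + 2)) 0 -
        max (a (i + 1) + 1 - (b j + 1)) 0 +
        (max (a (j + 1) + 1 + 1 - (a (i + 1) + 2)) 0 - max (a (j + 1) + 1 + 1 - (b i + 1)) 0)) := by
  -- The inequalities on `a` and `b` make the boundary values vanish in `t1` to `t4`. In `t5` they
  -- agree because `a` is nonnegative and zero at both ends.
  have t1 := pairSum_telescope_left k (fun i j => max (a i - b j) 0) fun j hj => by
    have := hab j hj
    have := ha j hj.le
    omega
  have t2 := pairSum_telescope_right k (fun i j => max (a j + 1 - b i) 0) fun i hi => by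
    have := hb i hi
    have := ha (i + 1) hi
    omega
  have t3 := pairSum_telescope_left k (fun i j => max (a i - 1 - (a (j + 1) + m)) 0) fun j hj => by
    have := hm j hj
    have := ha j hj.le
    omega
  have t4 := pairSum_telescope_left k (fun i j => max (a i - 1 - a j) 0) fun j hj => by
    have := ha j hj.le
    omega
  have t5 := pairSum_telescope_diag k (fun i j => max (a i) (a j)) (fun i hi => by
    have := ha i hi.le
    omega) (by
    omega)
  rw [← sub_eq_zero, pairSum_add, pairSum_add, pairSum_add, pairSum_sub]
  have hsum : ∀ X Y Z U V : ℕ → ℕ → ℤ, pairSum k X = 0 → pairSum k Y = 0 → pairSum k Z = 0 →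
      pairSum k U = 0 → pairSum k V = 0 →
      pairSum k (fun i j => X i j + Y i j + Z i j - U i j - V i j) = 0 := by
    intro X Y Z U V hX hY hZ hU hV
    rw [← pairSum_sub, ← pairSum_sub, ← pairSum_add, ← pairSum_add, hX, hY, hZ, hU, hV]
    norm_num
  refine Eq.trans (pairSum_congr fun i j _ _ => ?_) (hsum _ _ _ _ _ t1 t2 t3 t4 t5)
  have hneg (z w : ℤ) (h : z + w = 0) : max z 0 = z + max w 0 := by omega
  have hcongr (z w : ℤ) (h : z = w) : max z 0 = max w 0 := by rw [h]
  have hmax (z w : ℤ) : max z w = z + max (w - z) 0 := by omega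
  rw [hmax (a (i + 1)) (a (j + 1)), max_comm (a i) (a j), hmax (a j) (a i),
    hneg (a (j + 1) + m + 1 - a i) (a i - 1 - (a (j + 1) + m)) (by ring),
    hneg (a (j + 1) + m + 1 - (a (i + 1) + m)) (a (i + 1) - a (j + 1) - 1) (by ring),
    hneg (a j + 1 - a i) (a i - 1 - a j) (by ring),
    hcongr (a (i + 1) + m - (a (j + 1) + m)) (a (i + 1) - a (j + 1)) (by ring),
    hcongr (a (i + 1) + 1 - (a (j + 1) + 2)) (a (i + 1) - a (j + 1) - 1) (by ring),
    hcongr (a (i + 1) + 1 - (b j + 1)) (a (i + 1) - b j) (by ring),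
    hcongr (a (j + 1) + 1 + 1 - (a (i + 1) + 2)) (a (j + 1) - a (i + 1)) (by ring),
    hcongr (a (j + 1) + 1 + 1 - (b i + 1)) (a (j + 1) + 1 - b i) (by ring)]
  ring

end Exponents

end RiseDelta
end

noncomputable section

namespace RiseDelta

/-! ### From rational heights to stacks, and the equality of exponents -/

section Reindex

variable {k : ℕ} (m : ℕ) (w r : Fin k → ℕ)

/-- The heights of the columns of a rational parking function from which one obtains columns of
heights `r` over a stack with column heights `w`. -/
def wpfHeights (j : Fin k) : ℕ := r j + m - w j

theorem psum_wpfHeights (hw : ∀ j, w j ≤ m) (x : ℕ) (hx : x ≤ k) :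
    (psum (wpfHeights m w r) x : ℤ) = psum r x + m * x - psum w x := by
  have hcard : (Finset.univ.filter fun j : Fin k => (j : ℕ) < x).card = x := by
    have := card_filter_le_lt (N := k) 0 x hx
    simpa using this
  have h1 (j : Fin k) : ((wpfHeights m w r j : ℕ) : ℤ) = r j + m - w j := by
    have := hw j
    rw [wpfHeights]
    omega
  simp only [psum]
  push_cast
  simp only [h1, Finset.sum_sub_distrib, Finset.sum_add_distrib, Finset.sum_const, hcard,
    nsmul_eq_mul]
  ring

theorem wpfLevel_wpfHeights (hw : ∀ j, w j ≤ m) (x : ℕ) (hx : x ≤ k) :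
    wpfLevel m (wpfHeights m w r) x = stackLevel w r x := by
  rw [wpfLevel, psum_wpfHeights m w r hw x hx, stackLevel]
  ring

theorem totalRank_eq_pairSum (k : ℕ) : (totalRank k : ℤ) = pairSum k fun _ _ => 1 := by
  have h := sum_rankOf_eq_pairSum k (fun _ => 0) (fun _ => 0) (fun _ => 1) fun _ _ => by norm_num
  rw [show (fun _ _ : ℕ => (1 : ℤ)) = fun _ _ => max ((0 : ℤ) - 0) 0 - max ((0 : ℤ) - 1) 0 +
    (max ((0 : ℤ) + 1 - 0) 0 - max ((0 : ℤ) + 1 - 1) 0) by norm_num, ← h, totalRank, rankSum]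
  rfl

/-- The number of diagonals in a window is a difference of two counts below a threshold, each given
by `sum_Ico_lt`. -/
theorem pathdinvOf_eq_pairSum (h : Fin k → ℕ) (a : ℕ → ℤ)
    (ha : ∀ x ≤ k, wpfLevel m h x = a x) (hh : ∀ j : Fin k, a j + h j = a (j + 1) + m) :
    (pathdinvOf m h : ℤ) = pairSum k fun i j =>
      max (a (i + 1) + m - a j) 0 - max (a (i + 1) - a (j + 1)) 0 -
        (max (a (i + 1) - 1 - a j) 0 - max (a (i + 1) - 1 - (a (j + 1) + m)) 0) := by
  rw [← sum_lt_eq_pairSum, pathdinvOf]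
  push_cast
  refine Finset.sum_congr rfl fun j _ => ?_
  have hj := hh j
  have hle : a j ≤ a (j + 1) + m := by omega
  rw [ha j j.isLt.le, sum_range_eq_sum_Ico (a j) (h j) fun y =>
    (((Finset.univ.filter fun x : Fin k => x < j ∧ wpfLevel m h (x + 1) - 1 ≤ y ∧
      y < wpfLevel m h (x + 1) + m).card : ℕ) : ℤ), hj]
  simp only [Finset.card_filter]
  push_cast
  rw [Finset.sum_comm]
  refine Finset.sum_congr rfl fun i _ => ?_
  rw [ha (i + 1) i.isLt]
  split_ifs with hij
  · simp only [hij, true_and]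
    rw [show a (i + 1) - a (j + 1) = a (i + 1) + m - (a (j + 1) + m) by ring,
      ← sum_Ico_lt _ _ (a (i + 1) + m) hle, ← sum_Ico_lt _ _ (a (i + 1) - 1) hle,
      ← Finset.sum_sub_distrib]
    refine Finset.sum_congr rfl fun y _ => ?_
    split_ifs <;> omega
  · simp [hij]

/-- The left side without `baseRank` collects positive powers of `q` from `pathdinv` and
complementation; the right side collects the negative ones. The identity says that their difference
is `-baseRank`, the exponent in the stacked weight. -/
theorem exponent_identity (hw1 : ∀ j, 1 ≤ w j) (hw : ∀ j, w j ≤ m) (hm : 1 ≤ m)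
    (hsum : ∑ j, w j = ∑ j, r j) (hle : ∀ x ≤ k, psum w x ≤ psum r x) :
    (pathdinvOf m (wpfHeights m w r) : ℤ) + (m - 1 : ℕ) * totalRank k +
      baseRank (fun j => stackLevel w r j) r =
    topRank (fun j => stackLevel w r j) (wpfHeights m w r) +
      minRank (fun j => stackLevel w r j + r j)
        (fun j => stackLevel w r j + wpfHeights m w r j - (m - 1 : ℕ)) := by
  set a := stackLevel w r with ha
  -- The top of column `j` once the original labels are placed, equal to both `a j + r j` and `a (j
  -- + 1) + w j`. The full rational column ends at `a (j + 1) + m`, so all five statistics are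
  -- expressed by `a`, `b` and `m`.
  let b (j : ℕ) : ℤ := psum r (j + 1) - psum w j
  have hr (j : Fin k) : (psum r (j + 1) : ℤ) = psum r j + r j := by
    exact_mod_cast psum_succ r j
  have hw' (j : Fin k) : (psum w (j + 1) : ℤ) = psum w j + w j := by
    exact_mod_cast psum_succ w j
  have hb (j : Fin k) : a j + r j = b j := by
    simp only [ha, stackLevel, b, hr]
    ring
  have hN (j : Fin k) : a j + wpfHeights m w r j = a (j + 1) + m := by
    have := hw j
    have : ((wpfHeights m w r j : ℕ) : ℤ) = r j + m - w j := by
      rw [wpfHeights]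
      omega
    rw [this]
    simp only [ha, stackLevel, hr, hw']
    ring
  have hbw (j : Fin k) : a (j + 1) + w j = b j := by
    simp only [ha, stackLevel, b, hw']
    ring
  have hnn (x : ℕ) (hx : x ≤ k) : 0 ≤ a x := by
    have := hle x hx
    simp only [ha, stackLevel]
    omega
  have h1 : ∀ j < k, a j ≤ b j := fun j hj => by
    have := hb ⟨j, hj⟩
    dsimp only at this
    omega
  have h2 : ∀ j < k, a (j + 1) + 1 ≤ b j := fun j hj => by
    have := hbw ⟨j, hj⟩
    have := hw1 ⟨j, hj⟩
    dsimp only at *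
    omega
  have h3 : ∀ j < k, a j ≤ a (j + 1) + m := fun j hj => by
    have := hN ⟨j, hj⟩
    dsimp only at this
    omega
  have hP := pathdinvOf_eq_pairSum m (wpfHeights m w r) a
    (fun x hx => wpfLevel_wpfHeights m w r hw x hx) hN
  have hT : (((m - 1 : ℕ) : ℤ)) * totalRank k = pairSum k fun _ _ => (m : ℤ) - 1 := by
    rw [totalRank_eq_pairSum, Nat.cast_sub hm]
    simp only [pairSum, Finset.mul_sum, mul_one, Nat.cast_one]
  have hB := sum_rankOf_eq_pairSum k a a b h1
  have hTop := sum_rankOf_eq_pairSum k (fun j => a (j + 1) + m) a (fun j => a (j + 1) + m) h3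
  have hMin := sum_rankOf_eq_pairSum k (fun j => a (j + 1) + 1) (fun j => a (j + 1) + 2)
    (fun j => b j + 1) fun j hj => by
      have := h2 j hj
      omega
  have hbase : baseRank (fun j => a j) r =
      ∑ j : Fin k, ∑ y ∈ Finset.Ico (a j) (b j), rankOf (fun i : Fin k => a i) y j := by
    refine Finset.sum_congr rfl fun j _ => ?_
    rw [sum_range_eq_sum_Ico (a j) (r j) fun y => rankOf (fun i : Fin k => a i) y j, hb]
  have htop : topRank (fun j => a j) (wpfHeights m w r) =
      ∑ j : Fin k, ∑ y ∈ Finset.Ico (a j) (a (j + 1) + m),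
        rankOf (fun i : Fin k => a (i + 1) + m) y j := by
    refine Finset.sum_congr rfl fun j _ => ?_
    simp only [hN]
    rw [sum_range_eq_sum_Ico (a j) (wpfHeights m w r j) fun y =>
      rankOf (fun i : Fin k => a (i + 1) + m) y j, hN]
  have hmin : minRank (fun j => a j + r j) (fun j => a j + wpfHeights m w r j - (m - 1 : ℕ)) =
      ∑ j : Fin k, ∑ y ∈ Finset.Ico (a (j + 1) + 2) (b j + 1),
        rankOf (fun i : Fin k => a (i + 1) + 1) y j := by
    refine Finset.sum_congr rfl fun j _ => ?_
    have hN' (j : Fin k) : a j + wpfHeights m w r j - (m - 1 : ℕ) = a (j + 1) + 1 := by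
      rw [hN, Nat.cast_sub hm]
      push_cast
      ring
    simp only [hN', hb]
    refine Finset.sum_congr ?_ fun _ _ => rfl
    ext y
    rw [Finset.mem_Ioc, Finset.mem_Ico]
    omega
  rw [hP, hT, hbase, hB, htop, hTop, hmin, hMin]
  refine pairSum_exponents k m a b ?_ ?_ hnn h1 h2 h3
  · simp [ha, stackLevel, psum_zero]
  · simp [ha, stackLevel, psum_self, hsum]

end Reindex

/-! ### Summation over heights and the comparison of coefficients -/

section Main

variable {n k : ℕ}

theorem stackHeights_le (hk : k ≤ n) {w : Fin k → ℕ} (hw : w ∈ stackHeights n k) (j : Fin k) :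
    w j ≤ n - k + 1 := by
  rw [mem_stackHeights] at hw
  have h1 : w j + ∑ i ∈ Finset.univ.erase j, w i = n := by
    rw [Finset.add_sum_erase _ _ (Finset.mem_univ j), hw.2]
  have h2 : (Finset.univ.erase j).card • 1 ≤ ∑ i ∈ Finset.univ.erase j, w i :=
    Finset.card_nsmul_le_sum _ _ _ fun i _ => hw.1 i
  rw [Finset.card_erase_of_mem (Finset.mem_univ j), Finset.card_univ, Fintype.card_fin] at h2
  have := j.isLt
  simp only [smul_eq_mul, mul_one] at h2
  omega

/-- The term of a rational parking function with column heights `h` of which `r` come from the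
original labels. -/
def wpfTerm (l : ℕ) (q : QT) {k : ℕ} (f : (Fin k → ℤ) → (Fin k → ℤ) → QT) (r h : Fin k → ℕ) : QT :=
  wpfWeight (l + 1) h * (f (fun j => wpfLevel (l + 1) h j) (fun j => wpfLevel (l + 1) h j + r j) *
    (q ^ (l * totalRank k) * closedForm q⁻¹ l (fun j => wpfLevel (l + 1) h j + r j)
      (fun j => wpfLevel (l + 1) h j + h j - l)))

theorem wpfTerm_wpfHeights (hk : k ≤ n) {w : Fin k → ℕ} (hw : w ∈ stackHeights n k)
    (f : (Fin k → ℤ) → (Fin k → ℤ) → QT) (r : Fin k → ℕ) :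
    wpfTerm (n - k) qVar f r (wpfHeights (n - k + 1) w r) = stackWeight n w r *
      f (fun j => stackLevel w r j) (fun j => stackLevel w r j + r j) := by
  have hwm := stackHeights_le hk hw
  rw [mem_stackHeights] at hw
  set m := n - k + 1 with hm
  have hps := psum_wpfHeights m w r hwm
  have hlev : (fun j : Fin k => wpfLevel m (wpfHeights m w r) j) = fun j : Fin k => stackLevel w r j :=
    funext fun j => wpfLevel_wpfHeights m w r hwm j j.isLt.le
  have hlev' (j : Fin k) := congrFun hlev j
  have hH (j : Fin k) : ((wpfHeights m w r j : ℕ) : ℤ) = r j + m - w j := by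
    have := hwm j
    rw [wpfHeights]
    omega
  have hsum : ∑ j, wpfHeights m w r j = k * m ↔ ∑ j, r j = n := by
    have := hps k le_rfl
    rw [psum_self, psum_self, psum_self, hw.2, mul_comm] at this
    rw [← Nat.cast_inj (R := ℤ), this, Nat.cast_mul]
    omega
  have hvalid : (∀ x ≤ k, m * x ≤ psum (wpfHeights m w r) x) ↔
      ∀ x ≤ k, psum w x ≤ psum r x := by
    refine forall₂_congr fun x hx => ?_
    have := hps x hx
    zify
    rw [this]
    constructor <;> intro h <;> linarith
  have hclosed : (∀ j : Fin k, stackLevel w r j + wpfHeights m w r j - (n - k : ℕ) ≤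
        stackLevel w r j + r j) ∧
      ∑ j : Fin k, (stackLevel w r j + r j -
        (stackLevel w r j + wpfHeights m w r j - (n - k : ℕ))) = (n - k : ℕ) := by
    constructor
    · intro j
      have := hH j
      have := hw.1 j
      omega
    · have h1 (j : Fin k) : stackLevel w r j + r j -
          (stackLevel w r j + wpfHeights m w r j - (n - k : ℕ)) = (w j : ℤ) - 1 := by
        have := hH j
        omega
      simp only [h1, Finset.sum_sub_distrib]
      rw [← Nat.cast_sum, hw.2]
      simp only [Finset.sum_const, Finset.card_univ, Fintype.card_fin, nsmul_eq_mul, mul_one]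
      omega
  rw [wpfTerm, ← hm, wpfWeight, stackWeight, closedForm]
  simp only [hlev', hsum, hvalid, if_pos hclosed]
  split_ifs with h
  · have hid := exponent_identity m w r hw.1 hwm (by omega) (hw.2.trans h.1.symm) h.2
    have harea : areaOf k (wpfLevel m (wpfHeights m w r)) = areaOf k (stackLevel w r) := by
      rw [areaOf, areaOf]
      congr 1
      exact Finset.sum_congr rfl fun x hx =>
        wpfLevel_wpfHeights m w r hwm _ (Finset.mem_range.mp hx)
    have hml : m - 1 = n - k := by omega
    rw [hml] at hid
    rw [harea]
    set P := pathdinvOf m (wpfHeights m w r)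
    set T := topRank (fun j => stackLevel w r j) (wpfHeights m w r)
    set Mi := minRank (fun j => stackLevel w r j + r j)
      (fun j => stackLevel w r j + wpfHeights m w r j - (n - k : ℕ))
    set Bs := baseRank (fun j => stackLevel w r j) r
    have hexp : qVar ^ ((P : ℤ) - T) * (qVar ^ ((n - k) * totalRank k) * qVar⁻¹ ^ Mi) =
        qVar ^ (-(Bs : ℤ)) := by
      rw [inv_pow, ← zpow_natCast, ← zpow_natCast, ← zpow_neg, ← zpow_add₀ qVar_ne_zero,
        ← zpow_add₀ qVar_ne_zero]
      congr 1
      push_cast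
      linarith
    rw [← hexp]
    ring
  · rw [zero_mul, zero_mul]

/-- For fixed `r`, the map from `w` to `r + m - w` is a bijection onto the heights with nonzero
term. The bound on `B` makes room for the at most `n - k` boxes that the additional labels put in a
column. -/
theorem sum_wpfTerm (hk : k ≤ n) (B : ℕ) (f : (Fin k → ℤ) → (Fin k → ℤ) → QT) (r : Fin k → ℕ)
    (hr : ∀ j, r j + (n - k) ≤ B) :
    ∑ h ∈ heightBox k B, wpfTerm (n - k) qVar f r h = ∑ w ∈ stackHeights n k, stackWeight n w r *
      f (fun j => stackLevel w r j) (fun j => stackLevel w r j + r j) := by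
  symm
  refine Finset.sum_bij_ne_zero (fun w _ _ => wpfHeights (n - k + 1) w r) ?_ ?_ ?_ ?_
  · intro w hw _
    rw [mem_heightBox]
    intro j
    have := (mem_stackHeights.mp hw).1 j
    have := hr j
    rw [wpfHeights]
    omega
  · intro w hw _ w' hw' _ h
    funext j
    have h1 := congrFun h j
    have := stackHeights_le hk hw j
    have := stackHeights_le hk hw' j
    simp only [wpfHeights] at h1
    omega
  · intro h hh hne
    have hcl := right_ne_zero_of_mul (right_ne_zero_of_mul (right_ne_zero_of_mul hne))
    obtain ⟨h1, h2⟩ := (ite_ne_right_iff.mp hcl).1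
    have h3 (j : Fin k) : h j ≤ r j + (n - k) := by
      have := h1 j
      dsimp only at this
      omega
    have h4 (j : Fin k) : wpfLevel (n - k + 1) h j + r j -
        (wpfLevel (n - k + 1) h j + h j - (n - k : ℕ)) =
        ((r j + (n - k + 1) - h j : ℕ) : ℤ) - 1 := by
      have := h3 j
      omega
    -- The closed form is nonzero only if the numbers `w j - 1` are nonnegative with sum `n - k`;
    -- over `k` columns this means `w j ≥ 1` and total `n`.
    have hw : (fun j => r j + (n - k + 1) - h j) ∈ stackHeights n k := by
      rw [mem_stackHeights]
      refine ⟨fun j => ?_, ?_⟩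
      · have := h3 j
        omega
      · simp only [h4, Finset.sum_sub_distrib] at h2
        simp only [Finset.sum_const, Finset.card_univ, Fintype.card_fin, nsmul_eq_mul,
          mul_one] at h2
        zify
        omega
    have hH : wpfHeights (n - k + 1) (fun j => r j + (n - k + 1) - h j) r = h := by
      funext j
      have := h3 j
      rw [wpfHeights]
      omega
    refine ⟨_, hw, ?_, hH⟩
    rw [← wpfTerm_wpfHeights hk hw, hH]
    exact hne
  · intro w hw _
    exact (wpfTerm_wpfHeights hk hw f r).symm

theorem transfer_append_heights {F : Type} [Field F] (q : F) (L L' : List ℕ) (p p' : Fin k → ℤ) :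
    transfer q (L ++ L') p p' = ∑ r ∈ heightBox k L.length,
      transfer q L p (fun j => p j + r j) * transfer q L' (fun j => p j + r j) p' := by
  classical
  rw [transfer_append q L L' p' ((heightBox k L.length).image fun r j => p j + (r j : ℤ)),
    Finset.sum_image]
  · intro r _ s _ h
    funext j
    have := congrFun h j
    dsimp only at this
    omega
  · intro x hx
    rw [Finset.mem_image]
    refine ⟨fun j => (x j - p j).toNat, mem_heightBox.mpr fun j => ?_, funext fun j => ?_⟩
    · have := hx j
      omega
    · have := hx j
      dsimp only
      omega

/-- The labels of `M` are separated from the additional ones at the intermediate heights `r`.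
Complementation rewrites the second factor as `cotransfer`, the signed sum acts on that factor
alone, and its closed form turns the sum over rational heights into one over stacks. -/
theorem signedSum_columnSum (hk : k ≤ n) (M : List ℕ) :
    signedSum 1 (n - k) (fun L => if ∀ a ∈ L, a ≤ k then
      columnSum qVar (M.length + (n - k)) (wpfWeight (n - k + 1))
        (fun (h : Fin k → ℕ) j => wpfLevel (n - k + 1) h j) (M ++ L.map fun a => k - a) else 0) =
    ∑ w ∈ stackHeights n k,
      columnSum qVar M.length (stackWeight n w) (fun h j => stackLevel w h j) M := by
  set l := n - k
  set m := l + 1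
  have h1 (L : List ℕ) (hL : L.length = l) : (if ∀ a ∈ L, a ≤ k then
      columnSum qVar (M.length + l) (wpfWeight m)
        (fun (h : Fin k → ℕ) j => wpfLevel m h j) (M ++ L.map fun a => k - a) else 0) =
      ∑ x ∈ heightBox k (M.length + l) ×ˢ heightBox k M.length,
        (wpfWeight m x.1 * (transfer qVar M (fun j => wpfLevel m x.1 j)
          (fun j => wpfLevel m x.1 j + x.2 j) * qVar ^ (l * totalRank k))) *
          cotransfer qVar⁻¹ L (fun j => wpfLevel m x.1 j + x.2 j)
            (fun j => wpfLevel m x.1 j + x.1 j - l) := by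
    have h2 : (if ∀ a ∈ L, a ≤ k then
      columnSum qVar (M.length + l) (wpfWeight m)
        (fun (h : Fin k → ℕ) j => wpfLevel m h j) (M ++ L.map fun a => k - a) else 0) =
      ∑ x ∈ heightBox k (M.length + l) ×ˢ heightBox k M.length,
        wpfWeight m x.1 * (transfer qVar M (fun j => wpfLevel m x.1 j)
          (fun j => wpfLevel m x.1 j + x.2 j) *
          if ∀ a ∈ L, a ≤ k then transfer qVar (L.map fun a => k - a)
            (fun j => wpfLevel m x.1 j + x.2 j) (fun j => wpfLevel m x.1 j + x.1 j) else 0) := by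
      split_ifs
      · rw [Finset.sum_product]
        refine Finset.sum_congr rfl fun h _ => ?_
        rw [transfer_append_heights, Finset.mul_sum]
      · simp
    rw [h2]
    refine Finset.sum_congr rfl fun x _ => ?_
    rw [transfer_compl qVar qVar_ne_zero, hL]
    ring
  rw [signedSum_congr l 1 _ _ h1, signedSum_sum]
  simp only [signedSum_cotransfer_eq _ (inv_ne_zero qVar_ne_zero)]
  rw [Finset.sum_product_right]
  simp only [columnSum]
  rw [Finset.sum_comm (s := stackHeights n k)]
  refine Finset.sum_congr rfl fun r hr => ?_
  rw [← sum_wpfTerm hk (M.length + l) (transfer qVar M) r fun j =>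
    Nat.add_le_add_right (mem_heightBox.mp hr j) _]
  refine Finset.sum_congr rfl fun h _ => ?_
  rw [wpfTerm]
  ring

end Main

end RiseDelta
end

theorem theorem1p2 (n k : ℕ) (hk : 1 ≤ k) (hkn : k ≤ n) :
    (∃! B : LinearMap.BilinForm QT (SymmFunc QT), IsHallForm QT B) ∧
    (∃! T : SymmFunc QT →ₗ[QT] SymmFunc QT,
      IsSkewing QT (schur QT (rectPartition (n - k) (k - 1))) T) ∧
    ∃ (hW : wpfSeries (k * (n - k + 1)) k ∈ SymmFunc QT)
      (hS : stackedSeries n k ∈ SymmFunc QT),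
      skew QT (schur QT (rectPartition (n - k) (k - 1)))
          ⟨wpfSeries (k * (n - k + 1)) k, hW⟩ =
        ⟨stackedSeries n k, hS⟩ := by
  refine ⟨RiseDelta.existsUnique_hallForm, RiseDelta.existsUnique_skewing _,
    RiseDelta.wpfSeries_mem k (n - k + 1), RiseDelta.stackedSeries_mem n k,
    RiseDelta.symmFunc_ext fun α => ?_⟩
  obtain ⟨τ, M, rfl⟩ := RiseDelta.exists_listExp α
  rw [RiseDelta.coeffL_embDomain, RiseDelta.coeffL_embDomain,
    RiseDelta.coeffL_skew_rect _ k (n - k) hk fun α i hi =>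
      RiseDelta.wpfSeries_eq_zero k (n - k + 1) α i hi]
  have hL (L : List ℕ) (B : ℕ) (hB : L.length ≤ B) :
      RiseDelta.coeffL QT (RiseDelta.listExp L) ⟨wpfSeries (k * (n - k + 1)) k,
        RiseDelta.wpfSeries_mem k (n - k + 1)⟩ =
      RiseDelta.columnSum qVar B (RiseDelta.wpfWeight (n - k + 1))
        (fun (h : Fin k → ℕ) j => RiseDelta.wpfLevel (n - k + 1) h j) L := by
    refine (RiseDelta.wpfSeries_vecExp hB L.get).trans ?_
    rw [List.ofFn_get]
  have hR : RiseDelta.coeffL QT (RiseDelta.listExp M) ⟨stackedSeries n k,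
        RiseDelta.stackedSeries_mem n k⟩ =
      ∑ w ∈ RiseDelta.stackHeights n k, RiseDelta.columnSum qVar M.length
        (RiseDelta.stackWeight n w) (fun h j => RiseDelta.stackLevel w h j) M := by
    refine (RiseDelta.stackedSeries_vecExp le_rfl M.get).trans ?_
    rw [List.ofFn_get]
  rw [hR, ← RiseDelta.signedSum_columnSum hkn]
  refine RiseDelta.signedSum_congr _ _ _ _ fun L hl => ?_
  -- The bound is the total number of labels, independent of the word `L`, so the same set of
  -- heights serves every term of the signed sum.
  rw [hL _ (M.length + (n - k)) (by simp [hl])]
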